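/- Let $G$ be a finite-dimensional real Lie group with Lie algebra $\mathfrak g$, let $\pi:P\to M$ be a smooth principal $G$-bundle over a finite-dimensional smooth manifold $M$, let $A$ be a connection on $P$ with curvature $F=dA+A\wedge A$, and let $B$ be a smooth $\mathfrak g$-valued $2$-form on $M$ that transforms in the adjoint representation (a $2$-form with values in $\operatorname{Ad}P$). Fix $p_0\in P$ and put $x_0=\pi(p_0)$. Let $\Omega(M,x_0)$ be the space of smooth parametrized loops $x:[0,2\pi]\to M$ with $x(0)=x(2\pi)=x_0$. For such a loop let $W(\sigma)$ denote parallel transport along $x$ from $x(0)$ to $x(\sigma)$ with respect to $A$, that is, the solution of $W'+A_\mu(x)\,x'^\mu\,W=0$, $W(0)=1$; for $X=B$ or $X=F$ let $X^W(\sigma)=W(\sigma)^{-1}X(x(\sigma))W(\sigma)$ be the value of $X$ at $x(\sigma)$ transported back to $x_0$, a $2$-form on $T_{x(\sigma)}M$ with values in the Lie algebra $\mathfrak g$ (the fibre of $\operatorname{Ad}P$ at $x_0$ is identified with $\mathfrak g$ through $p_0$). The loop space connection is the $\mathfrak g$-valued $1$-form on $\Omega(M,x_0)$ $$\mathcal A[x](\delta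 x)=\int_0^{2\pi}B^W(\sigma)\bigl(x'(\sigma),\delta x(\sigma)\bigr)\,d\sigma .$$ $\mathcal A$ is called *curvature local* if the integrand of the nonlocal commutator term of its curvature $\delta\mathcal A+\mathcal A\wedge\mathcal A$ vanishes, that is, if for all loops $x\in\Omega(M,x_0)$, all $\sigma\ne\sigma'$ in $[0,2\pi]$ and all $u\in T_{x(\sigma')}M$, $v\in T_{x(\sigma)}M$, $$\theta(\sigma-\sigma')\bigl[(B^W-F^W)(\sigma')(x'(\sigma'),u),\,B^W(\sigma)(x'(\sigma),v)\bigr]-\theta(\sigma'-\sigma)\bigl[(B^W-F^W)(\sigma)(x'(\sigma),v),\,B^W(\sigma')(x'(\sigma'),u)\bigr]=0,$$ where $\theta$ is the Heaviside step function. A loop of loops is a smooth map $\Gamma:[0,2\pi]^2\to M$, $(\sigma,\tau)\mapsto\Gamma(\sigma,\tau)$, with $\Gamma(0,\tau)=\Gamma(2\pi,\tau)=x_0$ for all $\tau$ and $\Gamma(\sigma,0)=\Gamma(\sigma,2\pi)$ for all $\sigma$. Its holonomy is $\mathrm{hol}(\Gamma)=\mathcal W(2\pi)\in G$, where $\mathcal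 W'(\tau)+\mathcal A[\Gamma(\cdot,\tau)](\partial_\tau\Gamma(\cdot,\tau))\,\mathcal W(\tau)=0$ on $[0,2\pi]$ and $\mathcal W(0)=1$. $\mathcal A$ is called *r-flat* if $\mathrm{hol}(\Gamma\circ h)=\mathrm{hol}(\Gamma)$ for every loop of loops $\Gamma$ and every smooth diffeomorphism $h$ of $[0,2\pi]^2$ that is the identity on the boundary and is connected to the identity by a smooth path of such diffeomorphisms. **Theorem.** $\mathcal A$ is curvature local if and only if $\mathcal A$ is r-flat. -/

import Mathlib

open scoped Manifold ContDiff

noncomputable section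

namespace LoopSpace

section Bundle

variable (EM EP EG : Type*)
  [NormedAddCommGroup EM] [NormedSpace ℝ EM]
  [NormedAddCommGroup EP] [NormedSpace ℝ EP]
  [NormedAddCommGroup EG] [NormedSpace ℝ EG]
  (M P G : Type*)
  [TopologicalSpace M] [ChartedSpace EM M]
  [TopologicalSpace P] [ChartedSpace EP P]
  [TopologicalSpace G] [ChartedSpace EG G] [Group G]

/-- A smooth principal `G`-bundle `P → M`: a smooth projection, a smooth free right action of `G`
on `P` along the fibres, and local trivialisations. A local trivialisation over `U` is recorded
by a smooth local section `s` and by the smooth `G`-component `ψ` of the inverse of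
`(y, g) ↦ s y · g`. -/
structure PrincipalBundle where
  proj : P → M
  act : P → G → P
  contMDiff_proj : ContMDiff 𝓘(ℝ, EP) 𝓘(ℝ, EM) ∞ proj
  contMDiff_act :
    ContMDiff (𝓘(ℝ, EP).prod 𝓘(ℝ, EG)) 𝓘(ℝ, EP) ∞ (fun q : P × G => act q.1 q.2)
  act_one : ∀ p, act p 1 = p
  act_mul : ∀ p g h, act p (g * h) = act (act p g) h
  act_free : ∀ p g, act p g = p → g = 1
  proj_act : ∀ p g, proj (act p g) = proj p
  locallyTrivial : ∀ x : M, ∃ U : Set M, IsOpen U ∧ x ∈ U ∧ ∃ (s : M → P) (ψ : P → G),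
    ContMDiffOn 𝓘(ℝ, EM) 𝓘(ℝ, EP) ∞ s U ∧ (∀ y ∈ U, proj (s y) = y) ∧
    ContMDiffOn 𝓘(ℝ, EP) 𝓘(ℝ, EG) ∞ ψ (proj ⁻¹' U) ∧
    ∀ p ∈ proj ⁻¹' U, act (s (proj p)) (ψ p) = p

variable {EG G}

/-- The adjoint action `Ad g` on the Lie algebra: the derivative at `1` of `a ↦ g a g⁻¹`. -/
def Ad (g : G) (ξ : GroupLieAlgebra 𝓘(ℝ, EG) G) : GroupLieAlgebra 𝓘(ℝ, EG) G :=
  mfderiv 𝓘(ℝ, EG) 𝓘(ℝ, EG) (fun a : G => g * a * g⁻¹) 1 ξ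

/-- The right-invariant vector field `g ↦ ξ g` of an element `ξ` of the Lie algebra. -/
def rightInvariant (ξ : GroupLieAlgebra 𝓘(ℝ, EG) G) (g : G) : TangentSpace 𝓘(ℝ, EG) g :=
  mfderiv 𝓘(ℝ, EG) 𝓘(ℝ, EG) (fun a : G => a * g) 1 ξ

/-- The tangent space of `G` at `1` is, in the preferred chart, the model space: an element of the
Lie algebra seen as an element of the normed space `EG`, in which one integrates and
differentiates. -/
def toModel (ξ : GroupLieAlgebra 𝓘(ℝ, EG) G) : EG := ξ

/-- The inverse of `toModel`. -/
def ofModel (ξ : EG) : GroupLieAlgebra 𝓘(ℝ, EG) G := ξ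

variable {EM EP M P}

/-- The coordinate vector field with constant coordinates `U` in the chart of `P` centred at `c`,
at the point with coordinates `y`. -/
def coordVector (c : P) (U y : EP) :
    TangentSpace 𝓘(ℝ, EP) ((extChartAt 𝓘(ℝ, EP) c).symm y) :=
  mfderiv 𝓘(ℝ, EP) 𝓘(ℝ, EP) (extChartAt 𝓘(ℝ, EP) c).symm y U

/-- The component along `U` of a Lie algebra valued one-form, in the chart of `P` centred
at `c`. -/
def component (θ : ∀ p : P, TangentSpace 𝓘(ℝ, EP) p →L[ℝ] GroupLieAlgebra 𝓘(ℝ, EG) G)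
    (c : P) (U y : EP) : EG :=
  toModel (θ ((extChartAt 𝓘(ℝ, EP) c).symm y) (coordVector c U y))

/-- A connection on a principal bundle, given by its connection form: a smooth Lie algebra valued
one-form on the total space which reproduces the generators of the vertical vector fields and is
equivariant under the structure group. -/
structure Connection (Q : PrincipalBundle EM EP EG M P G) where
  form : ∀ p : P, TangentSpace 𝓘(ℝ, EP) p →L[ℝ] GroupLieAlgebra 𝓘(ℝ, EG) G
  smooth : ∀ (c : P) (U : EP),
    ContDiffOn ℝ ∞ (component form c U) (extChartAt 𝓘(ℝ, EP) c).target
  form_vertical : ∀ (p : P) (ξ : GroupLieAlgebra 𝓘(ℝ, EG) G),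
    form (Q.act p 1) (mfderiv 𝓘(ℝ, EG) 𝓘(ℝ, EP) (fun g : G => Q.act p g) 1 ξ) = ξ
  form_act : ∀ (p : P) (g : G) (V : TangentSpace 𝓘(ℝ, EP) p),
    form (Q.act p g) (mfderiv 𝓘(ℝ, EP) 𝓘(ℝ, EP) (fun q : P => Q.act q g) p V) =
      Ad g⁻¹ (form p V)

/-- A Lie algebra valued two-form `B` on the base that transforms in the adjoint representation,
that is, a two-form with values in the adjoint bundle: `B p` is the value of the two-form at
`proj p`, written in the gauge `p`. Smoothness is that of the pull-back of the form to `P`. -/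
structure AdjointTwoForm (Q : PrincipalBundle EM EP EG M P G) where
  toFun : ∀ p : P,
    (TangentSpace 𝓘(ℝ, EM) (Q.proj p)) [⋀^Fin 2]→L[ℝ] (GroupLieAlgebra 𝓘(ℝ, EG) G)
  act : ∀ (p : P) (g : G) (u v : TangentSpace 𝓘(ℝ, EM) (Q.proj p)),
    toFun (Q.act p g) ![u, v] = Ad g⁻¹ (toFun p ![u, v])
  smooth : ∀ (c : P) (U V : EP),
    ContDiffOn ℝ ∞
      (fun y : EP =>
        toModel (toFun ((extChartAt 𝓘(ℝ, EP) c).symm y)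
          ![mfderiv 𝓘(ℝ, EP) 𝓘(ℝ, EM) Q.proj _ (coordVector c U y),
            mfderiv 𝓘(ℝ, EP) 𝓘(ℝ, EM) Q.proj _ (coordVector c V y)]))
      (extChartAt 𝓘(ℝ, EP) c).target

variable {Q : PrincipalBundle EM EP EG M P G}

namespace Connection

/-- The curvature two-form `dω + [ω, ω] / 2` of the connection form `ω` on the total space,
`(U, V) ↦ dω(U, V) + [ω U, ω V]`. The exterior derivative at `p` is computed in the chart centred
at `p`, through which the tangent space at `p` is identified with the model space. -/
def curvatureForm (C : Connection Q) (p : P) (U V : TangentSpace 𝓘(ℝ, EP) p) :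
    GroupLieAlgebra 𝓘(ℝ, EG) G :=
  let z : EP := extChartAt 𝓘(ℝ, EP) p p
  ofModel (fderiv ℝ (component C.form p V) z U - fderiv ℝ (component C.form p U) z V) + ⁅C.form p U, C.form p V⁆

/-- The horizontal lift to `p` of a tangent vector of the base at `proj p`: the unique tangent
vector that projects to it and is annihilated by the connection form. -/
def horizontalVector (C : Connection Q) (p : P) (u : TangentSpace 𝓘(ℝ, EM) (Q.proj p)) :
    TangentSpace 𝓘(ℝ, EP) p :=
  Classical.epsilon fun U : TangentSpace 𝓘(ℝ, EP) p =>
    mfderiv 𝓘(ℝ, EP) 𝓘(ℝ, EM) Q.proj p U = u ∧ C.form p U = 0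

/-- The curvature `F` of the connection as a two-form on the base in the adjoint representation:
`F p u v` is the value of `F(u, v)` at `proj p` in the gauge `p`. -/
def curvature (C : Connection Q) (p : P) (u v : TangentSpace 𝓘(ℝ, EM) (Q.proj p)) :
    GroupLieAlgebra 𝓘(ℝ, EG) G :=
  C.curvatureForm p (C.horizontalVector p u) (C.horizontalVector p v)

end Connection

end Bundle

/-- The parameter interval of loops. -/
abbrev interval : Set ℝ := Set.Icc 0 (2 * Real.pi)

/-- The square of parameters `(σ, τ)` of loops of loops. -/
abbrev square : Set (ℝ × ℝ) := interval ×ˢ interval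

/-- The Heaviside step function. -/
def heaviside (t : ℝ) : ℝ := if 0 < t then 1 else 0

section Loops

variable {EM EP EG : Type*}
  [NormedAddCommGroup EM] [NormedSpace ℝ EM]
  [NormedAddCommGroup EP] [NormedSpace ℝ EP]
  [NormedAddCommGroup EG] [NormedSpace ℝ EG]
  {M P G : Type*}
  [TopologicalSpace M] [ChartedSpace EM M]
  [TopologicalSpace P] [ChartedSpace EP P]
  [TopologicalSpace G] [ChartedSpace EG G] [Group G]

/-- The velocity of a curve. -/
def velocity {E N : Type*} [NormedAddCommGroup E] [NormedSpace ℝ E] [TopologicalSpace N]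
    [ChartedSpace E N] (x : ℝ → N) (t : ℝ) : TangentSpace 𝓘(ℝ, E) (x t) :=
  mfderiv 𝓘(ℝ, ℝ) 𝓘(ℝ, E) x t (1 : ℝ)

/-- A parametrised loop `[0, 2π] → M` based at `x₀`, smooth on the closed interval. As usual, a map
on a closed interval is smooth when it is the restriction of a smooth map on the line; the values
outside `[0, 2π]` play no role. -/
structure IsLoop (EM : Type*) [NormedAddCommGroup EM] [NormedSpace ℝ EM] {M : Type*}
    [TopologicalSpace M] [ChartedSpace EM M] (x₀ : M) (x : ℝ → M) : Prop where
  smooth : ContMDiff 𝓘(ℝ, ℝ) 𝓘(ℝ, EM) ∞ x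
  start : x 0 = x₀
  finish : x (2 * Real.pi) = x₀

/-- A loop of loops: a map `(σ, τ) ↦ Γ (σ, τ)` from the square to `M`, smooth on the closed square
(the restriction of a smooth map on the plane), such that every `Γ (·, τ)` is a loop at `x₀`, and
such that the loops for `τ = 0` and `τ = 2π` coincide. -/
structure IsLoopOfLoops (EM : Type*) [NormedAddCommGroup EM] [NormedSpace ℝ EM] {M : Type*}
    [TopologicalSpace M] [ChartedSpace EM M] (x₀ : M) (Γ : ℝ × ℝ → M) : Prop where
  smooth : ContMDiff 𝓘(ℝ, ℝ × ℝ) 𝓘(ℝ, EM) ∞ Γ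
  left : ∀ τ ∈ interval, Γ (0, τ) = x₀
  right : ∀ τ ∈ interval, Γ (2 * Real.pi, τ) = x₀
  closed : ∀ σ ∈ interval, Γ (σ, 0) = Γ (σ, 2 * Real.pi)

/-- A smooth diffeomorphism of the closed square that is the identity on its boundary. -/
structure IsSquareDiffeo (h : ℝ × ℝ → ℝ × ℝ) : Prop where
  smooth : ContDiff ℝ ∞ h
  mapsTo : Set.MapsTo h square square
  exists_inverse : ∃ k : ℝ × ℝ → ℝ × ℝ, ContDiff ℝ ∞ k ∧ Set.MapsTo k square square ∧
    Set.LeftInvOn k h square ∧ Set.RightInvOn k h square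
  boundary : ∀ z ∈ frontier square, h z = z

/-- A reparametrisation of the square: a diffeomorphism of the square, the identity on the
boundary, that is connected to the identity by a smooth path of such diffeomorphisms. -/
def IsReparametrization (h : ℝ × ℝ → ℝ × ℝ) : Prop :=
  IsSquareDiffeo h ∧ ∃ H : ℝ → ℝ × ℝ → ℝ × ℝ,
    ContDiff ℝ ∞ (fun q : ℝ × ℝ × ℝ => H q.1 q.2) ∧
    (∀ s ∈ Set.Icc (0 : ℝ) 1, IsSquareDiffeo (H s)) ∧
    (∀ z ∈ square, H 0 z = z) ∧ ∀ z ∈ square, H 1 z = h z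

variable {Q : PrincipalBundle EM EP EG M P G}

/-- `p` is a horizontal lift of the curve `x`, starting at `p₀`. In a local section `s` with
`p = s(x) · W`, this is the parallel transport equation `W' + A(x') W = 0`. -/
structure IsHorizontalLift (C : Connection Q) (p₀ : P) (x : ℝ → M) (p : ℝ → P) : Prop where
  start : p 0 = p₀
  lift : ∀ σ, Q.proj (p σ) = x σ
  differentiable : MDifferentiable 𝓘(ℝ, ℝ) 𝓘(ℝ, EP) p
  horizontal : ∀ σ, C.form (p σ) (velocity p σ) = 0

/-- Parallel transport along `x`: the unique horizontal lift of `x` starting at `p₀`. -/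
def horizontalLift (C : Connection Q) (p₀ : P) (x : ℝ → M) : ℝ → P :=
  @Classical.epsilon _ ⟨fun _ => p₀⟩ fun p => IsHorizontalLift C p₀ x p

/-- `B^W(σ)` evaluated on tangent vectors at `x σ`: the value of `B` at `x σ`, parallel transported
back to the base point along `x`, and expressed in the gauge `p₀`. -/
def transportedB (C : Connection Q) (B : AdjointTwoForm Q) (p₀ : P) (x : ℝ → M) (σ : ℝ)
    (u v : TangentSpace 𝓘(ℝ, EM) (x σ)) : GroupLieAlgebra 𝓘(ℝ, EG) G :=
  B.toFun (horizontalLift C p₀ x σ) ![u, v]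

/-- `F^W(σ)` evaluated on tangent vectors at `x σ`: the curvature of the connection, parallel
transported back to the base point along `x`. -/
def transportedF (C : Connection Q) (p₀ : P) (x : ℝ → M) (σ : ℝ)
    (u v : TangentSpace 𝓘(ℝ, EM) (x σ)) : GroupLieAlgebra 𝓘(ℝ, EG) G :=
  C.curvature (horizontalLift C p₀ x σ) u v

/-- The loop space connection: the Lie algebra valued one-form on the space of loops whose value
at the loop `x`, on a variation `δx` of `x`, is `∫ B^W(σ)(x'(σ), δx(σ)) dσ` over `[0, 2π]`. -/
def loopConnection (C : Connection Q) (B : AdjointTwoForm Q) (p₀ : P) (x : ℝ → M)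
    (δx : ∀ σ : ℝ, TangentSpace 𝓘(ℝ, EM) (x σ)) : GroupLieAlgebra 𝓘(ℝ, EG) G :=
  ofModel (∫ σ in (0 : ℝ)..(2 * Real.pi),
    toModel (transportedB C B p₀ x σ (velocity x σ) (δx σ)))

/-- The value of the loop space connection on the velocity at time `τ` of the curve of loops
`τ ↦ Γ (·, τ)`. -/
def loopConnectionAt (C : Connection Q) (B : AdjointTwoForm Q) (p₀ : P) (Γ : ℝ × ℝ → M) (τ : ℝ) :
    GroupLieAlgebra 𝓘(ℝ, EG) G :=
  loopConnection C B p₀ (fun σ => Γ (σ, τ)) (fun σ => velocity (fun t => Γ (σ, t)) τ)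

/-- `W` solves on `[0, 2π]` the parallel transport equation `W' + 𝒜(∂Γ/∂τ) W = 0`, `W(0) = 1`, of
the loop space connection along the loop of loops `Γ`. -/
structure IsLoopTransport (C : Connection Q) (B : AdjointTwoForm Q) (p₀ : P) (Γ : ℝ × ℝ → M)
    (W : ℝ → G) : Prop where
  start : W 0 = 1
  equation : ∀ τ ∈ interval,
    HasMFDerivWithinAt 𝓘(ℝ, ℝ) 𝓘(ℝ, EG) W interval τ
      (ContinuousLinearMap.toSpanSingleton ℝ
        (-rightInvariant (loopConnectionAt C B p₀ Γ τ) (W τ)))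

/-- The holonomy of the loop space connection along the loop of loops `Γ`: the value at `τ = 2π`
of the solution of the parallel transport equation. -/
def holonomy (C : Connection Q) (B : AdjointTwoForm Q) (p₀ : P) (Γ : ℝ × ℝ → M) : G :=
  (Classical.epsilon fun W : ℝ → G => IsLoopTransport C B p₀ Γ W) (2 * Real.pi)

/-- The loop space connection is *curvature local*: the integrand of the nonlocal commutator term
of its curvature vanishes, for all loops and all pairs of parameters. -/
def CurvatureLocal (C : Connection Q) (B : AdjointTwoForm Q) (p₀ : P) : Prop :=
  ∀ x : ℝ → M, IsLoop EM (Q.proj p₀) x → ∀ σ ∈ interval, ∀ σ' ∈ interval,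
    ∀ (u : TangentSpace 𝓘(ℝ, EM) (x σ')) (v : TangentSpace 𝓘(ℝ, EM) (x σ)),
      heaviside (σ - σ') •
          ⁅transportedB C B p₀ x σ' (velocity x σ') u - transportedF C p₀ x σ' (velocity x σ') u,
            transportedB C B p₀ x σ (velocity x σ) v⁆
        - heaviside (σ' - σ) •
          ⁅transportedB C B p₀ x σ (velocity x σ) v - transportedF C p₀ x σ (velocity x σ) v,
            transportedB C B p₀ x σ' (velocity x σ') u⁆ = 0

/-- The loop space connection is *r-flat*: its holonomy along every loop of loops is invariant
under all reparametrisations of the square. -/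
def RFlat (C : Connection Q) (B : AdjointTwoForm Q) (p₀ : P) : Prop :=
  ∀ Γ : ℝ × ℝ → M, IsLoopOfLoops EM (Q.proj p₀) Γ →
    ∀ h : ℝ × ℝ → ℝ × ℝ, IsReparametrization h →
      holonomy C B p₀ (Γ ∘ h) = holonomy C B p₀ Γ

end Loops

end LoopSpace

end

/-!
The holonomy of a flat connection is invariant under homotopies, and on families of loops that stay in
one surface the only obstruction to the flatness of the loop space connection is the nonlocal
commutator. Conversely, reparametrisations can exchange the order of two variations of a loop that
take place at different parameters, and the invariance of the holonomy under the exchange is,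
infinitesimally, the vanishing of the nonlocal commutator.

From curvature locality to r-flatness: the path from the identity to a reparametrisation is a
homotopy `H` of the square relative to its boundary, and `Γ ∘ H` is a family of loops with two
parameters `τ` and `s` that stays in one surface. Therefore the pull-back of `B` is covariantly
closed (`covariant_pull_cyclic`), whatever `B` is. In a gauge of horizontal lifts the curvature `F`
of `A` is the derivative along the loop of the remaining components of `A`
(`hasDerivAt_pullForm_of_horizontal`), and curvature locality allows to replace the primitives of
`F` by those of `B` inside commutators (`integral_adL_sub_adL`). The two facts together say that the
loop space connection is flat on the `(τ, s)`-strip (`loopConnection_flat`), so that the holonomy does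
not depend on `s` (`transport_eq_of_flat`, `holonomy_eq_of_homotopy`).

From r-flatness to curvature locality: take two variations of a loop, one before the parameter `m`
and one after it (`SeparatedVariations`), and let the loop of loops switch on the first, then the
second, then switch off the second and the first. It has trivial holonomy, for it runs back along
its own path (`holonomy_glue_of_rest`). A reparametrisation of the square which shifts in time only
the parameters after `m` turns it into a loop of loops that runs once around a rectangle in the plane
of the two variations (`exists_time_profiles`), whose holonomy is a group commutator
(`holonomy_glue_of_rectangle`). Hence the transports of the two variations commute
(`commute_of_rFlat`). The precise relation is `V (k U) = (k U) V`, where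
`U` and `V` are the transports and `k` is the change that the first variation makes in the parallel
transport of `A` up to `m`; the logarithmic derivative of `k` is the integral of `F`. Differentiation
gives the smeared form of the condition, with `B - F` in the first slot
(`adL_integral_eq_zero_of_rFlat`), and test functions localise it (`curvatureLocal_of_rFlat`).

The calculus in Lie groups that this needs is built first: right logarithmic derivatives, which turn
equations `g' = ξ g` into equations of maps to the model space of the Lie algebra, global solutions of
these equations and their smooth dependence on parameters, and, from these, horizontal lifts of
families of curves. Tangent spaces are identified throughout with the model spaces, through the
preferred charts.
-/

open Topology NNReal
open Set Filter

set_option linter.unusedSectionVars false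

noncomputable section

namespace LoopSpace

/-! ### The Lie group near the identity: the adjoint action and logarithmic derivatives -/

section LieGroupCalculus

variable {EG : Type*} [NormedAddCommGroup EG] [NormedSpace ℝ EG]
  {G : Type*} [TopologicalSpace G] [ChartedSpace EG G] [Group G]

variable (EG G) in
/-- The preferred chart of a Lie group at the identity. -/
abbrev logChart : PartialEquiv G EG := extChartAt 𝓘(ℝ, EG) (1 : G)

variable (EG G) in
/-- The coordinates of the identity in the preferred chart. -/
abbrev logOne : EG := logChart EG G 1

variable (G) in
/-- The group multiplication in the preferred chart at the identity. -/
def chartMul (q : EG × EG) : EG :=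
  logChart EG G ((logChart EG G).symm q.1 * (logChart EG G).symm q.2)

/-- Conjugation by `g` in the preferred chart at the identity. -/
def chartConj (g : G) (y : EG) : EG :=
  logChart EG G (g * (logChart EG G).symm y * g⁻¹)

/-- The adjoint action, as a continuous linear map of the model space: the derivative of
conjugation in the preferred chart. -/
def AdL (g : G) : EG →L[ℝ] EG := fderiv ℝ (chartConj g) (logOne EG G)

theorem logChart_symm_one : (logChart EG G).symm (logOne EG G) = 1 :=
  extChartAt_to_inv (I := 𝓘(ℝ, EG)) (1 : G)

theorem logOne_mem_target : logOne EG G ∈ (logChart EG G).target :=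
  mem_extChartAt_target (I := 𝓘(ℝ, EG)) (1 : G)

theorem one_mem_source : (1 : G) ∈ (logChart EG G).source :=
  mem_extChartAt_source (I := 𝓘(ℝ, EG)) (1 : G)

theorem logChart_left_inv {g : G} (hg : g ∈ (logChart EG G).source) :
    (logChart EG G).symm (logChart EG G g) = g := (logChart EG G).left_inv hg

variable [LieGroup 𝓘(ℝ, EG) ∞ G]

theorem contMDiffAt_logChart {g : G} (hg : g ∈ (logChart EG G).source) :
    ContMDiffAt 𝓘(ℝ, EG) 𝓘(ℝ, EG) ∞ (logChart EG G) g :=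
  have : IsManifold 𝓘(ℝ, EG) ∞ G := LieGroup.toContMDiffMul.toIsManifold
  contMDiffAt_extChartAt' (by simpa using hg)

theorem contMDiffAt_logChart_symm {y : EG} (hy : y ∈ (logChart EG G).target) :
    ContMDiffAt 𝓘(ℝ, EG) 𝓘(ℝ, EG) ∞ (logChart EG G).symm y :=
  have : IsManifold 𝓘(ℝ, EG) ∞ G := LieGroup.toContMDiffMul.toIsManifold
  (contMDiffOn_extChartAt_symm (1 : G)).contMDiffAt ((isOpen_extChartAt_target (1 : G)).mem_nhds hy)

theorem contDiffAt_chartMul {x y : EG} (hx : x ∈ (logChart EG G).target)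
    (hy : y ∈ (logChart EG G).target)
    (hxy : (logChart EG G).symm x * (logChart EG G).symm y ∈ (logChart EG G).source) :
    ContDiffAt ℝ ∞ (chartMul G) (x, y) := by
  rw [← contMDiffAt_iff_contDiffAt]
  have h1 : ContMDiffAt 𝓘(ℝ, EG × EG) 𝓘(ℝ, EG) ∞
      (fun q : EG × EG => (logChart EG G).symm q.1) (x, y) :=
    ContMDiffAt.comp (x, y) (contMDiffAt_logChart_symm hx) (contDiff_fst.contMDiff).contMDiffAt
  have h2 : ContMDiffAt 𝓘(ℝ, EG × EG) 𝓘(ℝ, EG) ∞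
      (fun q : EG × EG => (logChart EG G).symm q.2) (x, y) :=
    ContMDiffAt.comp (x, y) (contMDiffAt_logChart_symm hy) (contDiff_snd.contMDiff).contMDiffAt
  exact ContMDiffAt.comp (x, y) (contMDiffAt_logChart hxy) (h1.mul h2)

theorem logChart_mul {g k : G} (hg : g ∈ (logChart EG G).source) (hk : k ∈ (logChart EG G).source) :
    logChart EG G (g * k) = chartMul G (logChart EG G g, logChart EG G k) := by
  simp only [chartMul, logChart_left_inv hg, logChart_left_inv hk]

theorem contDiffAt_chartMul_one {y : EG} (hy : y ∈ (logChart EG G).target) :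
    ContDiffAt ℝ ∞ (chartMul G) (logOne EG G, y) := by
  refine contDiffAt_chartMul logOne_mem_target hy ?_
  rw [logChart_symm_one, one_mul]
  exact (logChart EG G).map_target hy

theorem eventually_target {y : EG} (hy : y ∈ (logChart EG G).target) :
    ∀ᶠ z in 𝓝 y, z ∈ (logChart EG G).target :=
  (isOpen_extChartAt_target (1 : G)).mem_nhds hy

theorem isOpen_source : IsOpen (logChart EG G).source := isOpen_extChartAt_source (1 : G)

theorem chartMul_one_left {y : EG} (hy : y ∈ (logChart EG G).target) :
    chartMul G (logOne EG G, y) = y := by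
  simp only [chartMul, logChart_symm_one, one_mul]
  exact (logChart EG G).right_inv hy

theorem chartMul_one_right {y : EG} (hy : y ∈ (logChart EG G).target) :
    chartMul G (y, logOne EG G) = y := by
  simp only [chartMul, logChart_symm_one, mul_one]
  exact (logChart EG G).right_inv hy

variable (G) in
/-- The derivative of the multiplication with respect to the left factor at the identity, in the
preferred chart: the coordinate expression of right-invariant vector fields. -/
def rightField (y : EG) : EG →L[ℝ] EG :=
  fderiv ℝ (fun x => chartMul G (x, y)) (logOne EG G)

theorem contDiffAt_rightField {y : EG} (hy : y ∈ (logChart EG G).target) :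
    ContDiffAt ℝ ∞ (rightField G) y := by
  refine ContDiffAt.fderiv (f := fun y x => chartMul G (x, y)) (g := fun _ => logOne EG G)
    (n := ∞) (m := ∞) ?_ contDiffAt_const le_rfl
  exact ContDiffAt.comp (y, logOne EG G) (f := fun q : EG × EG => (q.2, q.1))
    (contDiffAt_chartMul_one hy) (contDiff_snd.prodMk contDiff_fst).contDiffAt

theorem hasFDerivAt_rightField {y : EG} (hy : y ∈ (logChart EG G).target) :
    HasFDerivAt (fun x => chartMul G (x, y)) (rightField G y) (logOne EG G) := by
  refine DifferentiableAt.hasFDerivAt ?_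
  have h := (contDiffAt_chartMul_one hy).differentiableAt (by simp)
  exact DifferentiableAt.comp (logOne EG G) (f := fun x => (x, y)) h
    (differentiableAt_id.prodMk (differentiableAt_const _))

theorem hasFDerivAt_chartMul_one : HasFDerivAt (chartMul G)
    (ContinuousLinearMap.fst ℝ EG EG + ContinuousLinearMap.snd ℝ EG EG)
    (logOne EG G, logOne EG G) := by
  have h := ((contDiffAt_chartMul_one (EG := EG) (G := G) logOne_mem_target).differentiableAt
    (by simp)).hasFDerivAt
  set D := fderiv ℝ (chartMul G) (logOne EG G, logOne EG G)
  have h1 : D.comp (ContinuousLinearMap.inl ℝ EG EG) = ContinuousLinearMap.id ℝ EG := by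
    have e : (fun x => chartMul G (x, logOne EG G)) =ᶠ[𝓝 (logOne EG G)] fun x => x := by
      filter_upwards [eventually_target (G := G) logOne_mem_target] with x hx
      exact chartMul_one_right hx
    exact (h.comp (logOne EG G) (f := fun x => (x, logOne EG G))
      (hasFDerivAt_prodMk_left _ _)).unique ((hasFDerivAt_id _).congr_of_eventuallyEq e)
  have h2 : D.comp (ContinuousLinearMap.inr ℝ EG EG) = ContinuousLinearMap.id ℝ EG := by
    have e : (fun x => chartMul G (logOne EG G, x)) =ᶠ[𝓝 (logOne EG G)] fun x => x := by
      filter_upwards [eventually_target (G := G) logOne_mem_target] with x hx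
      exact chartMul_one_left hx
    exact (h.comp (logOne EG G) (f := fun x => (logOne EG G, x))
      (hasFDerivAt_prodMk_right _ _)).unique ((hasFDerivAt_id _).congr_of_eventuallyEq e)
  have hD : D = ContinuousLinearMap.fst ℝ EG EG + ContinuousLinearMap.snd ℝ EG EG := by
    ext v
    · simpa using DFunLike.congr_fun h1 v
    · simpa using DFunLike.congr_fun h2 v
  rwa [hD] at h

theorem rightField_one : rightField G (logOne EG G) = ContinuousLinearMap.id ℝ EG := by
  have h := (hasFDerivAt_chartMul_one (G := G)).comp (logOne EG G) (f := fun x => (x, logOne EG G))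
      (hasFDerivAt_prodMk_left _ _)
  refine (HasFDerivAt.fderiv h).trans ?_
  ext; simp

theorem contDiffAt_chartConj (g : G) {y : EG} (hy : y ∈ (logChart EG G).target)
    (hg : g * (logChart EG G).symm y * g⁻¹ ∈ (logChart EG G).source) :
    ContDiffAt ℝ ∞ (fun y => chartConj g y) y := by
  rw [← contMDiffAt_iff_contDiffAt]
  exact ContMDiffAt.comp y (contMDiffAt_logChart hg)
    ((contMDiffAt_const.mul (contMDiffAt_logChart_symm hy)).mul contMDiffAt_const)

theorem conj_one_mem (g : G) : g * (logChart EG G).symm (logOne EG G) * g⁻¹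
    ∈ (logChart EG G).source := by
  rw [logChart_symm_one]; simp only [mul_one, mul_inv_cancel]; exact one_mem_source

theorem hasFDerivAt_chartConj (g : G) : HasFDerivAt (chartConj g) (AdL g) (logOne EG G) :=
  ((contDiffAt_chartConj g (logOne_mem_target (EG := EG) (G := G)) (conj_one_mem g)).differentiableAt
    (by simp)).hasFDerivAt

theorem chartConj_one (g : G) : chartConj g (logOne EG G) = logOne EG G := by
  simp only [chartConj, logChart_symm_one, mul_one, mul_inv_cancel]

theorem AdL_one : AdL (1 : G) = ContinuousLinearMap.id ℝ EG := by
  refine (hasFDerivAt_chartConj (1 : G)).unique ((hasFDerivAt_id _).congr_of_eventuallyEq ?_)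
  filter_upwards [eventually_target (EG := EG) (G := G) logOne_mem_target] with x hx
  simp only [chartConj, one_mul, inv_one, mul_one, id]
  exact (logChart EG G).right_inv hx

theorem continuousAt_logChart_symm {y : EG} (hy : y ∈ (logChart EG G).target) :
    ContinuousAt (logChart EG G).symm y := (contMDiffAt_logChart_symm hy).continuousAt

theorem AdL_mul (g k : G) : AdL (EG := EG) (g * k) = (AdL g).comp (AdL k) := by
  have : IsTopologicalGroup G := topologicalGroup_of_lieGroup 𝓘(ℝ, EG) ∞
  have h : HasFDerivAt (chartConj g) (AdL g) (chartConj k (logOne EG G)) := by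
    rw [chartConj_one]; exact hasFDerivAt_chartConj g
  refine (hasFDerivAt_chartConj (g * k)).unique
    ((h.comp (logOne EG G) (hasFDerivAt_chartConj k)).congr_of_eventuallyEq ?_)
  have hc : ContinuousAt (fun x => k * (logChart EG G).symm x * k⁻¹) (logOne EG G) :=
    (continuousAt_const.mul (continuousAt_logChart_symm logOne_mem_target)).mul
      continuousAt_const
  filter_upwards [hc.preimage_mem_nhds (isOpen_source.mem_nhds (conj_one_mem k))] with x hx
  simp only [Function.comp, chartConj, logChart_left_inv hx]
  congr 1; group

theorem chartConj_logChart {g k : G} (hk : k ∈ (logChart EG G).source) :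
    chartConj g (logChart EG G k) = logChart EG G (g * k * g⁻¹) := by
  simp only [chartConj, logChart_left_inv hk]

section LogDeriv

variable {V : Type*} [NormedAddCommGroup V] [NormedSpace ℝ V]

/-- `r` is the right logarithmic derivative `(dg) g⁻¹` of `g : V → G` at `z` within `s`: the
derivative at `z` of `w ↦ g w (g z)⁻¹`, in the preferred chart at the identity. -/
def HasLogDerivWithinAt (g : V → G) (r : V →L[ℝ] EG) (s : Set V) (z : V) : Prop :=
  ContinuousWithinAt g s z ∧
    HasFDerivWithinAt (fun w => logChart EG G (g w * (g z)⁻¹)) r s z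

/-- `r` is the right logarithmic derivative `(dg) g⁻¹` of `g : V → G` at `z`. -/
abbrev HasLogDerivAt (g : V → G) (r : V →L[ℝ] EG) (z : V) : Prop :=
  HasLogDerivWithinAt g r univ z

variable {g k : V → G} {r r' : V →L[ℝ] EG} {s : Set V} {z : V}

theorem HasLogDerivWithinAt.mono {t : Set V} (h : HasLogDerivWithinAt g r s z) (hst : t ⊆ s) :
    HasLogDerivWithinAt g r t z := ⟨h.1.mono hst, h.2.mono hst⟩

theorem HasLogDerivWithinAt.congr (h : HasLogDerivWithinAt g r s z) (he : k =ᶠ[𝓝[s] z] g)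
    (hz : k z = g z) : HasLogDerivWithinAt k r s z :=
  ⟨h.1.congr_of_eventuallyEq he hz, h.2.congr_of_eventuallyEq
    (he.mono fun w hw => by simp only [hw, hz]) (by simp only [hz])⟩

theorem HasLogDerivWithinAt.unique_at (h : HasLogDerivAt g r z)
    (h' : HasLogDerivAt g r' z) : r = r' :=
  (hasFDerivWithinAt_univ.1 h.2).unique (hasFDerivWithinAt_univ.1 h'.2)

theorem hasLogDerivWithinAt_const (a : G) : HasLogDerivWithinAt (fun _ : V => a) (0 : V →L[ℝ] EG) s z :=
  ⟨continuousWithinAt_const, hasFDerivWithinAt_const _ _ _⟩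

theorem HasLogDerivWithinAt.comp {V' : Type*} [NormedAddCommGroup V'] [NormedSpace ℝ V']
    {f : V' → V} {f' : V' →L[ℝ] V} {t : Set V'} {y : V'} (h : HasLogDerivWithinAt g r s (f y))
    (hf : HasFDerivWithinAt f f' t y) (hst : MapsTo f t s) :
    HasLogDerivWithinAt (fun y => g (f y)) (r.comp f') t y :=
  ⟨h.1.comp hf.continuousWithinAt hst, h.2.comp y hf hst⟩

theorem HasLogDerivWithinAt.eventually_source (h : HasLogDerivWithinAt g r s z) :
    ∀ᶠ w in 𝓝[s] z, g w * (g z)⁻¹ ∈ (logChart EG G).source := by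
  have : IsTopologicalGroup G := topologicalGroup_of_lieGroup 𝓘(ℝ, EG) ∞
  have h1 : ContinuousWithinAt (fun w => g w * (g z)⁻¹) s z := h.1.mul continuousWithinAt_const
  refine h1.preimage_mem_nhdsWithin (isOpen_source.mem_nhds ?_)
  simp only [mul_inv_cancel]; exact one_mem_source

/-- The product rule: the logarithmic derivative of `g k` is `(dg) g⁻¹ + Ad g ((dk) k⁻¹)`. -/
theorem HasLogDerivWithinAt.mul (hg : HasLogDerivWithinAt g r s z)
    (hk : HasLogDerivWithinAt k r' s z) :
    HasLogDerivWithinAt (fun w => g w * k w) (r + (AdL (g z)).comp r') s z := by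
  have : IsTopologicalGroup G := topologicalGroup_of_lieGroup 𝓘(ℝ, EG) ∞
  refine ⟨hg.1.mul hk.1, ?_⟩
  have hc : HasFDerivWithinAt (fun w => chartConj (g z) (logChart EG G (k w * (k z)⁻¹)))
      ((AdL (g z)).comp r') s z := by
    refine HasFDerivAt.comp_hasFDerivWithinAt z (g := chartConj (g z)) ?_ hk.2
    simp only [mul_inv_cancel]
    exact hasFDerivAt_chartConj (g z)
  have hm : HasFDerivWithinAt (fun w => chartMul G (logChart EG G (g w * (g z)⁻¹),
      chartConj (g z) (logChart EG G (k w * (k z)⁻¹)))) (r + (AdL (g z)).comp r') s z := by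
    have := HasFDerivAt.comp_hasFDerivWithinAt z
      (f := fun w => (logChart EG G (g w * (g z)⁻¹),
        chartConj (g z) (logChart EG G (k w * (k z)⁻¹))))
      (g := chartMul G)
      (g' := ContinuousLinearMap.fst ℝ EG EG + ContinuousLinearMap.snd ℝ EG EG)
      (by simp only [mul_inv_cancel, chartConj_one]; exact hasFDerivAt_chartMul_one)
      (hg.2.prodMk hc)
    refine this.congr_fderiv ?_
    ext v; simp
  have hcont : ContinuousWithinAt (fun w => g z * (k w * (k z)⁻¹) * (g z)⁻¹) s z :=
    (continuousWithinAt_const.mul (hk.1.mul continuousWithinAt_const)).mul continuousWithinAt_const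
  have hsrc := hcont.preimage_mem_nhdsWithin (t := (logChart EG G).source)
    (isOpen_source.mem_nhds (by simp only [mul_inv_cancel, mul_one]; exact one_mem_source))
  -- the identity `g k (g₀ k₀)⁻¹ = (g g₀⁻¹) · g₀ (k k₀⁻¹) g₀⁻¹`, in the chart
  have key : ∀ w, g w * (g z)⁻¹ ∈ (logChart EG G).source →
      k w * (k z)⁻¹ ∈ (logChart EG G).source →
      g z * (k w * (k z)⁻¹) * (g z)⁻¹ ∈ (logChart EG G).source →
      logChart EG G (g w * k w * (g z * k z)⁻¹) = chartMul G (logChart EG G (g w * (g z)⁻¹),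
      chartConj (g z) (logChart EG G (k w * (k z)⁻¹))) := by
    intro w h1 h2 h3
    rw [chartConj_logChart h2, ← logChart_mul h1 h3]
    congr 1; group
  refine hm.congr_of_eventuallyEq ?_ ?_
  · filter_upwards [hg.eventually_source, hk.eventually_source, hsrc] with w h1 h2 h3
    exact key w h1 h2 h3
  · apply key <;> simp only [mul_inv_cancel, mul_one] <;> exact one_mem_source

variable (G) in
/-- The group inverse in the preferred chart at the identity. -/
def chartInv (y : EG) : EG := logChart EG G ((logChart EG G).symm y)⁻¹

/-- The derivative of the inverse at the identity is `-1`: differentiate `x · x⁻¹ = 1`. -/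
theorem hasFDerivAt_chartInv :
    HasFDerivAt (chartInv G) (-ContinuousLinearMap.id ℝ EG) (logOne EG G) := by
  have : IsTopologicalGroup G := topologicalGroup_of_lieGroup 𝓘(ℝ, EG) ∞
  have hs : ((logChart EG G).symm (logOne EG G))⁻¹ ∈ (logChart EG G).source := by
    rw [logChart_symm_one, inv_one]; exact one_mem_source
  have hd : ContDiffAt ℝ ∞ (chartInv G) (logOne EG G) := by
    rw [← contMDiffAt_iff_contDiffAt]
    exact ContMDiffAt.comp (logOne EG G) (contMDiffAt_logChart hs)
      (contMDiffAt_logChart_symm logOne_mem_target).inv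
  have h := (hd.differentiableAt (by simp)).hasFDerivAt
  have h1 : chartInv G (logOne EG G) = logOne EG G := by
    simp only [chartInv, logChart_symm_one, inv_one]
  have h2 := HasFDerivAt.comp (logOne EG G) (f := fun y => (y, chartInv G y)) (g := chartMul G)
    (g' := ContinuousLinearMap.fst ℝ EG EG + ContinuousLinearMap.snd ℝ EG EG)
    (by simp only [h1]; exact hasFDerivAt_chartMul_one) ((hasFDerivAt_id _).prodMk h)
  have hc : ContinuousAt (fun y => ((logChart EG G).symm y)⁻¹) (logOne EG G) :=
    (continuousAt_logChart_symm (G := G) logOne_mem_target).inv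
  have h3 : (fun y => chartMul G (y, chartInv G y)) =ᶠ[𝓝 (logOne EG G)]
      fun _ => logOne EG G := by
    filter_upwards [hc.preimage_mem_nhds (isOpen_source.mem_nhds hs)] with y hy
    simp only [chartMul, chartInv, logChart_left_inv hy, mul_inv_cancel]
  have h4 := h2.unique ((hasFDerivAt_const _ _).congr_of_eventuallyEq h3)
  refine h.congr_fderiv ?_
  ext v
  have := DFunLike.congr_fun h4 v
  simp at this ⊢
  exact eq_neg_of_add_eq_zero_right this

theorem HasLogDerivWithinAt.inv (hg : HasLogDerivWithinAt g r s z) :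
    HasLogDerivWithinAt (fun w => (g w)⁻¹) (-(AdL (g z)⁻¹).comp r) s z := by
  have : IsTopologicalGroup G := topologicalGroup_of_lieGroup 𝓘(ℝ, EG) ∞
  refine ⟨hg.1.inv, ?_⟩
  have h1 : HasFDerivWithinAt (fun w => chartInv G (logChart EG G (g w * (g z)⁻¹)))
      (-r) s z := by
    refine (HasFDerivAt.comp_hasFDerivWithinAt z (g := chartInv G)
      (g' := -ContinuousLinearMap.id ℝ EG) ?_ hg.2).congr_fderiv (by ext; simp)
    simp only [mul_inv_cancel]
    exact hasFDerivAt_chartInv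
  have h2 : HasFDerivWithinAt
      (fun w => chartConj (g z)⁻¹ (chartInv G (logChart EG G (g w * (g z)⁻¹))))
      (-(AdL (g z)⁻¹).comp r) s z := by
    refine (HasFDerivAt.comp_hasFDerivWithinAt z (g := chartConj (g z)⁻¹)
      (g' := LoopSpace.AdL (g z)⁻¹) ?_ h1).congr_fderiv
      (by ext; simp)
    simp only [mul_inv_cancel, chartInv, logChart_symm_one, inv_one]
    exact hasFDerivAt_chartConj _
  have hcont : ContinuousWithinAt (fun w => (g w * (g z)⁻¹)⁻¹) s z :=
    (hg.1.mul continuousWithinAt_const).inv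
  have hsrc := hcont.preimage_mem_nhdsWithin (t := (logChart EG G).source)
    (isOpen_source.mem_nhds (by simp only [mul_inv_cancel, inv_one]; exact one_mem_source))
  -- the identity `g⁻¹ g₀ = g₀⁻¹ (g g₀⁻¹)⁻¹ g₀`, in the chart
  have key : ∀ w, g w * (g z)⁻¹ ∈ (logChart EG G).source →
      (g w * (g z)⁻¹)⁻¹ ∈ (logChart EG G).source →
      logChart EG G ((g w)⁻¹ * (g z)⁻¹⁻¹) =
        chartConj (g z)⁻¹ (chartInv G (logChart EG G (g w * (g z)⁻¹))) := by
    intro w h1 h2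
    rw [chartInv, logChart_left_inv h1, chartConj_logChart h2]
    congr 1; group
  refine h2.congr_of_eventuallyEq ?_ ?_
  · filter_upwards [hg.eventually_source, hsrc] with w h1 h2
    exact key w h1 h2
  · apply key <;> simp only [mul_inv_cancel, inv_one] <;> exact one_mem_source

end LogDeriv

theorem AdL_inv_comp (g : G) : (AdL g⁻¹).comp (AdL g) = ContinuousLinearMap.id ℝ EG := by
  rw [← AdL_mul, inv_mul_cancel, AdL_one]

theorem AdL_inv_apply (g : G) (v : EG) : AdL g⁻¹ (AdL g v) = v :=
  DFunLike.congr_fun (AdL_inv_comp g) v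

theorem AdL_apply_inv (g : G) (v : EG) : AdL g (AdL g⁻¹ v) = v := by
  have := AdL_inv_apply g⁻¹ v
  rwa [inv_inv] at this

variable (G) in
/-- The adjoint action as a function of the coordinates of the group element. -/
def chartAd (x : EG) : EG →L[ℝ] EG := AdL ((logChart EG G).symm x)

theorem contDiffAt_chartAd : ContDiffAt ℝ ∞ (chartAd G) (logOne EG G) := by
  refine ContDiffAt.fderiv (f := fun x y => chartConj ((logChart EG G).symm x) y)
    (g := fun _ => logOne EG G) (n := ∞) (m := ∞) ?_ contDiffAt_const le_rfl
  rw [← contMDiffAt_iff_contDiffAt]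
  have h1 : ContMDiffAt 𝓘(ℝ, EG × EG) 𝓘(ℝ, EG) ∞
      (fun q : EG × EG => (logChart EG G).symm q.1) (logOne EG G, logOne EG G) :=
    ContMDiffAt.comp _ (contMDiffAt_logChart_symm logOne_mem_target)
      (contDiff_fst.contMDiff).contMDiffAt
  have h2 : ContMDiffAt 𝓘(ℝ, EG × EG) 𝓘(ℝ, EG) ∞
      (fun q : EG × EG => (logChart EG G).symm q.2) (logOne EG G, logOne EG G) :=
    ContMDiffAt.comp _ (contMDiffAt_logChart_symm logOne_mem_target)
      (contDiff_snd.contMDiff).contMDiffAt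
  exact ContMDiffAt.comp _ (contMDiffAt_logChart (conj_one_mem _)) ((h1.mul h2).mul h1.inv)

theorem contMDiff_AdL : ContMDiff 𝓘(ℝ, EG) 𝓘(ℝ, EG →L[ℝ] EG) ∞ (AdL : G → EG →L[ℝ] EG) := by
  have : IsTopologicalGroup G := topologicalGroup_of_lieGroup 𝓘(ℝ, EG) ∞
  intro g
  have h1 : ContMDiffAt 𝓘(ℝ, EG) 𝓘(ℝ, EG) ∞ (fun k => logChart EG G (k * g⁻¹)) g :=
    ContMDiffAt.comp g (contMDiffAt_logChart (by rw [mul_inv_cancel]; exact one_mem_source))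
      (contMDiffAt_id.mul contMDiffAt_const)
  have h2 : ContMDiffAt 𝓘(ℝ, EG) 𝓘(ℝ, EG →L[ℝ] EG) ∞
      (fun k => chartAd G (logChart EG G (k * g⁻¹))) g := by
    refine ContMDiffAt.comp g (g := chartAd G) ?_ h1
    simp only [mul_inv_cancel]
    exact contDiffAt_chartAd.contMDiffAt
  have h3 : ContMDiffAt 𝓘(ℝ, EG) 𝓘(ℝ, EG →L[ℝ] EG) ∞
      (fun k => (chartAd G (logChart EG G (k * g⁻¹))).comp (AdL g)) g :=
    h2.clm_comp contMDiffAt_const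
  refine h3.congr_of_eventuallyEq ?_
  have hc : ContinuousAt (fun k => k * g⁻¹) g := continuousAt_id.mul continuousAt_const
  filter_upwards [hc.preimage_mem_nhds (isOpen_source.mem_nhds (by
    rw [mul_inv_cancel]; exact one_mem_source (EG := EG)))] with k hk
  rw [chartAd, logChart_left_inv hk, ← AdL_mul, inv_mul_cancel_right]

variable (EG G) in
/-- The derivative of the adjoint action at the identity. -/
def adL : EG →L[ℝ] EG →L[ℝ] EG := fderiv ℝ (chartAd G) (logOne EG G)

theorem hasFDerivAt_chartAd : HasFDerivAt (chartAd G) (adL EG G) (logOne EG G) :=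
  (contDiffAt_chartAd.differentiableAt (by simp)).hasFDerivAt

section LogDeriv

variable {V : Type*} [NormedAddCommGroup V] [NormedSpace ℝ V]
variable {g k : V → G} {r r' : V →L[ℝ] EG} {s : Set V} {z : V}

theorem HasLogDerivWithinAt.AdL (h : HasLogDerivWithinAt g r s z) :
    HasFDerivWithinAt (fun w => LoopSpace.AdL (g w))
      (((ContinuousLinearMap.compL ℝ EG EG EG).flip (LoopSpace.AdL (g z))).comp
        ((adL EG G).comp r)) s z := by
  have h1 : HasFDerivWithinAt (fun w => chartAd G (logChart EG G (g w * (g z)⁻¹)))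
      ((adL EG G).comp r) s z := by
    refine HasFDerivAt.comp_hasFDerivWithinAt z (g := chartAd G) ?_ h.2
    simp only [mul_inv_cancel]
    exact hasFDerivAt_chartAd
  have h2 := ((ContinuousLinearMap.compL ℝ EG EG EG).flip
    (LoopSpace.AdL (g z))).hasFDerivAt.comp_hasFDerivWithinAt z h1
  have key : ∀ w, g w * (g z)⁻¹ ∈ (logChart EG G).source → LoopSpace.AdL (g w) =
      (chartAd G (logChart EG G (g w * (g z)⁻¹))).comp (LoopSpace.AdL (g z)) := by
    intro w hw
    rw [chartAd, logChart_left_inv hw, ← AdL_mul, inv_mul_cancel_right]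
  refine h2.congr_of_eventuallyEq ?_ (key z (by rw [mul_inv_cancel]; exact one_mem_source))
  filter_upwards [h.eventually_source] with w hw
  exact key w hw

theorem HasLogDerivWithinAt.AdL_apply (h : HasLogDerivWithinAt g r s z) {f : V → EG}
    {f' : V →L[ℝ] EG} (hf : HasFDerivWithinAt f f' s z) :
    HasFDerivWithinAt (fun w => LoopSpace.AdL (g w) (f w))
      ((adL EG G).flip (LoopSpace.AdL (g z) (f z)) ∘L r + (LoopSpace.AdL (g z)).comp f') s z := by
  refine (h.AdL.clm_apply hf).congr_fderiv ?_
  ext v; simp [add_comm]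

end LogDeriv

end LieGroupCalculus

/-! ### The bracket as the derivative of the adjoint action -/

section LieGroupBracket

variable {EG : Type*} [NormedAddCommGroup EG] [NormedSpace ℝ EG]
  {G : Type*} [TopologicalSpace G] [ChartedSpace EG G] [Group G] [LieGroup 𝓘(ℝ, EG) ∞ G]

/-- The preferred chart identifies the tangent space at the identity with the model space by the
identity map. -/
theorem mfderiv_logChart_symm_one :
    mfderiv 𝓘(ℝ, EG) 𝓘(ℝ, EG) (logChart EG G).symm (logOne EG G) =
      ContinuousLinearMap.id ℝ EG := by
  have : IsManifold 𝓘(ℝ, EG) ∞ G := LieGroup.toContMDiffMul.toIsManifold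
  have : IsManifold 𝓘(ℝ, EG) 1 G := IsManifold.of_le (n := ∞) (by simp)
  have h := mfderivWithin_range_extChartAt_symm (I := 𝓘(ℝ, EG)) (x := (1 : G))
  rw [modelWithCornersSelf_coe, range_id, mfderivWithin_univ] at h
  exact h

/-- The derivative of the multiplication with respect to the right factor at the identity, in the
preferred chart: the coordinate expression of left-invariant vector fields. -/
def leftField (G : Type*) [TopologicalSpace G] [ChartedSpace EG G] [Group G] (x : EG) :
    EG →L[ℝ] EG := fderiv ℝ (fun y => chartMul G (x, y)) (logOne EG G)

theorem contDiffAt_chartMul_right {x : EG} (hx : x ∈ (logChart EG G).target) :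
    ContDiffAt ℝ ∞ (chartMul G) (x, logOne EG G) := by
  refine contDiffAt_chartMul hx logOne_mem_target ?_
  rw [logChart_symm_one, mul_one]
  exact (logChart EG G).map_target hx

theorem leftField_eq {x : EG} (hx : x ∈ (logChart EG G).target) : leftField G x =
    (fderiv ℝ (chartMul G) (x, logOne EG G)).comp (ContinuousLinearMap.inr ℝ EG EG) :=
  (HasFDerivAt.comp (logOne EG G) (f := fun y => (x, y))
    ((contDiffAt_chartMul_right hx).differentiableAt (by simp)).hasFDerivAt
    (hasFDerivAt_prodMk_right _ _)).fderiv

theorem rightField_eq {y : EG} (hy : y ∈ (logChart EG G).target) : rightField G y =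
    (fderiv ℝ (chartMul G) (logOne EG G, y)).comp (ContinuousLinearMap.inl ℝ EG EG) :=
  (HasFDerivAt.comp (logOne EG G) (f := fun x => (x, y))
    ((contDiffAt_chartMul_one hy).differentiableAt (by simp)).hasFDerivAt
    (hasFDerivAt_prodMk_left _ _)).fderiv

theorem hasFDerivAt_leftField {x : EG} (hx : x ∈ (logChart EG G).target) :
    HasFDerivAt (fun y => chartMul G (x, y)) (leftField G x) (logOne EG G) := by
  rw [leftField_eq hx]
  exact HasFDerivAt.comp (logOne EG G) (f := fun y => (x, y))
    ((contDiffAt_chartMul_right hx).differentiableAt (by simp)).hasFDerivAt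
    (hasFDerivAt_prodMk_right _ _)

variable (EG G) in
/-- The second derivative of the multiplication at the identity, in the preferred chart. -/
def chartMulSnd : EG × EG →L[ℝ] EG × EG →L[ℝ] EG :=
  fderiv ℝ (fderiv ℝ (chartMul G)) (logOne EG G, logOne EG G)

theorem hasFDerivAt_fderiv_chartMul : HasFDerivAt (fderiv ℝ (chartMul G)) (chartMulSnd EG G)
    (logOne EG G, logOne EG G) :=
  (((contDiffAt_chartMul_one (EG := EG) (G := G) logOne_mem_target).fderiv_right
    (m := ∞) le_rfl).differentiableAt (by simp)).hasFDerivAt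

theorem hasFDerivAt_leftField_apply (w : EG) : HasFDerivAt (fun x => leftField G x w)
    (((chartMulSnd EG G).flip (0, w)).comp (ContinuousLinearMap.inl ℝ EG EG)) (logOne EG G) := by
  have h := HasFDerivAt.comp (logOne EG G) (f := fun x : EG => (x, logOne EG G))
    (hasFDerivAt_fderiv_chartMul (EG := EG) (G := G)) (hasFDerivAt_prodMk_left _ _)
  refine ((h.clm_apply (hasFDerivAt_const ((0 : EG), w) _)).congr_fderiv
    (by ext; simp)).congr_of_eventuallyEq ?_
  filter_upwards [eventually_target (EG := EG) (G := G) logOne_mem_target] with x hx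
  rw [leftField_eq hx]; simp

theorem hasFDerivAt_rightField_one : HasFDerivAt (fun x => rightField G x)
    ((fderiv ℝ (rightField G) (logOne EG G))) (logOne EG G) :=
  ((contDiffAt_rightField (EG := EG) (G := G) logOne_mem_target).differentiableAt
    (by simp)).hasFDerivAt

theorem fderiv_rightField_one (v w : EG) : fderiv ℝ (rightField G) (logOne EG G) v w =
    chartMulSnd EG G (0, v) (w, 0) := by
  have h := HasFDerivAt.comp (logOne EG G) (f := fun y : EG => (logOne EG G, y))
    (hasFDerivAt_fderiv_chartMul (EG := EG) (G := G)) (hasFDerivAt_prodMk_right _ _)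
  have h2 : HasFDerivAt (fun x => rightField G x w)
    (((chartMulSnd EG G).flip (w, 0)).comp (ContinuousLinearMap.inr ℝ EG EG)) (logOne EG G) := by
    refine ((h.clm_apply (hasFDerivAt_const (w, (0 : EG)) _)).congr_fderiv
      (by ext; simp)).congr_of_eventuallyEq ?_
    filter_upwards [eventually_target (EG := EG) (G := G) logOne_mem_target] with x hx
    rw [rightField_eq hx]; simp
  have h3 := (hasFDerivAt_rightField_one (EG := EG) (G := G)).clm_apply
    (hasFDerivAt_const w (logOne EG G))
  simpa using DFunLike.congr_fun (h3.unique h2) v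

/-- `L_x = R_x ∘ Ad x`, in coordinates. -/
theorem leftField_eq_rightField_comp : ∀ᶠ x in 𝓝 (logOne EG G),
    leftField G x = (rightField G x).comp (chartAd G x) := by
  have : IsTopologicalGroup G := topologicalGroup_of_lieGroup 𝓘(ℝ, EG) ∞
  filter_upwards [eventually_target (EG := EG) (G := G) logOne_mem_target] with x hx
  have h1 := HasFDerivAt.comp (logOne EG G) (f := fun y => chartConj ((logChart EG G).symm x) y)
    (g := fun z => chartMul G (z, x)) (g' := rightField G x)
    (by simp only [chartConj_one]; exact hasFDerivAt_rightField hx)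
    (hasFDerivAt_chartConj ((logChart EG G).symm x))
  refine (hasFDerivAt_leftField hx).unique (h1.congr_of_eventuallyEq ?_)
  have hc : ContinuousAt (fun y => (logChart EG G).symm x * (logChart EG G).symm y *
      ((logChart EG G).symm x)⁻¹) (logOne EG G) :=
    (continuousAt_const.mul (continuousAt_logChart_symm logOne_mem_target)).mul continuousAt_const
  filter_upwards [hc.preimage_mem_nhds (isOpen_source.mem_nhds (conj_one_mem _))] with y hy
  simp only [Function.comp, chartMul, chartConj, logChart_left_inv hy, inv_mul_cancel_right]

/-- The derivative of the adjoint action is the antisymmetric part of the second derivative of the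
multiplication: differentiate `L_x = R_x ∘ Ad x` at the identity. -/
theorem adL_eq_chartMulSnd (v w : EG) : adL EG G v w =
    chartMulSnd EG G (v, 0) (0, w) - chartMulSnd EG G (w, 0) (0, v) := by
  have h1 := ((hasFDerivAt_rightField_one (EG := EG) (G := G)).clm_apply
    ((hasFDerivAt_chartAd (EG := EG) (G := G)).clm_apply (hasFDerivAt_const w (logOne EG G))))
  have h2 := h1.congr_of_eventuallyEq (f₁ := fun x => leftField G x w) (by
    filter_upwards [leftField_eq_rightField_comp (EG := EG) (G := G)] with x hx
    rw [hx]; rfl)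
  have h3 := DFunLike.congr_fun (h2.unique (hasFDerivAt_leftField_apply w)) v
  have hs : IsSymmSndFDerivAt ℝ (chartMul G) (logOne EG G, logOne EG G) :=
    (contDiffAt_chartMul_one (EG := EG) (G := G) logOne_mem_target).isSymmSndFDerivAt
      (by rw [minSmoothness_of_isRCLikeNormedField]; exact ENat.LEInfty.out)
  have h4 : chartMulSnd EG G (0, v) (w, 0) = chartMulSnd EG G (w, 0) (0, v) := hs _ _
  have h5 : chartAd G (logOne EG G) = ContinuousLinearMap.id ℝ EG := by
    rw [chartAd, logChart_symm_one, AdL_one]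
  simp [rightField_one, fderiv_rightField_one, h5, h4] at h3
  rw [← h3]; abel

/-- In the chart at the identity, the left-invariant vector field of `w` is
`x ↦ leftField G x w`. -/
theorem mulInvariantVectorField_chart (w : EG) : ∀ᶠ x in 𝓝 (logOne EG G),
    VectorField.mpullbackWithin 𝓘(ℝ, EG) 𝓘(ℝ, EG) (logChart EG G).symm
      (mulInvariantVectorField (I := 𝓘(ℝ, EG)) (G := G) w) (range 𝓘(ℝ, EG)) x =
    leftField G x w := by
  have : IsManifold 𝓘(ℝ, EG) ∞ G := LieGroup.toContMDiffMul.toIsManifold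
  have : IsManifold 𝓘(ℝ, EG) 1 G := IsManifold.of_le (n := ∞) (by simp)
  have : IsTopologicalGroup G := topologicalGroup_of_lieGroup 𝓘(ℝ, EG) ∞
  filter_upwards [eventually_target (EG := EG) (G := G) logOne_mem_target] with x hx
  have hinv := isInvertible_mfderivWithin_extChartAt_symm (I := 𝓘(ℝ, EG)) (x := (1 : G)) hx
  rw [VectorField.mpullbackWithin_apply]
  rw [modelWithCornersSelf_coe, range_id, mfderivWithin_univ] at hinv ⊢
  have hcont : ContinuousAt (fun y => (logChart EG G).symm x * (logChart EG G).symm y)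
      (logOne EG G) := continuousAt_const.mul (continuousAt_logChart_symm logOne_mem_target)
  have hsx : HasMFDerivAt 𝓘(ℝ, EG) 𝓘(ℝ, EG) (logChart EG G).symm (chartMul G (x, logOne EG G))
      (mfderiv 𝓘(ℝ, EG) 𝓘(ℝ, EG) (logChart EG G).symm (chartMul G (x, logOne EG G))) :=
    ((contMDiffAt_logChart_symm (by rwa [chartMul_one_right hx])).mdifferentiableAt
      (by simp)).hasMFDerivAt
  have h1 := HasMFDerivAt.comp (logOne EG G) hsx (hasFDerivAt_leftField hx).hasMFDerivAt
  have hL : HasMFDerivAt 𝓘(ℝ, EG) 𝓘(ℝ, EG) (fun b : G => (logChart EG G).symm x * b)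
      ((logChart EG G).symm (logOne EG G))
      (mfderiv 𝓘(ℝ, EG) 𝓘(ℝ, EG) (fun b : G => (logChart EG G).symm x * b)
      ((logChart EG G).symm (logOne EG G))) :=
    ((contMDiff_mul_left (I := 𝓘(ℝ, EG)) (n := ∞)).contMDiffAt.mdifferentiableAt
      (by simp)).hasMFDerivAt
  have hs1 : HasMFDerivAt 𝓘(ℝ, EG) 𝓘(ℝ, EG) (logChart EG G).symm (logOne EG G)
      (ContinuousLinearMap.id ℝ EG) := by
    have := ((contMDiffAt_logChart_symm (EG := EG) (G := G) logOne_mem_target).mdifferentiableAt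
      (by simp)).hasMFDerivAt
    rwa [mfderiv_logChart_symm_one] at this
  have h2 := HasMFDerivAt.comp (logOne EG G) hL hs1
  have h3 := h2.congr_of_eventuallyEq
    (f₁ := (logChart EG G).symm ∘ fun y => chartMul G (x, y)) (by
    have hs : (logChart EG G).symm x * (logChart EG G).symm (logOne EG G) ∈
        (logChart EG G).source := by
      rw [logChart_symm_one, mul_one]; exact (logChart EG G).map_target hx
    filter_upwards [hcont.preimage_mem_nhds (isOpen_source.mem_nhds hs)] with y hy
    simp only [Function.comp, chartMul]
    exact logChart_left_inv hy)
  -- the two derivatives at the identity of `y ↦ x y`, computed in the chart and in the group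
  have h4 := DFunLike.congr_fun (hasMFDerivAt_unique h1 h3) w
  rw [chartMul_one_right hx] at h4
  have h5 : mulInvariantVectorField (I := 𝓘(ℝ, EG)) (G := G) w ((logChart EG G).symm x) =
      mfderiv 𝓘(ℝ, EG) 𝓘(ℝ, EG) (logChart EG G).symm x (leftField G x w) := by
    refine Eq.trans ?_ h4.symm
    change mfderiv 𝓘(ℝ, EG) 𝓘(ℝ, EG) (fun b : G => (logChart EG G).symm x * b) 1 w = _
    rw [← logChart_symm_one (EG := EG) (G := G)]
    rfl
  rw [h5]
  exact hinv.inverse_apply_eq.2 rfl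

theorem lieBracketWithin_univ_of_hasFDerivAt {X Y : EG → EG} {X' Y' : EG →L[ℝ] EG} {x a b : EG}
    (hX : HasFDerivAt X X' x) (hY : HasFDerivAt Y Y' x) (ha : X x = a) (hb : Y x = b) :
    VectorField.lieBracketWithin ℝ X Y univ x = Y' a - X' b := by
  rw [VectorField.lieBracketWithin_univ, VectorField.lieBracket_eq]
  simp only [hX.fderiv, hY.fderiv, ha, hb]

/-- The derivative of the adjoint action is the bracket of the Lie algebra. -/
theorem adL_apply (v w : GroupLieAlgebra 𝓘(ℝ, EG) G) :
    adL EG G (toModel v) (toModel w) = toModel ⁅v, w⁆ := by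
  have : IsManifold 𝓘(ℝ, EG) ∞ G := LieGroup.toContMDiffMul.toIsManifold
  have : IsManifold 𝓘(ℝ, EG) 1 G := IsManifold.of_le (n := ∞) (by simp)
  have h : ∀ u : EG, HasFDerivAt (VectorField.mpullbackWithin 𝓘(ℝ, EG) 𝓘(ℝ, EG)
      (logChart EG G).symm (mulInvariantVectorField (I := 𝓘(ℝ, EG)) (G := G) u)
      (range 𝓘(ℝ, EG)))
      (((chartMulSnd EG G).flip (0, u)).comp (ContinuousLinearMap.inl ℝ EG EG))
      (logOne EG G) := fun u =>
    (hasFDerivAt_leftField_apply u).congr_of_eventuallyEq (mulInvariantVectorField_chart u)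
  have h0 : ∀ u : EG, VectorField.mpullbackWithin 𝓘(ℝ, EG) 𝓘(ℝ, EG)
      (logChart EG G).symm (mulInvariantVectorField (I := 𝓘(ℝ, EG)) (G := G) u)
      (range 𝓘(ℝ, EG)) (logOne EG G) = u := by
    intro u
    rw [(mulInvariantVectorField_chart u).self_of_nhds]
    have := leftField_eq_rightField_comp (EG := EG) (G := G).self_of_nhds
    rw [this, rightField_one, chartAd, logChart_symm_one, AdL_one]; rfl
  have key : VectorField.lieBracketWithin ℝ (E := EG)
      (VectorField.mpullbackWithin 𝓘(ℝ, EG) 𝓘(ℝ, EG)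
        (logChart EG G).symm (mulInvariantVectorField (I := 𝓘(ℝ, EG)) (G := G) v)
        (range 𝓘(ℝ, EG)))
      (VectorField.mpullbackWithin 𝓘(ℝ, EG) 𝓘(ℝ, EG)
        (logChart EG G).symm (mulInvariantVectorField (I := 𝓘(ℝ, EG)) (G := G) w)
        (range 𝓘(ℝ, EG))) univ (logOne EG G) =
      chartMulSnd EG G (toModel v, 0) (0, toModel w) -
        chartMulSnd EG G (toModel w, 0) (0, toModel v) := by
    refine (lieBracketWithin_univ_of_hasFDerivAt (h v) (h w) (h0 v) (h0 w)).trans ?_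
    rfl
  have hset : ((extChartAt 𝓘(ℝ, EG) (1 : G)).symm ⁻¹' univ ∩ range 𝓘(ℝ, EG)) = univ := by simp
  have e3 : ∀ z : EG, (ContinuousLinearMap.id ℝ EG).inverse z = z := by
    intro z; rw [ContinuousLinearMap.inverse_id]; rfl
  rw [adL_eq_chartMulSnd, ← key, GroupLieAlgebra.bracket_def, VectorField.mlieBracket,
    VectorField.mlieBracketWithin_apply, hset, mfderiv_extChartAt_self]
  exact (e3 _).symm

end LieGroupBracket

/-! ### Logarithmic derivatives and derivatives of maps of manifolds -/

section LogDerivative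

variable {EG : Type*} [NormedAddCommGroup EG] [NormedSpace ℝ EG]
  {G : Type*} [TopologicalSpace G] [ChartedSpace EG G] [Group G] [LieGroup 𝓘(ℝ, EG) ∞ G]

theorem hasMFDerivAt_logChart_symm_one :
    HasMFDerivAt 𝓘(ℝ, EG) 𝓘(ℝ, EG) (logChart EG G).symm (logOne EG G)
      (ContinuousLinearMap.id ℝ EG) := by
  have := ((contMDiffAt_logChart_symm (EG := EG) (G := G) logOne_mem_target).mdifferentiableAt
    (by simp)).hasMFDerivAt
  rwa [mfderiv_logChart_symm_one] at this

theorem hasMFDerivAt_logChart_one :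
    HasMFDerivAt 𝓘(ℝ, EG) 𝓘(ℝ, EG) (logChart EG G) (1 : G) (ContinuousLinearMap.id ℝ EG) := by
  have : IsManifold 𝓘(ℝ, EG) ∞ G := LieGroup.toContMDiffMul.toIsManifold
  have : IsManifold 𝓘(ℝ, EG) 1 G := IsManifold.of_le (n := ∞) (by simp)
  have h := ((contMDiffAt_logChart (EG := EG) (G := G) one_mem_source).mdifferentiableAt
    (by simp)).hasMFDerivAt
  rwa [mfderiv_extChartAt_self] at h

variable (EG) in
theorem hasMFDerivAt_mul_right (a b : G) : HasMFDerivAt 𝓘(ℝ, EG) 𝓘(ℝ, EG) (fun c : G => c * a) b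
    (mfderiv 𝓘(ℝ, EG) 𝓘(ℝ, EG) (fun c : G => c * a) b) :=
  ((contMDiff_mul_right (I := 𝓘(ℝ, EG)) (n := ∞)).contMDiffAt.mdifferentiableAt
      (by simp)).hasMFDerivAt

/-- The adjoint action computed in the preferred chart is the adjoint action on the Lie algebra. -/
theorem toModel_Ad (g : G) (ξ : GroupLieAlgebra 𝓘(ℝ, EG) G) :
    toModel (Ad g ξ) = AdL g (toModel ξ) := by
  have h1 : HasMFDerivAt 𝓘(ℝ, EG) 𝓘(ℝ, EG) (fun a : G => g * a * g⁻¹) (1 : G)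
      (mfderiv 𝓘(ℝ, EG) 𝓘(ℝ, EG) (fun a : G => g * a * g⁻¹) 1) :=
    (((contMDiff_const.mul contMDiff_id).mul contMDiff_const).contMDiffAt.mdifferentiableAt
      (n := ∞) (by simp)).hasMFDerivAt
  have h0 : g * (1 : G) * g⁻¹ = 1 := by simp
  have hs := hasMFDerivAt_logChart_symm_one (EG := EG) (G := G)
  have hc := hasMFDerivAt_logChart_one (EG := EG) (G := G)
  rw [← logChart_symm_one (EG := EG)] at h1
  have h2 := HasMFDerivAt.comp (logOne EG G) h1 hs
  have hc' : HasMFDerivAt 𝓘(ℝ, EG) 𝓘(ℝ, EG) (logChart EG G)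
      (g * (logChart EG G).symm (logOne EG G) * g⁻¹) (ContinuousLinearMap.id ℝ EG) := by
    rw [logChart_symm_one, h0]; exact hc
  let D : EG →L[ℝ] EG := mfderiv 𝓘(ℝ, EG) 𝓘(ℝ, EG) (fun a : G => g * a * g⁻¹)
    ((logChart EG G).symm (logOne EG G))
  have h3 : HasFDerivAt (chartConj g) ((ContinuousLinearMap.id ℝ EG).comp
      (D.comp (ContinuousLinearMap.id ℝ EG))) (logOne EG G) :=
    (HasMFDerivAt.comp (logOne EG G) (g := logChart EG G) hc' h2).hasFDerivAt
  have h4 := DFunLike.congr_fun (h3.unique (hasFDerivAt_chartConj g)) (toModel ξ)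
  refine Eq.trans ?_ h4
  change mfderiv 𝓘(ℝ, EG) 𝓘(ℝ, EG) (fun a : G => g * a * g⁻¹) 1 ξ = mfderiv 𝓘(ℝ, EG) 𝓘(ℝ, EG)
    (fun a : G => g * a * g⁻¹) ((logChart EG G).symm (logOne EG G)) ξ
  rw [logChart_symm_one]

section

variable {V : Type*} [NormedAddCommGroup V] [NormedSpace ℝ V]
variable {g k : V → G} {r r' : V →L[ℝ] EG} {s : Set V} {z : V}

/-- A map with right logarithmic derivative `r` at `z` has derivative `r` followed by the right
translation by `g z`. -/
theorem HasLogDerivWithinAt.hasMFDerivWithinAt (h : HasLogDerivWithinAt g r s z) :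
    HasMFDerivWithinAt 𝓘(ℝ, V) 𝓘(ℝ, EG) g s z
      ((mfderiv 𝓘(ℝ, EG) 𝓘(ℝ, EG) (fun c : G => c * g z) 1).comp r) := by
  have h1 : HasMFDerivWithinAt 𝓘(ℝ, V) 𝓘(ℝ, EG)
      ((logChart EG G).symm ∘ fun w => logChart EG G (g w * (g z)⁻¹)) s z
      ((ContinuousLinearMap.id ℝ EG).comp r) := by
    refine HasMFDerivAt.comp_hasMFDerivWithinAt z ?_ h.2.hasMFDerivWithinAt
    rw [mul_inv_cancel]; exact hasMFDerivAt_logChart_symm_one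
  have hz : ((logChart EG G).symm ∘ fun w => logChart EG G (g w * (g z)⁻¹)) z = 1 := by
    simp only [Function.comp, mul_inv_cancel, logChart_symm_one]
  have h2 : HasMFDerivWithinAt 𝓘(ℝ, V) 𝓘(ℝ, EG) (fun w => g w * (g z)⁻¹) s z r := by
    refine (h1.congr_of_eventuallyEq ?_ ?_)
    · filter_upwards [h.eventually_source] with w hw
      simp only [Function.comp, logChart_left_inv hw]
    · rw [hz, mul_inv_cancel]
  have h3 := HasMFDerivAt.comp_hasMFDerivWithinAt z (hasMFDerivAt_mul_right EG (g z)
    (g z * (g z)⁻¹)) h2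
  have e : ((fun c : G => c * g z) ∘ fun w => g w * (g z)⁻¹) = g := by
    ext w; simp
  rw [e, mul_inv_cancel] at h3
  exact h3

/-- Converse of `HasLogDerivWithinAt.hasMFDerivWithinAt`. -/
theorem HasMFDerivWithinAt.hasLogDerivWithinAt
    (h : HasMFDerivWithinAt 𝓘(ℝ, V) 𝓘(ℝ, EG) g s z
      ((mfderiv 𝓘(ℝ, EG) 𝓘(ℝ, EG) (fun c : G => c * g z) 1).comp r)) :
    HasLogDerivWithinAt g r s z := by
  refine ⟨h.continuousWithinAt, ?_⟩
  have hc : HasMFDerivAt 𝓘(ℝ, EG) 𝓘(ℝ, EG) (logChart EG G) (g z * (g z)⁻¹)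
      (ContinuousLinearMap.id ℝ EG) := by
    rw [mul_inv_cancel]; exact hasMFDerivAt_logChart_one
  have h1 : HasMFDerivAt 𝓘(ℝ, EG) 𝓘(ℝ, EG) (fun c => logChart EG G (c * (g z)⁻¹)) (g z)
      ((ContinuousLinearMap.id ℝ EG).comp
        (mfderiv 𝓘(ℝ, EG) 𝓘(ℝ, EG) (fun c : G => c * (g z)⁻¹) (g z))) :=
    HasMFDerivAt.comp (g z) (g := logChart EG G) hc (hasMFDerivAt_mul_right EG (g z)⁻¹ (g z))
  have h2 := (HasMFDerivAt.comp_hasMFDerivWithinAt z h1 h).hasFDerivWithinAt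
  have h1' : HasMFDerivAt 𝓘(ℝ, EG) 𝓘(ℝ, EG) (fun c => logChart EG G (c * (g z)⁻¹))
      ((1 : G) * g z) ((ContinuousLinearMap.id ℝ EG).comp
        (mfderiv 𝓘(ℝ, EG) 𝓘(ℝ, EG) (fun c : G => c * (g z)⁻¹) (g z))) := by
    rw [one_mul]; exact h1
  -- right translations by `g z` and by its inverse have inverse derivatives
  have h3 := HasMFDerivAt.comp (1 : G) h1' (hasMFDerivAt_mul_right EG (g z) 1)
  have e : ((fun c => logChart EG G (c * (g z)⁻¹)) ∘ fun c => c * g z) = logChart EG G := by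
    ext w; simp
  rw [e] at h3
  have h4 := hasMFDerivAt_unique h3 hasMFDerivAt_logChart_one
  refine h2.congr_fderiv ?_
  ext v
  exact DFunLike.congr_fun h4 (r v)

/-- The right logarithmic derivative of a map to a Lie group. -/
def logDeriv (g : V → G) (z : V) : V →L[ℝ] EG :=
  fderiv ℝ (fun w => logChart EG G (g w * (g z)⁻¹)) z

theorem hasLogDerivAt_of_mdifferentiableAt (hg : MDifferentiableAt 𝓘(ℝ, V) 𝓘(ℝ, EG) g z) :
    HasLogDerivAt g (logDeriv (EG := EG) g z) z := by
  refine ⟨hg.continuousAt.continuousWithinAt, ?_⟩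
  rw [hasFDerivWithinAt_univ]
  refine DifferentiableAt.hasFDerivAt ?_
  rw [← mdifferentiableAt_iff_differentiableAt]
  have hc : MDifferentiableAt 𝓘(ℝ, EG) 𝓘(ℝ, EG) (fun c => logChart EG G (c * (g z)⁻¹)) (g z) :=
    MDifferentiableAt.comp (g z) (g := logChart EG G)
      ((contMDiffAt_logChart (by rw [mul_inv_cancel]; exact one_mem_source)).mdifferentiableAt
        (by simp)) (hasMFDerivAt_mul_right EG (g z)⁻¹ (g z)).mdifferentiableAt
  exact MDifferentiableAt.comp z (g := fun c => logChart EG G (c * (g z)⁻¹)) (f := g) hc hg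

theorem ContMDiff.hasLogDerivAt (hg : ContMDiff 𝓘(ℝ, V) 𝓘(ℝ, EG) ∞ g) (z : V) :
    HasLogDerivAt g (logDeriv (EG := EG) g z) z :=
  hasLogDerivAt_of_mdifferentiableAt (hg.mdifferentiableAt (by simp))

/-- The derivative in the chart at the identity is obtained from the logarithmic derivative by the
right-invariant fields. -/
theorem HasLogDerivWithinAt.logChart (h : HasLogDerivWithinAt g r s z)
    (hz : g z ∈ (LoopSpace.logChart EG G).source) :
    HasFDerivWithinAt (fun w => LoopSpace.logChart EG G (g w))
      ((rightField G (LoopSpace.logChart EG G (g z))).comp r) s z := by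
  have ht := (LoopSpace.logChart EG G).map_source hz
  have h1 := HasFDerivAt.comp_hasFDerivWithinAt z
    (g := fun x => chartMul G (x, LoopSpace.logChart EG G (g z)))
    (g' := rightField G (LoopSpace.logChart EG G (g z)))
    (by simp only [mul_inv_cancel]; exact hasFDerivAt_rightField ht) h.2
  have key : ∀ w, g w * (g z)⁻¹ ∈ (LoopSpace.logChart EG G).source →
      LoopSpace.logChart EG G (g w) = chartMul G (LoopSpace.logChart EG G (g w * (g z)⁻¹),
        LoopSpace.logChart EG G (g z)) := by
    intro w hw
    rw [← logChart_mul hw hz, inv_mul_cancel_right]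
  refine h1.congr_of_eventuallyEq ?_ (key z (by rw [mul_inv_cancel]; exact one_mem_source))
  filter_upwards [h.eventually_source] with w hw
  exact key w hw

/-- A curve in the chart at the identity that solves the equation of the right-invariant fields
defines a map to the group with the corresponding logarithmic derivative. -/
theorem hasLogDerivWithinAt_of_chart {y : V → EG}
    (hy : HasFDerivWithinAt y ((rightField G (y z)).comp r) s z)
    (hz : y z ∈ (logChart EG G).target) :
    HasLogDerivWithinAt (fun w => (logChart EG G).symm (y w)) r s z := by
  have : IsTopologicalGroup G := topologicalGroup_of_lieGroup 𝓘(ℝ, EG) ∞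
  have hcont : ContinuousWithinAt (fun w => (logChart EG G).symm (y w)) s z :=
    (continuousAt_logChart_symm hz).comp_continuousWithinAt hy.continuousWithinAt
  refine ⟨hcont, ?_⟩
  set a := (logChart EG G).symm (y z)
  have hsm : ContMDiffAt 𝓘(ℝ, EG) 𝓘(ℝ, EG) ∞
      (fun x => logChart EG G ((logChart EG G).symm x * a⁻¹)) (y z) :=
    ContMDiffAt.comp (y z) (contMDiffAt_logChart
      (by rw [mul_inv_cancel]; exact one_mem_source (EG := EG)))
      ((contMDiffAt_logChart_symm hz).mul contMDiffAt_const)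
  have hd := ((contMDiffAt_iff_contDiffAt.1 hsm).differentiableAt (by simp)).hasFDerivAt
  set D := fderiv ℝ (fun x => logChart EG G ((logChart EG G).symm x * a⁻¹)) (y z)
  -- `D` is the inverse of the right-invariant field
  have hD : D.comp (rightField G (y z)) = ContinuousLinearMap.id ℝ EG := by
    have h1 := HasFDerivAt.comp (logOne EG G) (f := fun x => chartMul G (x, y z))
      (g := fun x => logChart EG G ((logChart EG G).symm x * a⁻¹)) (g' := D)
      (by simp only [chartMul_one_left hz]; exact hd) (hasFDerivAt_rightField hz)
    refine h1.unique ((hasFDerivAt_id _).congr_of_eventuallyEq ?_)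
    have hc : ContinuousAt (fun x => (logChart EG G).symm x * a) (logOne EG G) :=
      (continuousAt_logChart_symm (G := G) logOne_mem_target).mul continuousAt_const
    filter_upwards [eventually_target (EG := EG) (G := G) logOne_mem_target,
      hc.preimage_mem_nhds (isOpen_source.mem_nhds (by
        rw [logChart_symm_one, one_mul]; exact (logChart EG G).map_target hz))] with x hx hx'
    have : (logChart EG G).symm (chartMul G (x, y z)) = (logChart EG G).symm x * a :=
      logChart_left_inv hx'
    simp only [Function.comp, this, mul_inv_cancel_right, id]
    exact (logChart EG G).right_inv hx
  refine (hd.comp_hasFDerivWithinAt z hy).congr_fderiv ?_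
  rw [← ContinuousLinearMap.comp_assoc, hD, ContinuousLinearMap.id_comp]

end

end LogDerivative

/-! ### Equations `g' = ξ g` in a Lie group -/

section Gluing

/-- Gluing of local solutions on the line. `Sol f t` says that `f` solves an equation near `t`, and
`Adm t x` that `x` is a possible value at time `t`. If every admissible value at every nearby time
is attained by a solution on an interval that depends on the base time only, and if solutions are
unique, then there is a global solution with a given admissible value at `0`. -/
theorem exists_global_solution {X : Type*} (Sol : (ℝ → X) → ℝ → Prop) (Adm : ℝ → X → Prop)
    (hcongr : ∀ f f' t, f =ᶠ[𝓝 t] f' → Sol f t → Sol f' t)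
    (hadm : ∀ f t, Sol f t → Adm t (f t))
    (hloc : ∀ t₀, ∃ ε > 0, ∀ t₁ ∈ Ioo (t₀ - ε) (t₀ + ε), ∀ x, Adm t₁ x →
      ∃ f : ℝ → X, f t₁ = x ∧ ∀ t ∈ Ioo (t₀ - ε) (t₀ + ε), Sol f t)
    (huniq : ∀ a b f f', ∀ t₁ ∈ Ioo a b, f t₁ = f' t₁ → (∀ t ∈ Ioo a b, Sol f t) →
      (∀ t ∈ Ioo a b, Sol f' t) → EqOn f f' (Ioo a b))
    {x₀ : X} (hx₀ : Adm 0 x₀) : ∃ f, f 0 = x₀ ∧ ∀ t, Sol f t := by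
  classical
  have : Nonempty X := ⟨x₀⟩
  -- `P R`: there is a solution on the interval of radius `R`
  set P : ℝ → Prop := fun R => ∃ f, f 0 = x₀ ∧ ∀ t ∈ Ioo (-R) R, Sol f t with hP
  have hmono : ∀ R R', R ≤ R' → P R' → P R := by
    rintro R R' h ⟨f, h0, hf⟩
    exact ⟨f, h0, fun t ht => hf t ⟨by linarith [ht.1], by linarith [ht.2]⟩⟩
  -- solutions on intervals that exhaust an open set agree by uniqueness, and can be glued
  have hunion : ∀ I : Set ℝ, IsOpen I → (∀ t ∈ I, ∃ R > |t|, P R) →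
      ∃ f, f 0 = x₀ ∧ ∀ t ∈ I, Sol f t := by
    intro I hI h
    choose! D hD hPD using h
    choose! F hF0 hF using hPD
    refine ⟨fun t => if t ∈ I then F t t else x₀, ?_, ?_⟩
    · change (if (0 : ℝ) ∈ I then F 0 0 else x₀) = x₀
      by_cases h0 : (0 : ℝ) ∈ I
      · rw [if_pos h0]; exact hF0 0 h0
      · rw [if_neg h0]
    · intro t ht
      refine hcongr (F t) _ t ?_ (hF t ht t (abs_lt.1 (hD t ht)))
      have h1 : ∀ᶠ s in 𝓝 t, |s| < D t := (continuous_abs.tendsto t).eventually_lt_const (hD t ht)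
      filter_upwards [hI.mem_nhds ht, h1] with s hs hs1
      simp only [hs, if_true]
      have hm : |s| < min (D t) (D s) := lt_min hs1 (hD s hs)
      refine huniq (-(min (D t) (D s))) (min (D t) (D s)) (F t) (F s) 0 ?_ ?_ ?_ ?_ (abs_lt.1 hm)
      · have := (abs_nonneg s).trans_lt hm
        exact ⟨by linarith, this⟩
      · rw [hF0 t ht, hF0 s hs]
      · intro u hu
        exact hF t ht u ⟨by linarith [hu.1, min_le_left (D t) (D s)],
          by linarith [hu.2, min_le_left (D t) (D s)]⟩
      · intro u hu
        exact hF s hs u ⟨by linarith [hu.1, min_le_right (D t) (D s)],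
          by linarith [hu.2, min_le_right (D t) (D s)]⟩
  -- a solution extends a little beyond both ends of its interval
  have hstep : ∀ R > 0, P R → ∃ R' > R, P R' := by
    rintro R hR ⟨f, h0, hf⟩
    obtain ⟨ε₁, hε₁, h₁⟩ := hloc R
    obtain ⟨ε₂, hε₂, h₂⟩ := hloc (-R)
    set ε := min (min ε₁ ε₂) R with hε
    have e1 : ε ≤ ε₁ := (min_le_left _ _).trans (min_le_left _ _)
    have e2 : ε ≤ ε₂ := (min_le_left _ _).trans (min_le_right _ _)
    have e3 : ε ≤ R := min_le_right _ _
    have e0 : 0 < ε := lt_min (lt_min hε₁ hε₂) hR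
    have ht₁ : R - ε / 2 ∈ Ioo (-R) R := ⟨by linarith, by linarith⟩
    have ht₂ : -R + ε / 2 ∈ Ioo (-R) R := ⟨by linarith, by linarith⟩
    obtain ⟨f₁, hf₁0, hf₁⟩ := h₁ (R - ε / 2) ⟨by linarith, by linarith⟩ (f (R - ε / 2))
      (hadm _ _ (hf _ ht₁))
    obtain ⟨f₂, hf₂0, hf₂⟩ := h₂ (-R + ε / 2) ⟨by linarith, by linarith⟩ (f (-R + ε / 2))
      (hadm _ _ (hf _ ht₂))
    have q1 : EqOn f₁ f (Ioo (R - ε) R) := huniq _ _ _ _ (R - ε / 2)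
      ⟨by linarith, by linarith⟩ hf₁0 (fun t ht => hf₁ t ⟨by linarith [ht.1], by linarith [ht.2]⟩)
      (fun t ht => hf t ⟨by linarith [ht.1], ht.2⟩)
    have q2 : EqOn f₂ f (Ioo (-R) (-R + ε)) := huniq _ _ _ _ (-R + ε / 2)
      ⟨by linarith, by linarith⟩ hf₂0 (fun t ht => hf₂ t ⟨by linarith [ht.1], by linarith [ht.2]⟩)
      (fun t ht => hf t ⟨ht.1, by linarith [ht.2]⟩)
    set g : ℝ → X := fun t => if t ≤ -R then f₂ t else if t < R then f t else f₁ t with hg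
    refine ⟨R + ε, by linarith, g, ?_, ?_⟩
    · simp only [hg]
      rw [if_neg (by linarith), if_pos hR, h0]
    · intro t ht
      rcases lt_or_ge t (-R + ε) with h | h
      · refine hcongr f₂ g t ?_ (hf₂ t ⟨by linarith [ht.1], by linarith⟩)
        filter_upwards [Iio_mem_nhds h] with s hs
        simp only [hg]
        split_ifs with h3 h4
        · rfl
        · exact q2 ⟨by linarith, hs⟩
        · have : s < -R + ε := hs
          linarith
      · rcases lt_or_ge (R - ε) t with h' | h'
        · refine hcongr f₁ g t ?_ (hf₁ t ⟨by linarith, by linarith [ht.2]⟩)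
          filter_upwards [Ioi_mem_nhds h', Ioi_mem_nhds (show -R < t by linarith)] with s hs hs'
          simp only [hg]
          rw [if_neg (not_le.2 hs')]
          split_ifs with h4
          · exact q1 ⟨hs, h4⟩
          · rfl
        · have h3 : t ∈ Ioo (-R) R := ⟨by linarith, by linarith⟩
          refine hcongr f g t ?_ (hf t h3)
          filter_upwards [isOpen_Ioo.mem_nhds h3] with s hs
          simp only [hg]
          rw [if_neg (not_le.2 hs.1), if_pos hs.2]
  have hP0 : ∃ R > 0, P R := by
    obtain ⟨ε, hε, h⟩ := hloc 0
    obtain ⟨f, h0, hf⟩ := h 0 ⟨by linarith, by linarith⟩ x₀ hx₀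
    exact ⟨ε, hε, f, h0, fun t ht => hf t ⟨by linarith [ht.1], by linarith [ht.2]⟩⟩
  -- hence the supremum of the admissible radii is infinite
  have hall : ∀ R, P R := by
    by_contra! hcon
    obtain ⟨B, hB⟩ := hcon
    obtain ⟨R₀, hR₀, hPR₀⟩ := hP0
    have hbdd : BddAbove {R | P R} :=
      ⟨B, fun R hR => le_of_not_gt fun h => hB (hmono B R h.le hR)⟩
    set S := sSup {R | P R} with hS
    have hS0 : 0 < S := hR₀.trans_le (le_csSup hbdd hPR₀)
    have hPS : P S := by
      refine hunion (Ioo (-S) S) isOpen_Ioo fun t ht => ?_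
      obtain ⟨R, hR, h⟩ := exists_lt_of_lt_csSup ⟨R₀, hPR₀⟩ (abs_lt.2 ht)
      exact ⟨R, h, hR⟩
    obtain ⟨R', hR', hPR'⟩ := hstep S hS0 hPS
    exact (le_csSup hbdd hPR').not_gt hR'
  obtain ⟨f, h0, hf⟩ := hunion univ isOpen_univ fun t _ => ⟨|t| + 1, by linarith, hall _⟩
  exact ⟨f, h0, fun t => hf t (mem_univ t)⟩

end Gluing

section Equations

variable {EG : Type*} [NormedAddCommGroup EG] [NormedSpace ℝ EG]
  {G : Type*} [TopologicalSpace G] [ChartedSpace EG G] [Group G] [LieGroup 𝓘(ℝ, EG) ∞ G]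

section Uniqueness

variable {V : Type*} [NormedAddCommGroup V] [NormedSpace ℝ V]
variable {g k : V → G} {r : V → V →L[ℝ] EG} {s : Set V}

theorem HasLogDerivWithinAt.mul_const {r : V →L[ℝ] EG} {z : V} (h : HasLogDerivWithinAt g r s z)
    (a : G) : HasLogDerivWithinAt (fun w => g w * a) r s z := by
  simpa using h.mul (hasLogDerivWithinAt_const a)

/-- A map to a Lie group with vanishing logarithmic derivative on a convex set is constant there: it is
locally constant by the mean value inequality in a chart. -/
theorem eq_of_hasLogDerivWithinAt_zero (hs : Convex ℝ s)
    (h : ∀ z ∈ s, HasLogDerivWithinAt g (0 : V →L[ℝ] EG) s z) {z w : V} (hz : z ∈ s)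
    (hw : w ∈ s) : g w = g z := by
  have : IsTopologicalGroup G := topologicalGroup_of_lieGroup 𝓘(ℝ, EG) ∞
  have hlc : IsLocallyConstant (fun x : s => g x) := by
    rw [IsLocallyConstant.iff_eventually_eq]
    rintro ⟨z, hz⟩
    have h1 := (h z hz).eventually_source
    obtain ⟨ρ, hρ, hb⟩ := Metric.mem_nhdsWithin_iff.1 h1
    have hconv : Convex ℝ (Metric.ball z ρ ∩ s) := (convex_ball z ρ).inter hs
    have hd : ∀ w ∈ Metric.ball z ρ ∩ s, HasFDerivWithinAt
        (fun w => logChart EG G (g w * (g z)⁻¹)) (0 : V →L[ℝ] EG) (Metric.ball z ρ ∩ s) w := by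
      intro w hw
      have := (((h w hw.2).mul_const (g z)⁻¹).logChart (hb hw)).mono
        (inter_subset_right (s := Metric.ball z ρ))
      simpa using this
    have hconst : ∀ w ∈ Metric.ball z ρ ∩ s, g w = g z := by
      intro w hw
      have hzz : z ∈ Metric.ball z ρ ∩ s := ⟨Metric.mem_ball_self hρ, hz⟩
      have h2 := hconv.norm_image_sub_le_of_norm_hasFDerivWithin_le (C := 0) hd (by simp) hzz hw
      have h3 : logChart EG G (g w * (g z)⁻¹) = logChart EG G (g z * (g z)⁻¹) := by
        rw [← sub_eq_zero, ← norm_le_zero_iff]; simpa using h2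
      have h4 := (logChart EG G).injOn (hb hw) (hb hzz) h3
      exact mul_right_cancel h4
    have : ∀ᶠ x : s in 𝓝 ⟨z, hz⟩, (x : V) ∈ Metric.ball z ρ :=
      continuous_subtype_val.continuousAt.preimage_mem_nhds (Metric.ball_mem_nhds z hρ)
    filter_upwards [this] with x hx
    exact hconst x ⟨hx, x.2⟩
  have : PreconnectedSpace s := isPreconnected_iff_preconnectedSpace.1 hs.isPreconnected
  exact hlc.apply_eq_of_preconnectedSpace ⟨w, hw⟩ ⟨z, hz⟩

/-- The logarithmic derivative of a quotient: it vanishes if the two maps have the same logarithmic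
derivative. -/
theorem HasLogDerivWithinAt.inv_mul {r₁ r₂ : V →L[ℝ] EG} {z : V}
    (hk : HasLogDerivWithinAt k r₁ s z) (hg : HasLogDerivWithinAt g r₂ s z) :
    HasLogDerivWithinAt (fun w => (k w)⁻¹ * g w) ((LoopSpace.AdL (k z)⁻¹).comp (r₂ - r₁)) s z := by
  have := hk.inv.mul hg
  rwa [show -(LoopSpace.AdL (k z)⁻¹).comp r₁ + (LoopSpace.AdL (k z)⁻¹).comp r₂ =
      (LoopSpace.AdL (k z)⁻¹).comp (r₂ - r₁) by
    ext v; simp [sub_eq_neg_add]] at this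

/-- Two maps to a Lie group with the same logarithmic derivative differ by a constant. -/
theorem eqOn_of_hasLogDerivWithinAt (hs : Convex ℝ s)
    (hg : ∀ z ∈ s, HasLogDerivWithinAt g (r z) s z)
    (hk : ∀ z ∈ s, HasLogDerivWithinAt k (r z) s z) {z₀ : V} (hz₀ : z₀ ∈ s)
    (h : g z₀ = k z₀) : EqOn g k s := by
  intro w hw
  have h0 : ∀ z ∈ s, HasLogDerivWithinAt (fun w => (k w)⁻¹ * g w) (0 : V →L[ℝ] EG) s z := by
    intro z hz
    simpa using (hk z hz).inv_mul (hg z hz)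
  have := eq_of_hasLogDerivWithinAt_zero hs h0 hz₀ hw
  simp only [h, inv_mul_cancel] at this
  exact (inv_mul_eq_one.1 this).symm

end Uniqueness

/-- The linear map `ℝ → EG` with value `ξ` at `1`. -/
abbrev spanL (ξ : EG) : ℝ →L[ℝ] EG := ContinuousLinearMap.toSpanSingleton ℝ ξ

variable [FiniteDimensional ℝ EG]

variable (EG G) in
/-- For small `ζ`, the solution of `k' = ζ k`, `k 0 = 1` stays in the chart at the identity, where it
is the primitive of `ζ` up to a quadratic error. -/
theorem exists_hasLogDerivAt_small : ∃ a > 0, ∃ C ≥ 0, ∀ (S δ : ℝ) (ζ : ℝ → EG), 0 < S → 0 ≤ δ →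
    ContinuousOn ζ (Icc (-S) S) → (∀ t ∈ Icc (-S) S, ‖ζ t‖ ≤ δ) → δ * S ≤ a →
    ∃ k : ℝ → G, k 0 = 1 ∧ ∀ t ∈ Ioo (-S) S, HasLogDerivAt k (spanL (ζ t)) t ∧
      k t ∈ (logChart EG G).source ∧
      ‖logChart EG G (k t) - logOne EG G - ∫ u in (0 : ℝ)..t, ζ u‖ ≤ C * (δ * S) ^ 2 := by
  have : CompleteSpace EG := FiniteDimensional.complete ℝ EG
  obtain ⟨K, t, ht, hK⟩ := ((contDiffAt_rightField (EG := EG) (G := G)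
    logOne_mem_target).of_le (m := 1) (by simp)).exists_lipschitzOnWith
  obtain ⟨a₀, ha₀, hball⟩ := Metric.nhds_basis_closedBall.mem_iff.1
    (inter_mem ht (eventually_target (EG := EG) (G := G) logOne_mem_target))
  set y₀ := logOne EG G with hy₀
  set a : ℝ := min a₀ (1 / (K + 1)) with ha
  have hKpos : (0 : ℝ) < K + 1 := by positivity
  have ha_pos : 0 < a := lt_min ha₀ (by positivity)
  have hKa : K * a ≤ 1 := by
    calc (K : ℝ) * a ≤ K * (1 / (K + 1)) := by gcongr; exact min_le_right _ _
      _ ≤ 1 := by rw [mul_one_div, div_le_one hKpos]; linarith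
  have hsub : Metric.closedBall y₀ a ⊆ t ∩ (logChart EG G).target :=
    (Metric.closedBall_subset_closedBall (min_le_left _ _)).trans hball
  have hM : ∀ y ∈ Metric.closedBall y₀ a, ‖rightField G y - ContinuousLinearMap.id ℝ EG‖ ≤
      K * ‖y - y₀‖ := by
    intro y hy
    rw [← rightField_one (EG := EG) (G := G), ← dist_eq_norm, ← dist_eq_norm]
    exact hK.dist_le_mul y (hsub hy).1 y₀ (hsub (Metric.mem_closedBall_self ha_pos.le)).1
  have hM2 : ∀ y ∈ Metric.closedBall y₀ a, ‖rightField G y‖ ≤ 2 := by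
    intro y hy
    have h1 := hM y hy
    have h2 : ‖y - y₀‖ ≤ a := by rwa [← dist_eq_norm]
    have h3 : (K : ℝ) * ‖y - y₀‖ ≤ 1 := (by gcongr : (K : ℝ) * ‖y - y₀‖ ≤ K * a).trans hKa
    calc ‖rightField G y‖ = ‖(rightField G y - ContinuousLinearMap.id ℝ EG) +
          ContinuousLinearMap.id ℝ EG‖ := by rw [sub_add_cancel]
      _ ≤ 1 + 1 := (norm_add_le _ _).trans (add_le_add (h1.trans h3)
          ContinuousLinearMap.norm_id_le)
      _ = 2 := by norm_num
  refine ⟨a / 2, by positivity, 2 * K, by positivity, ?_⟩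
  intro S δ ζ hS hδ hζ hζδ hδS
  -- in the chart the equation reads `y' = rightField G y (ζ t)`; solve it by Picard-Lindelöf in the
  -- ball of radius `a`
  set f : ℝ → EG → EG := fun t y => rightField G y (ζ t) with hf
  have h0mem : (0 : ℝ) ∈ Icc (-S) S := ⟨by linarith, hS.le⟩
  have hfn : ∀ t ∈ Icc (-S) S, ∀ y ∈ Metric.closedBall y₀ a, ‖f t y‖ ≤ 2 * δ := by
    intro t ht y hy
    exact ((rightField G y).le_opNorm _).trans
      (mul_le_mul (hM2 y hy) (hζδ t ht) (norm_nonneg _) (by norm_num))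
  obtain ⟨aN, haN⟩ : ∃ aN : ℝ≥0, (aN : ℝ) = a := ⟨⟨a, ha_pos.le⟩, rfl⟩
  obtain ⟨δN, hδN⟩ : ∃ δN : ℝ≥0, (δN : ℝ) = δ := ⟨⟨δ, hδ⟩, rfl⟩
  have hPL : IsPicardLindelof f (tmin := -S) (tmax := S) ⟨0, h0mem⟩ y₀ aN 0
      (2 * δN) (K * δN) := by
    refine ⟨?_, ?_, ?_, ?_⟩ <;> try rw [haN]
    · intro t ht
      refine LipschitzOnWith.of_dist_le_mul fun x hx y hy => ?_
      rw [dist_eq_norm, dist_eq_norm]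
      have : f t x - f t y = (rightField G x - rightField G y) (ζ t) := by simp [hf]
      rw [this]
      have h1 := hK.dist_le_mul x (hsub hx).1 y (hsub hy).1
      rw [dist_eq_norm, dist_eq_norm] at h1
      calc _ ≤ ‖rightField G x - rightField G y‖ * ‖ζ t‖ := ContinuousLinearMap.le_opNorm _ _
        _ ≤ (K * ‖x - y‖) * δ := mul_le_mul h1 (hζδ t ht) (norm_nonneg _) (by positivity)
        _ = _ := by push_cast; rw [hδN]; ring
    · intro x hx
      exact ((rightField G x).continuous.comp_continuousOn hζ)
    · intro t ht y hy
      push_cast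
      rw [hδN]
      exact hfn t ht y hy
    · push_cast
      rw [hδN]
      simp only [sub_zero, zero_sub, neg_neg, max_self]
      linarith
  obtain ⟨α, hα⟩ := ODE.FunSpace.exists_isFixedPt_next hPL (Metric.mem_closedBall_self le_rfl)
  have hmem : ∀ t, α.compProj t ∈ Metric.closedBall y₀ a :=
    fun t => haN ▸ α.compProj_mem_closedBall hPL.mul_max_le
  set y := α.compProj with hy
  have hyc : Continuous y := α.continuous_compProj
  have hfc : ContinuousOn (fun t => f t (y t)) (Icc (-S) S) := by
    refine ContinuousOn.clm_apply ?_ hζ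
    intro u hu
    exact ((contDiffAt_rightField (hsub (hmem u)).2).continuousAt.comp
      hyc.continuousAt).continuousWithinAt
  have hyint : ∀ t ∈ Icc (-S) S, y t = y₀ + ∫ u in (0 : ℝ)..t, f u (y u) := by
    intro t ht
    rw [hy, ODE.FunSpace.compProj_of_mem ht, (ODE.FunSpace.isFixedPt_next_iff hPL _).1 hα ⟨t, ht⟩,
      ODE.picard_apply]
  have hsubI : ∀ t ∈ Icc (-S) S, uIcc 0 t ⊆ Icc (-S) S := fun t ht =>
    uIcc_subset_Icc h0mem ht
  have hy0 : y 0 = y₀ := by rw [hyint 0 h0mem]; simp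
  have hderiv : ∀ t ∈ Ioo (-S) S, HasDerivAt y (f t (y t)) t := by
    intro t ht
    have htI := Ioo_subset_Icc_self ht
    have h1 : HasDerivAt (fun t => y₀ + ∫ u in (0 : ℝ)..t, f u (y u)) (f t (y t)) t := by
      refine (intervalIntegral.integral_hasDerivAt_right ?_ ?_ ?_).const_add y₀
      · exact (hfc.mono (hsubI t htI)).intervalIntegrable
      · exact (hfc.mono Ioo_subset_Icc_self).stronglyMeasurableAtFilter isOpen_Ioo t ht
      · exact hfc.continuousAt (Icc_mem_nhds ht.1 ht.2)
    refine h1.congr_of_eventuallyEq ?_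
    filter_upwards [Icc_mem_nhds ht.1 ht.2] with u hu
    exact hyint u hu
  have hbound : ∀ t ∈ Icc (-S) S, ‖y t - y₀‖ ≤ 2 * δ * S := by
    intro t ht
    rw [hyint t ht, add_sub_cancel_left]
    have h1 : ‖∫ u in (0 : ℝ)..t, f u (y u)‖ ≤ 2 * δ * |t - 0| :=
      intervalIntegral.norm_integral_le_of_norm_le_const fun u hu =>
        hfn u (hsubI t ht (uIoc_subset_uIcc hu)) _ (hmem u)
    refine h1.trans ?_
    have : |t - 0| ≤ S := by rw [sub_zero]; exact abs_le.2 ht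
    gcongr
  refine ⟨fun t => (logChart EG G).symm (y t), ?_, ?_⟩
  · simp only [hy0, hy₀, logChart_symm_one]
  · intro t ht
    have htI := Ioo_subset_Icc_self ht
    refine ⟨hasLogDerivWithinAt_of_chart ?_ (hsub (hmem t)).2,
      (logChart EG G).map_target (hsub (hmem t)).2, ?_⟩
    · refine (hderiv t ht).hasFDerivAt.hasFDerivWithinAt.congr_fderiv ?_
      ext; simp [hf]
    · rw [(logChart EG G).right_inv (hsub (hmem t)).2, hyint t htI, add_sub_cancel_left,
        ← intervalIntegral.integral_sub ((hfc.mono (hsubI t htI)).intervalIntegrable)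
          ((hζ.mono (hsubI t htI)).intervalIntegrable)]
      -- the error is controlled by `rightField G y - 1`, which is Lipschitz and vanishes at `y₀`
      have h1 : ‖∫ u in (0 : ℝ)..t, (f u (y u) - ζ u)‖ ≤ K * (2 * δ * S) * δ * |t - 0| := by
        refine intervalIntegral.norm_integral_le_of_norm_le_const fun u hu => ?_
        have huI := hsubI t htI (uIoc_subset_uIcc hu)
        have : f u (y u) - ζ u = (rightField G (y u) - ContinuousLinearMap.id ℝ EG) (ζ u) := by
          simp [hf]
        rw [this]
        refine (ContinuousLinearMap.le_opNorm _ _).trans ?_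
        refine mul_le_mul ((hM _ (hmem u)).trans ?_) (hζδ u huI) (norm_nonneg _) (by positivity)
        exact mul_le_mul_of_nonneg_left (hbound u huI) (by positivity)
      refine h1.trans ?_
      have : |t - 0| ≤ S := by rw [sub_zero]; exact abs_le.2 htI
      calc _ ≤ K * (2 * δ * S) * δ * S := by gcongr
        _ = _ := by ring

/-- The equation `g' = ξ g` in a Lie group has a global solution. -/
theorem exists_hasLogDerivAt {ξ : ℝ → EG} (hξ : Continuous ξ) (g₀ : G) :
    ∃ g : ℝ → G, g 0 = g₀ ∧ ∀ t, HasLogDerivAt g (spanL (ξ t)) t := by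
  refine exists_global_solution (fun g t => HasLogDerivAt g (spanL (ξ t)) t) (fun _ _ => True)
    ?_ (fun _ _ _ => trivial) ?_ ?_ trivial
  · intro f f' t hff hf
    refine hf.congr ?_ hff.self_of_nhds.symm
    rw [nhdsWithin_univ]; exact hff.symm
  · -- near `t₀` the solution with any value at `t₁` is a right translate of the small solution
    intro t₀
    obtain ⟨a, ha, C, -, H⟩ := exists_hasLogDerivAt_small EG G
    obtain ⟨δ, hδ⟩ := (isCompact_Icc (a := t₀ - 1) (b := t₀ + 1)).exists_bound_of_continuousOn
      hξ.continuousOn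
    set δ' := max δ 0 + 1
    have hδ' : 0 < δ' := by positivity
    set S := min 1 (a / δ')
    have hS : 0 < S := lt_min one_pos (by positivity)
    have hS1 : S ≤ 1 := min_le_left _ _
    obtain ⟨k, hk0, hk⟩ := H S δ' (fun t => ξ (t + t₀)) hS hδ'.le (by fun_prop)
      (fun t ht => (hδ _ ⟨by linarith [ht.1], by linarith [ht.2]⟩).trans
        (by linarith [le_max_left δ 0]))
      (by
        calc δ' * S ≤ δ' * (a / δ') := by gcongr; exact min_le_right _ _
          _ = a := by field_simp)
    refine ⟨S, hS, fun t₁ ht₁ x _ => ⟨fun t => k (t - t₀) * ((k (t₁ - t₀))⁻¹ * x), by simp, ?_⟩⟩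
    intro t ht
    have h1 := (hk (t - t₀) ⟨by linarith [ht.1], by linarith [ht.2]⟩).1
    have h2 := HasLogDerivWithinAt.comp (f := fun t => t - t₀) (t := univ) (y := t) h1
      ((hasFDerivAt_id (𝕜 := ℝ) t).sub_const t₀).hasFDerivWithinAt (mapsTo_univ _ _)
    rw [sub_add_cancel, ContinuousLinearMap.comp_id] at h2
    exact h2.mul_const _
  · intro a b f f' t₁ ht₁ h hf hf'
    exact eqOn_of_hasLogDerivWithinAt (r := fun t => spanL (ξ t)) (convex_Ioo a b)
      (fun t ht => (hf t ht).mono (subset_univ _)) (fun t ht => (hf' t ht).mono (subset_univ _))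
      ht₁ h

end Equations

/-! ### Smooth dependence on parameters -/

section ParametricIntegrals

variable {Z E : Type*} [NormedAddCommGroup Z] [NormedSpace ℝ Z] [FiniteDimensional ℝ Z]
  [NormedAddCommGroup E] [NormedSpace ℝ E]

theorem hasFDerivAt_parametric_integral {F : ℝ × Z → E} (hF : ContDiff ℝ 1 F) (a b : ℝ) (w : Z) :
    HasFDerivAt (fun w => ∫ u in a..b, F (u, w))
      (∫ u in a..b, (fderiv ℝ F (u, w)).comp (ContinuousLinearMap.inr ℝ ℝ Z)) w := by
  have hc : Continuous fun q : ℝ × Z => (fderiv ℝ F q).comp (ContinuousLinearMap.inr ℝ ℝ Z) :=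
    (hF.continuous_fderiv (by simp)).clm_comp continuous_const
  have hproper : ProperSpace Z := FiniteDimensional.proper_real Z
  obtain ⟨C, hC⟩ := (isCompact_uIcc.prod (isCompact_closedBall w 1)).exists_bound_of_continuousOn
    (s := uIcc a b ×ˢ Metric.closedBall w 1) hc.continuousOn
  refine intervalIntegral.hasFDerivAt_integral_of_dominated_of_fderiv_le (μ := MeasureTheory.volume)
    (F := fun w u => F (u, w)) (bound := fun _ => C)
    (F' := fun w u => (fderiv ℝ F (u, w)).comp (ContinuousLinearMap.inr ℝ ℝ Z))
    (Metric.closedBall_mem_nhds w one_pos) ?_ ?_ ?_ ?_ ?_ ?_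
  · exact Eventually.of_forall fun w =>
      (hF.continuous.comp (by fun_prop : Continuous fun u : ℝ => (u, w))).aestronglyMeasurable
  · exact (hF.continuous.comp (by fun_prop : Continuous fun u : ℝ => (u, w))).intervalIntegrable _ _
  · exact (hc.comp (by fun_prop : Continuous fun u : ℝ => (u, w))).aestronglyMeasurable
  · exact Eventually.of_forall fun u hu w' hw' => hC (u, w') ⟨uIoc_subset_uIcc hu, hw'⟩
  · exact intervalIntegrable_const
  · refine Eventually.of_forall fun u _ w' _ => ?_
    exact HasFDerivAt.comp w' (f := fun w => (u, w))
      (hF.differentiable (by simp) (u, w')).hasFDerivAt (hasFDerivAt_prodMk_right u w')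

theorem contDiff_parametric_integral_nat (n : ℕ) : ∀ {F : ℝ × Z → E}, ContDiff ℝ n F →
    ∀ a b : ℝ, ContDiff ℝ n (fun w => ∫ u in a..b, F (u, w)) := by
  induction n with
  | zero =>
    intro F hF a b
    have hF' : Continuous F := hF.continuous
    refine contDiff_zero.2 ?_
    exact intervalIntegral.continuous_parametric_intervalIntegral_of_continuous'
      (f := fun w u => F (u, w)) (by simp only [Function.uncurry_def]; fun_prop) a b
  | succ n ih =>
    intro F hF a b
    have hF1 : ContDiff ℝ 1 F := hF.of_le (by exact_mod_cast Nat.le_add_left 1 n)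
    have hd := hasFDerivAt_parametric_integral hF1 a b
    rw [Nat.cast_add, Nat.cast_one, contDiff_succ_iff_fderiv_apply]
    refine ⟨fun w => (hd w).differentiableAt, by simp, fun y => ?_⟩
    have hfd : ContDiff ℝ n (fderiv ℝ F) := hF.fderiv_right (by simp)
    have h1 : ContDiff ℝ n fun q : ℝ × Z => fderiv ℝ F q (0, y) := hfd.clm_apply contDiff_const
    convert ih h1 a b using 1
    ext w
    rw [(hd w).fderiv, ContinuousLinearMap.intervalIntegral_apply]
    · simp
    · refine Continuous.intervalIntegrable ?_ _ _
      have : Continuous (fderiv ℝ F) := hfd.continuous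
      exact (this.comp (by fun_prop : Continuous fun u : ℝ => (u, w))).clm_comp continuous_const

theorem contDiff_parametric_integral {n : ℕ∞} {F : ℝ × Z → E} (hF : ContDiff ℝ n F) (a b : ℝ) :
    ContDiff ℝ n (fun w => ∫ u in a..b, F (u, w)) := by
  rw [contDiff_iff_forall_nat_le]
  intro m hm
  exact contDiff_parametric_integral_nat m (hF.of_le (by exact_mod_cast hm)) a b

theorem contDiff_primitive {n : ℕ∞} {F : ℝ × Z → E} (hF : ContDiff ℝ n F) :
    ContDiff ℝ n (fun q : ℝ × Z => ∫ u in (0 : ℝ)..q.1, F (u, q.2)) := by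
  have h1 : ContDiff ℝ n (fun q : ℝ × Z => ∫ u in (0 : ℝ)..1, F (q.1 * u, q.2)) :=
    contDiff_parametric_integral (F := fun p : ℝ × (ℝ × Z) => F (p.2.1 * p.1, p.2.2))
      (hF.comp (by fun_prop)) 0 1
  -- rescaling to the fixed interval `[0, 1]` turns the upper limit into a parameter
  convert contDiff_fst.smul h1 using 1
  ext q
  change _ = q.1 • ∫ u in (0 : ℝ)..1, F (q.1 * u, q.2)
  rw [intervalIntegral.smul_integral_comp_mul_left (fun u => F (u, q.2))]
  simp

end ParametricIntegrals

section SmoothDependence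

variable {EG : Type*} [NormedAddCommGroup EG] [NormedSpace ℝ EG]
  {G : Type*} [TopologicalSpace G] [ChartedSpace EG G] [Group G] [LieGroup 𝓘(ℝ, EG) ∞ G]

/-- A map to a Lie group gains one order of differentiability over its logarithmic derivative: near
`z₀`, translate the value to the identity and read the equation in the chart there. -/
theorem contMDiff_succ_of_hasLogDerivAt {V : Type*} [NormedAddCommGroup V] [NormedSpace ℝ V]
    {g : V → G} {r : V → V →L[ℝ] EG} (hg : ∀ z, HasLogDerivAt g (r z) z) {n : ℕ}
    (hr : ContDiff ℝ n r) (hn : ContMDiff 𝓘(ℝ, V) 𝓘(ℝ, EG) n g) :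
    ContMDiff 𝓘(ℝ, V) 𝓘(ℝ, EG) (n + 1 : ℕ) g := by
  have : IsTopologicalGroup G := topologicalGroup_of_lieGroup 𝓘(ℝ, EG) ∞
  have hLn : ∀ m : ℕ, LieGroup 𝓘(ℝ, EG) (m : ℕ) G := fun m =>
    LieGroup.of_le (n := ∞) (by exact_mod_cast le_top)
  have hle : ∀ m : ℕ, ((m : ℕ) : WithTop ℕ∞) ≤ ∞ := fun m => by exact_mod_cast le_top
  intro z₀
  set k : V → G := fun w => g w * (g z₀)⁻¹ with hk
  have hkd : ∀ z, HasLogDerivAt k (r z) z := fun z => (hg z).mul_const _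
  have hkc : ContinuousAt k z₀ := hn.continuous.continuousAt.mul continuousAt_const
  have hk1 : k z₀ = 1 := mul_inv_cancel _
  have hkn : ContMDiffAt 𝓘(ℝ, V) 𝓘(ℝ, EG) n k z₀ := by
    have := hLn n
    exact (hn z₀).mul contMDiffAt_const
  have hev : ∀ᶠ z in 𝓝 z₀, k z ∈ (logChart EG G).source :=
    hkc.preimage_mem_nhds (isOpen_source.mem_nhds (by rw [hk1]; exact one_mem_source))
  have hy : ∀ᶠ z in 𝓝 z₀, HasFDerivAt (fun w => logChart EG G (k w))
      ((rightField G (logChart EG G (k z))).comp (r z)) z := by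
    filter_upwards [hev] with z hz
    exact hasFDerivWithinAt_univ.1 ((hkd z).logChart hz)
  have hyn : ContDiffAt ℝ n (fun w => logChart EG G (k w)) z₀ := by
    rw [← contMDiffAt_iff_contDiffAt]
    exact ContMDiffAt.comp z₀ (g := logChart EG G)
      ((contMDiffAt_logChart (by rw [hk1]; exact one_mem_source)).of_le (hle n)) hkn
  have hy1 : ContDiffAt ℝ (n + 1) (fun w => logChart EG G (k w)) z₀ := by
    rw [contDiffAt_succ_iff_hasFDerivAt]
    refine ⟨_, ⟨_, hy, fun z hz => hz⟩, ?_⟩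
    refine ContDiffAt.clm_comp ?_ hr.contDiffAt
    refine ContDiffAt.comp z₀ (g := rightField G) ?_ hyn
    rw [hk1]
    exact (contDiffAt_rightField logOne_mem_target).of_le (hle n)
  have hk2 : ContMDiffAt 𝓘(ℝ, V) 𝓘(ℝ, EG) (n + 1 : ℕ) k z₀ := by
    have h1 : ContMDiffAt 𝓘(ℝ, V) 𝓘(ℝ, EG) (n + 1 : ℕ)
        (fun w => (logChart EG G).symm (logChart EG G (k w))) z₀ := by
      refine ContMDiffAt.comp z₀ (g := (logChart EG G).symm)
        ((contMDiffAt_logChart_symm ?_).of_le (hle (n + 1))) ?_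
      · rw [hk1]; exact logOne_mem_target
      · rw [contMDiffAt_iff_contDiffAt]; exact_mod_cast hy1
    refine h1.congr_of_eventuallyEq ?_
    filter_upwards [hev] with z hz
    exact (logChart_left_inv hz).symm
  have := hLn (n + 1)
  have h3 := hk2.mul (contMDiffAt_const (c := g z₀))
  refine h3.congr_of_eventuallyEq (Eventually.of_forall fun w => ?_)
  simp [hk]

variable {V : Type*} [NormedAddCommGroup V] [NormedSpace ℝ V]

/-- A map to a Lie group is smooth if its logarithmic derivative is as smooth as the map. -/
theorem contMDiff_of_hasLogDerivAt {g : V → G} {r : V → V →L[ℝ] EG}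
    (hg : ∀ z, HasLogDerivAt g (r z) z)
    (hr : ∀ n : ℕ, ContMDiff 𝓘(ℝ, V) 𝓘(ℝ, EG) n g → ContDiff ℝ n r) :
    ContMDiff 𝓘(ℝ, V) 𝓘(ℝ, EG) ∞ g := by
  rw [contMDiff_infty]
  intro n
  induction n with
  | zero =>
    have : Continuous g := continuous_iff_continuousAt.2 fun z => by
      simpa [continuousWithinAt_univ] using (hg z).1
    exact_mod_cast contMDiff_zero_iff.2 this
  | succ n ih => exact contMDiff_succ_of_hasLogDerivAt hg (hr n ih) ih

theorem contDiff_AdL_comp {g : V → G} {n : ℕ∞} (hg : ContMDiff 𝓘(ℝ, V) 𝓘(ℝ, EG) n g) :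
    ContDiff ℝ n (fun z => AdL (EG := EG) (g z)) := by
  rw [← contMDiff_iff_contDiff]
  exact (contMDiff_AdL.of_le (by exact_mod_cast le_top)).comp hg

theorem contMDiff_inv_comp {g : V → G} {n : ℕ∞} (hg : ContMDiff 𝓘(ℝ, V) 𝓘(ℝ, EG) n g) :
    ContMDiff 𝓘(ℝ, V) 𝓘(ℝ, EG) n (fun z => (g z)⁻¹) := by
  have : LieGroup 𝓘(ℝ, EG) n G := LieGroup.of_le (n := ∞) (by exact_mod_cast le_top)
  exact hg.inv

variable [FiniteDimensional ℝ EG] [FiniteDimensional ℝ V]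

/-- The derivative with respect to the parameter of the solution of `g' = ξ g`, translated back to
the identity from the left. -/
def paramVariation (ξ : ℝ × V → EG) (g : ℝ → V → G) (q : ℝ × V) : V →L[ℝ] EG :=
  ∫ u in (0 : ℝ)..q.1, (AdL (g u q.2)⁻¹).comp
    ((fderiv ℝ ξ (u, q.2)).comp (ContinuousLinearMap.inr ℝ ℝ V))

/-- The solution of `g' = ξ g` is differentiable with respect to a parameter. Near a parameter `l`,
the product of the inverse of the solution at `l` with the solution solves an equation whose
coefficient is small, to which `exists_hasLogDerivAt_small` applies. -/
theorem hasLogDerivAt_of_solution {ξ : ℝ × V → EG} (hξ : ContDiff ℝ ∞ ξ) {g : ℝ → V → G}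
    (h0 : ∀ l, g 0 l = 1)
    (hg : ∀ l t, HasLogDerivAt (fun t => g t l) (spanL (ξ (t, l))) t) (q : ℝ × V) :
    HasLogDerivAt (fun q : ℝ × V => g q.1 q.2)
      ((spanL (ξ q)).comp (ContinuousLinearMap.fst ℝ ℝ V) +
        (AdL (g q.1 q.2)).comp
          ((paramVariation ξ g q).comp (ContinuousLinearMap.snd ℝ ℝ V))) q := by
  obtain ⟨σ, l⟩ := q
  have hproper : ProperSpace V := FiniteDimensional.proper_real V
  have hgl : ContMDiff 𝓘(ℝ, ℝ) 𝓘(ℝ, EG) ∞ (fun t => g t l) := by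
    refine contMDiff_of_hasLogDerivAt (r := fun t => spanL (ξ (t, l))) (hg l) fun n _ => ?_
    have h1 : ContDiff ℝ n fun t : ℝ => ξ (t, l) :=
      (hξ.of_le (by exact_mod_cast le_top)).comp (by fun_prop)
    exact (ContinuousLinearMap.toSpanSingletonCLE (𝕜 := ℝ) (E := EG)).contDiff.comp h1
  set A : ℝ → EG →L[ℝ] EG := fun t => AdL (g t l)⁻¹ with hA
  have hAs : ContDiff ℝ ∞ A := contDiff_AdL_comp (contMDiff_inv_comp hgl)
  -- the coefficient of the equation solved by `g(·, l)⁻¹ g(·, m)`, and its primitive `I`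
  set ζ : ℝ × V → EG := fun p => A p.1 (ξ p - ξ (p.1, l)) with hζ
  have hζs : ContDiff ℝ ∞ ζ :=
    (hAs.comp contDiff_fst).clm_apply (hξ.sub (hξ.comp (by fun_prop)))
  set I : ℝ × V → EG := fun p => ∫ u in (0 : ℝ)..p.1, ζ (u, p.2) with hI
  have hIs : ContDiff ℝ ∞ I := contDiff_primitive hζs
  have hζl : ∀ u, ζ (u, l) = 0 := fun u => by simp [hζ]
  have hId : HasFDerivAt I ((paramVariation ξ g (σ, l)).comp (ContinuousLinearMap.snd ℝ ℝ V))
      (σ, l) := by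
    have h1 := (hIs.differentiable (by simp) (σ, l)).hasFDerivAt
    have h2 : (fderiv ℝ I (σ, l)).comp (ContinuousLinearMap.inl ℝ ℝ V) = 0 := by
      have h3 := HasFDerivAt.comp σ (f := fun t : ℝ => (t, l)) h1 (hasFDerivAt_prodMk_left σ l)
      refine h3.unique ((hasFDerivAt_const (0 : EG) σ).congr_of_eventuallyEq
        (Eventually.of_forall fun t => ?_))
      simp [hI, hζl]
    have h3 : (fderiv ℝ I (σ, l)).comp (ContinuousLinearMap.inr ℝ ℝ V) =
        paramVariation ξ g (σ, l) := by
      have h4 := HasFDerivAt.comp l (f := fun m : V => (σ, m)) h1 (hasFDerivAt_prodMk_right σ l)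
      refine h4.unique ((hasFDerivAt_parametric_integral (hζs.of_le (by simp)) 0 σ l).congr_fderiv ?_)
      rw [paramVariation]
      congr 1
      ext1 u
      have h5 : HasFDerivAt (fun m : V => ζ (u, m))
          ((A u).comp ((fderiv ℝ ξ (u, l)).comp (ContinuousLinearMap.inr ℝ ℝ V))) l := by
        have h6 := HasFDerivAt.comp l (f := fun m : V => (u, m))
          (hξ.differentiable (by simp) (u, l)).hasFDerivAt (hasFDerivAt_prodMk_right u l)
        exact (A u).hasFDerivAt.comp l (h6.sub_const (ξ (u, l)))
      exact (HasFDerivAt.comp l (f := fun m : V => (u, m))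
        (hζs.differentiable (by simp) (u, l)).hasFDerivAt
        (hasFDerivAt_prodMk_right u l)).unique h5
    refine h1.congr_fderiv ?_
    refine ContinuousLinearMap.prod_ext ?_ ?_
    · rw [h2]
      ext
      simp
    · rw [h3]
      ext
      simp
  obtain ⟨a, ha, C, hC, H⟩ := exists_hasLogDerivAt_small EG G
  set S := |σ| + 1 with hS
  have hSpos : 0 < S := by positivity
  have hσS : σ ∈ Ioo (-S) S := abs_lt.1 (by linarith)
  obtain ⟨K, hK⟩ := ((isCompact_Icc (a := -S) (b := S)).prod
    (isCompact_closedBall l 1)).exists_bound_of_continuousOn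
    (hζs.continuous_fderiv (by simp)).continuousOn
  set K' := max K 0
  have hK'0 : 0 ≤ K' := le_max_right _ _
  -- `ζ` vanishes at the parameter `l` and is Lipschitz
  have hlip : ∀ t ∈ Icc (-S) S, ∀ m ∈ Metric.closedBall l 1, ‖ζ (t, m)‖ ≤ K' * ‖m - l‖ := by
    intro t ht m hm
    have h1 : ∀ w ∈ Metric.closedBall l 1, HasFDerivWithinAt (fun m => ζ (t, m))
        ((fderiv ℝ ζ (t, w)).comp (ContinuousLinearMap.inr ℝ ℝ V)) (Metric.closedBall l 1) w :=
      fun w _ => (HasFDerivAt.comp w (f := fun m : V => (t, m))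
        (hζs.differentiable (by simp) (t, w)).hasFDerivAt
        (hasFDerivAt_prodMk_right t w)).hasFDerivWithinAt
    have h2 : ∀ w ∈ Metric.closedBall l 1,
        ‖(fderiv ℝ ζ (t, w)).comp (ContinuousLinearMap.inr ℝ ℝ V)‖ ≤ K' := by
      intro w hw
      refine (ContinuousLinearMap.opNorm_comp_le _ _).trans ?_
      calc _ ≤ K' * 1 := mul_le_mul ((hK (t, w) ⟨ht, hw⟩).trans (le_max_left _ _))
            (ContinuousLinearMap.norm_inr_le_one ℝ ℝ V) (norm_nonneg _) hK'0
        _ = K' := mul_one _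
    have h3 := (convex_closedBall l 1).norm_image_sub_le_of_norm_hasFDerivWithin_le h1 h2
      (Metric.mem_closedBall_self one_pos.le) hm
    simpa [hζl] using h3
  set k : ℝ × V → G := fun p => (g p.1 l)⁻¹ * g p.1 p.2 with hk
  have hk1 : k (σ, l) = 1 := by simp [hk]
  -- the solution `k = g(·, l)⁻¹ g` is `I` up to an error that is quadratic in `m - l`
  have hkest : ∀ᶠ m in 𝓝 l, ∀ t ∈ Ioo (-S) S, k (t, m) ∈ (logChart EG G).source ∧
      ‖logChart EG G (k (t, m)) - logOne EG G - I (t, m)‖ ≤ C * (K' * S) ^ 2 * ‖m - l‖ ^ 2 := by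
    have hsmall : ∀ᶠ m in 𝓝 l, K' * ‖m - l‖ * S < a := by
      have : Continuous fun m => K' * ‖m - l‖ * S := by fun_prop
      exact (this.tendsto l).eventually_lt_const (by simpa using ha)
    filter_upwards [hsmall, Metric.closedBall_mem_nhds l one_pos] with m hm hm1
    obtain ⟨κ, hκ0, hκ⟩ := H S (K' * ‖m - l‖) (fun t => ζ (t, m)) hSpos (by positivity)
      (hζs.continuous.comp (by fun_prop : Continuous fun t : ℝ => (t, m))).continuousOn
      (fun t ht => hlip t ht m hm1) hm.le
    have heq : EqOn (fun t => k (t, m)) κ (Ioo (-S) S) := by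
      refine eqOn_of_hasLogDerivWithinAt (r := fun t => spanL (ζ (t, m))) (convex_Ioo _ _) ?_
        (fun t ht => (hκ t ht).1.mono (subset_univ _)) (z₀ := 0) ⟨by linarith, hSpos⟩ ?_
      · intro t _
        have h1 := ((hg l t).inv_mul (hg m t)).mono (subset_univ (Ioo (-S) S))
        convert h1 using 1
        ext; simp [hζ, hA]
      · simp [hk, h0, hκ0]
    intro t ht
    have h2 := heq ht
    simp only at h2
    rw [h2]
    refine ⟨(hκ t ht).2.1, (hκ t ht).2.2.trans (le_of_eq (by ring))⟩
  have hkevent : ∀ᶠ p in 𝓝 (σ, l), k p ∈ (logChart EG G).source ∧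
      ‖logChart EG G (k p) - logOne EG G - I p‖ ≤ C * (K' * S) ^ 2 * ‖p.2 - l‖ ^ 2 := by
    rw [nhds_prod_eq]
    filter_upwards [prod_mem_prod (isOpen_Ioo.mem_nhds hσS) hkest] with p hp
    exact hp.2 p.1 hp.1
  -- hence `k` has the derivative of `I` at `(σ, l)`
  have hphi : HasFDerivAt (fun p => logChart EG G (k p))
      ((paramVariation ξ g (σ, l)).comp (ContinuousLinearMap.snd ℝ ℝ V)) (σ, l) := by
    have h1 : HasFDerivAt (fun p => logChart EG G (k p) - logOne EG G - I p)
        (0 : ℝ × V →L[ℝ] EG) (σ, l) := by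
      have h2 : logChart EG G (k (σ, l)) - logOne EG G - I (σ, l) = 0 := by
        have h3 : I (σ, l) = 0 := by simp [hI, hζl]
        rw [hk1, h3]
        exact (sub_zero _).trans (sub_self _)
      rw [hasFDerivAt_iff_isLittleO, h2]
      have h3 : (fun p : ℝ × V => logChart EG G (k p) - logOne EG G - I p) =O[𝓝 (σ, l)]
          fun p => ‖p - (σ, l)‖ ^ 2 := by
        refine Asymptotics.IsBigO.of_bound (C * (K' * S) ^ 2) ?_
        filter_upwards [hkevent] with p hp
        refine hp.2.trans ?_
        rw [Real.norm_of_nonneg (by positivity)]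
        have : ‖p.2 - l‖ ≤ ‖p - (σ, l)‖ := norm_snd_le (p - (σ, l))
        gcongr
      have h4 : (fun p : ℝ × V => ‖p - (σ, l)‖ ^ 2) =o[𝓝 (σ, l)] fun p => p - (σ, l) := by
        have := (Asymptotics.isLittleO_norm_pow_id (E' := ℝ × V) (n := 2) one_lt_two).comp_tendsto
          (k := fun p : ℝ × V => p - (σ, l)) (l' := 𝓝 (σ, l)) (by
            have : Continuous fun p : ℝ × V => p - (σ, l) := by fun_prop
            simpa using this.tendsto (σ, l))
        simpa [Function.comp_def] using this
      simpa using h3.trans_isLittleO h4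
    have h5 := (h1.add hId).add_const (logOne EG G)
    refine (h5.congr_of_eventuallyEq (Eventually.of_forall fun p => ?_)).congr_fderiv (by simp)
    simp only [Pi.add_apply]; abel
  have hkc : ContinuousAt k (σ, l) := by
    have h1 : ContinuousAt (fun p => (logChart EG G).symm (logChart EG G (k p))) (σ, l) := by
      refine ContinuousAt.comp (g := (logChart EG G).symm) ?_ hphi.continuousAt
      rw [hk1]; exact continuousAt_logChart_symm logOne_mem_target
    refine h1.congr ?_
    filter_upwards [hkevent] with p hp
    exact logChart_left_inv hp.1
  have hklog : HasLogDerivAt k ((paramVariation ξ g (σ, l)).comp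
      (ContinuousLinearMap.snd ℝ ℝ V)) (σ, l) := by
    refine ⟨hkc.continuousWithinAt, ?_⟩
    rw [hk1]
    simpa [hasFDerivWithinAt_univ] using hphi
  have hgl' : HasLogDerivAt (fun p : ℝ × V => g p.1 l)
      ((spanL (ξ (σ, l))).comp (ContinuousLinearMap.fst ℝ ℝ V)) (σ, l) :=
    HasLogDerivWithinAt.comp (g := fun t => g t l) (f := Prod.fst) (hg l σ)
      hasFDerivAt_fst.hasFDerivWithinAt (mapsTo_univ _ _)
  have := hgl'.mul hklog
  simpa [hk, mul_inv_cancel_left] using this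

/-- Smooth dependence on parameters of the solutions of `g' = ξ g`. -/
theorem contMDiff_of_solution {ξ : ℝ × V → EG} (hξ : ContDiff ℝ ∞ ξ) {g : ℝ → V → G}
    (h0 : ∀ l, g 0 l = 1)
    (hg : ∀ l t, HasLogDerivAt (fun t => g t l) (spanL (ξ (t, l))) t) :
    ContMDiff 𝓘(ℝ, ℝ × V) 𝓘(ℝ, EG) ∞ (fun q : ℝ × V => g q.1 q.2) := by
  refine contMDiff_of_hasLogDerivAt (hasLogDerivAt_of_solution hξ h0 hg) fun n hn => ?_
  have hξn : ContDiff ℝ n ξ := hξ.of_le (by exact_mod_cast le_top)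
  have h1 : ContDiff ℝ n fun q : ℝ × V => (spanL (ξ q)).comp (ContinuousLinearMap.fst ℝ ℝ V) :=
    ((ContinuousLinearMap.toSpanSingletonCLE (𝕜 := ℝ) (E := EG)).contDiff.comp hξn).clm_comp
      contDiff_const
  have hn' : ContMDiff 𝓘(ℝ, ℝ × V) 𝓘(ℝ, EG) ((n : ℕ∞) : WithTop ℕ∞)
    (fun q : ℝ × V => g q.1 q.2) := hn
  have h2 : ContDiff ℝ ((n : ℕ∞) : WithTop ℕ∞) (paramVariation ξ g) := by
    refine contDiff_primitive (F := fun q : ℝ × V => (AdL (g q.1 q.2)⁻¹).comp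
      ((fderiv ℝ ξ q).comp (ContinuousLinearMap.inr ℝ ℝ V))) ?_
    refine (contDiff_AdL_comp (contMDiff_inv_comp hn')).clm_comp (ContDiff.clm_comp ?_
      contDiff_const)
    exact hξ.fderiv_right (by exact_mod_cast le_top)
  exact h1.add ((contDiff_AdL_comp hn').clm_comp (h2.clm_comp contDiff_const))

end SmoothDependence

/-! ### Pull-backs of the connection form -/

section

section ModelDerivative

variable {E E' E'' : Type*} [NormedAddCommGroup E] [NormedSpace ℝ E]
  [NormedAddCommGroup E'] [NormedSpace ℝ E'] [NormedAddCommGroup E''] [NormedSpace ℝ E'']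
  {N N' N'' : Type*} [TopologicalSpace N] [ChartedSpace E N]
  [TopologicalSpace N'] [ChartedSpace E' N'] [TopologicalSpace N''] [ChartedSpace E'' N'']

/-- The derivative of a map of manifolds as a linear map of the model spaces: the tangent space at
a point is identified with the model space through the preferred chart at that point. -/
def modelDeriv (f : N → N') (x : N) : E →L[ℝ] E' := mfderiv 𝓘(ℝ, E) 𝓘(ℝ, E') f x

theorem modelDeriv_comp {g : N' → N''} {f : N → N'} {x : N}
    (hg : MDifferentiableAt 𝓘(ℝ, E') 𝓘(ℝ, E'') g (f x))
    (hf : MDifferentiableAt 𝓘(ℝ, E) 𝓘(ℝ, E') f x) :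
    (modelDeriv (fun y => g (f y)) x : E →L[ℝ] E'') =
      (modelDeriv g (f x) : E' →L[ℝ] E'').comp (modelDeriv f x) :=
  mfderiv_comp x hg hf

theorem modelDeriv_congr {f f₁ : N → N'} {x : N} (h : f₁ =ᶠ[𝓝 x] f) :
    modelDeriv f₁ x = (modelDeriv f x : E →L[ℝ] E') :=
  h.mfderiv_eq

theorem modelDeriv_id (x : N) : (modelDeriv (fun y : N => y) x : E →L[ℝ] E) =
    ContinuousLinearMap.id ℝ E :=
  mfderiv_id

theorem modelDeriv_const (c : N') (x : N) : modelDeriv (fun _ : N => c) x = (0 : E →L[ℝ] E') :=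
  mfderiv_const

theorem modelDeriv_eq_fderiv {f : E → E'} {x : E} : modelDeriv f x = fderiv ℝ f x :=
  mfderiv_eq_fderiv

/-- The derivative of a map from a vector space is the derivative of its expression in the chart
centred at its value. -/
theorem modelDeriv_eq_fderiv_extChartAt {q : E → N'} {z : E}
    (hq : MDifferentiableAt 𝓘(ℝ, E) 𝓘(ℝ, E') q z) :
    modelDeriv q z = fderiv ℝ (fun w => extChartAt 𝓘(ℝ, E') (q z) (q w)) z := by
  have h := hq.mfderiv
  simp only [mfld_simps, fderivWithin_univ] at h
  exact h

end ModelDerivative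

variable {EM EP EG : Type*}
  [NormedAddCommGroup EM] [NormedSpace ℝ EM]
  [NormedAddCommGroup EP] [NormedSpace ℝ EP]
  [NormedAddCommGroup EG] [NormedSpace ℝ EG]
  {M P G : Type*}
  [TopologicalSpace M] [ChartedSpace EM M] [IsManifold 𝓘(ℝ, EM) ∞ M]
  [TopologicalSpace P] [ChartedSpace EP P] [IsManifold 𝓘(ℝ, EP) ∞ P]
  [TopologicalSpace G] [ChartedSpace EG G] [Group G] [LieGroup 𝓘(ℝ, EG) ∞ G]
  {Q : PrincipalBundle EM EP EG M P G}

section Connection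

namespace Connection

/-- The connection form with values in the model spaces. -/
def formL (A : Connection Q) (p : P) : EP →L[ℝ] EG := A.form p

/-- The connection form in the chart of `P` centred at `c`. -/
def localForm (A : Connection Q) (c : P) (y : EP) : EP →L[ℝ] EG :=
  (A.formL ((extChartAt 𝓘(ℝ, EP) c).symm y)).comp (modelDeriv (extChartAt 𝓘(ℝ, EP) c).symm y)

theorem contDiffOn_localForm [FiniteDimensional ℝ EP] (A : Connection Q) (c : P) :
    ContDiffOn ℝ ∞ (A.localForm c) (extChartAt 𝓘(ℝ, EP) c).target :=
  contDiffOn_clm_apply.2 fun U => A.smooth c U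

/-- The pull-back of the connection form along a map from a vector space. -/
def pullForm {V : Type*} [NormedAddCommGroup V] [NormedSpace ℝ V] (A : Connection Q) (q : V → P)
    (z : V) : V →L[ℝ] EG :=
  (A.formL (q z)).comp (modelDeriv q z)

end Connection

variable {V : Type*} [NormedAddCommGroup V] [NormedSpace ℝ V]

theorem mdifferentiableAt_extChartAt_symm {E : Type*} [NormedAddCommGroup E] [NormedSpace ℝ E]
    {N : Type*} [TopologicalSpace N] [ChartedSpace E N] [IsManifold 𝓘(ℝ, E) ∞ N] {c : N} {y : E}
    (hy : y ∈ (extChartAt 𝓘(ℝ, E) c).target) :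
    MDifferentiableAt 𝓘(ℝ, E) 𝓘(ℝ, E) (extChartAt 𝓘(ℝ, E) c).symm y :=
  (((contMDiffOn_extChartAt_symm (n := ∞) c) y hy).contMDiffAt
    ((isOpen_extChartAt_target c).mem_nhds hy)).mdifferentiableAt (by simp)

/-- The chart expression near `z` of a smooth map, in the chart centred at its value at `z`. -/
theorem ContMDiffAt.extChartAt_comp {N E : Type*} [NormedAddCommGroup E] [NormedSpace ℝ E]
    [TopologicalSpace N] [ChartedSpace E N] [IsManifold 𝓘(ℝ, E) ∞ N] {q : V → N} {z : V}
    {n : WithTop ℕ∞} (hq : ContMDiffAt 𝓘(ℝ, V) 𝓘(ℝ, E) n q z) :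
    ContDiffAt ℝ n (fun w => extChartAt 𝓘(ℝ, E) (q z) (q w)) z :=
  contMDiffAt_iff_contDiffAt.1 (ContMDiffAt.comp (g := extChartAt 𝓘(ℝ, E) (q z)) z
    contMDiffAt_extChartAt hq)

/-- The pull-back of the connection form, computed in a chart of the total space. -/
theorem Connection.pullForm_eventuallyEq (A : Connection Q) {q : V → P} {z : V}
    (hq : ContMDiffAt 𝓘(ℝ, V) 𝓘(ℝ, EP) 2 q z) :
    A.pullForm q =ᶠ[𝓝 z] fun w => (A.localForm (q z) (extChartAt 𝓘(ℝ, EP) (q z) (q w))).comp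
      (fderiv ℝ (fun w => extChartAt 𝓘(ℝ, EP) (q z) (q w)) w) := by
  have h1 : ∀ᶠ w in 𝓝 z, q w ∈ (extChartAt 𝓘(ℝ, EP) (q z)).source :=
    hq.continuousAt.eventually (extChartAt_source_mem_nhds (q z))
  have h2 := ((ContMDiffAt.extChartAt_comp hq).of_le one_le_two).eventually (by simp)
  filter_upwards [h1.eventually_nhds, h2] with w hw hd
  have h3 : q =ᶠ[𝓝 w] fun m => (extChartAt 𝓘(ℝ, EP) (q z)).symm
      (extChartAt 𝓘(ℝ, EP) (q z) (q m)) := by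
    filter_upwards [hw] with m hm
    exact ((extChartAt 𝓘(ℝ, EP) (q z)).left_inv hm).symm
  have h4 := (extChartAt 𝓘(ℝ, EP) (q z)).map_source hw.self_of_nhds
  rw [Connection.pullForm, modelDeriv_congr h3, modelDeriv_comp
    (f := fun m => extChartAt 𝓘(ℝ, EP) (q z) (q m))
    (mdifferentiableAt_extChartAt_symm h4)
    (hd.differentiableAt (by simp)).mdifferentiableAt,
    modelDeriv_eq_fderiv, Connection.localForm, (extChartAt 𝓘(ℝ, EP) (q z)).left_inv hw.self_of_nhds]
  rfl

variable [FiniteDimensional ℝ EP]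

theorem Connection.contDiffAt_localForm (A : Connection Q) (c : P) :
    ContDiffAt ℝ ∞ (A.localForm c) (extChartAt 𝓘(ℝ, EP) c c) :=
  (A.contDiffOn_localForm c).contDiffAt (extChartAt_target_mem_nhds c)

theorem Connection.contDiffAt_pullForm (A : Connection Q) {q : V → P} {z : V}
    (hq : ContMDiffAt 𝓘(ℝ, V) 𝓘(ℝ, EP) ∞ q z) : ContDiffAt ℝ ∞ (A.pullForm q) z := by
  have hy := ContMDiffAt.extChartAt_comp hq
  refine ContDiffAt.congr_of_eventuallyEq ?_
    (A.pullForm_eventuallyEq (hq.of_le (by exact ENat.LEInfty.out)))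
  refine ContDiffAt.clm_comp ?_ (hy.fderiv_right (by simp))
  exact ContDiffAt.comp z (A.contDiffAt_localForm (q z)) hy

theorem Connection.contDiff_pullForm (A : Connection Q) {q : V → P}
    (hq : ContMDiff 𝓘(ℝ, V) 𝓘(ℝ, EP) ∞ q) : ContDiff ℝ ∞ (A.pullForm q) :=
  contDiff_iff_contDiffAt.2 fun z => A.contDiffAt_pullForm (hq z)

/-- The curvature form with values in the model spaces. -/
def Connection.curvatureL (A : Connection Q) (p : P) (U U' : EP) : EG :=
  fderiv ℝ (A.localForm p) (extChartAt 𝓘(ℝ, EP) p p) U U' -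
    fderiv ℝ (A.localForm p) (extChartAt 𝓘(ℝ, EP) p p) U' U +
    adL EG G (A.formL p U) (A.formL p U')

theorem Connection.toModel_curvatureForm (A : Connection Q) (p : P)
    (U U' : TangentSpace 𝓘(ℝ, EP) p) :
    toModel (A.curvatureForm p U U') = A.curvatureL p U U' := by
  have h (W : EP) : fderiv ℝ (component A.form p W) (extChartAt 𝓘(ℝ, EP) p p) =
      (fderiv ℝ (A.localForm p) (extChartAt 𝓘(ℝ, EP) p p)).flip W := by
    have h1 := ((A.contDiffAt_localForm p).differentiableAt (by simp)).hasFDerivAt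
    have h2 := h1.clm_apply (hasFDerivAt_const W _)
    refine h2.fderiv.trans ?_
    rw [ContinuousLinearMap.comp_zero, zero_add]
  have h3 := adL_apply (A.form p U) (A.form p U')
  have h4 : ∀ W W' : EP, fderiv ℝ (component A.form p W) (extChartAt 𝓘(ℝ, EP) p p) W' =
      fderiv ℝ (A.localForm p) (extChartAt 𝓘(ℝ, EP) p p) W' W := fun W W' => by
    rw [h]; rfl
  exact congrArg₂ (· + ·) (congrArg₂ (· - ·) (h4 U' U) (h4 U U')) h3.symm

/-- Naturality of the curvature form. -/
theorem Connection.curvatureL_modelDeriv (A : Connection Q) {q : V → P} {z : V}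
    (hq : ContMDiffAt 𝓘(ℝ, V) 𝓘(ℝ, EP) ∞ q z) (u v : V) :
    A.curvatureL (q z) (modelDeriv q z u) (modelDeriv q z v) =
      fderiv ℝ (A.pullForm q) z u v - fderiv ℝ (A.pullForm q) z v u +
        adL EG G (A.pullForm q z u) (A.pullForm q z v) := by
  have hy := ContMDiffAt.extChartAt_comp hq
  have h1 := ((A.contDiffAt_localForm (q z)).differentiableAt (by simp)).hasFDerivAt
  have h2 := (hy.differentiableAt (by simp)).hasFDerivAt
  have h3 := ((hy.fderiv_right (m := ∞) (by simp)).differentiableAt (by simp)).hasFDerivAt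
  have h4 := ((h1.comp z h2).clm_comp h3).congr_of_eventuallyEq
    (A.pullForm_eventuallyEq (hq.of_le (by exact ENat.LEInfty.out)))
  -- the terms with the second derivative of `q` cancel by its symmetry
  have h5 : IsSymmSndFDerivAt ℝ (fun w => extChartAt 𝓘(ℝ, EP) (q z) (q w)) z :=
    hy.isSymmSndFDerivAt (by
      rw [minSmoothness_of_isRCLikeNormedField]; exact ENat.LEInfty.out)
  rw [h4.fderiv, ← modelDeriv_eq_fderiv_extChartAt (hq.mdifferentiableAt (by simp))]
  have h6 := h5 u v
  simp only [Connection.curvatureL, Connection.pullForm, add_apply,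
    ContinuousLinearMap.comp_apply, ContinuousLinearMap.compL_apply,
    ContinuousLinearMap.flip_apply, h6]
  abel

end Connection

end

/-! ### The action of the structure group -/

section

variable {EM EP EG : Type*}
  [NormedAddCommGroup EM] [NormedSpace ℝ EM]
  [NormedAddCommGroup EP] [NormedSpace ℝ EP]
  [NormedAddCommGroup EG] [NormedSpace ℝ EG]
  {M P G : Type*}
  [TopologicalSpace M] [ChartedSpace EM M] [IsManifold 𝓘(ℝ, EM) ∞ M]
  [TopologicalSpace P] [ChartedSpace EP P] [IsManifold 𝓘(ℝ, EP) ∞ P]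
  [TopologicalSpace G] [ChartedSpace EG G] [Group G] [LieGroup 𝓘(ℝ, EG) ∞ G]
  {Q : PrincipalBundle EM EP EG M P G}
  {V : Type*} [NormedAddCommGroup V] [NormedSpace ℝ V]

section Action

variable {E : Type*} [NormedAddCommGroup E] [NormedSpace ℝ E] {N : Type*} [TopologicalSpace N]
  [ChartedSpace E N]

namespace PrincipalBundle

/-- The vertical vector at `p` generated by an element of the Lie algebra. -/
def vertical (Q : PrincipalBundle EM EP EG M P G) (p : P) : EG →L[ℝ] EP :=
  modelDeriv (fun c : G => Q.act p c) 1

/-- The derivative at `p` of the right translation by `g`. -/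
def translate (Q : PrincipalBundle EM EP EG M P G) (g : G) (p : P) : EP →L[ℝ] EP :=
  modelDeriv (fun p' : P => Q.act p' g) p

/-- The derivative of the projection. -/
def projL (Q : PrincipalBundle EM EP EG M P G) (p : P) : EP →L[ℝ] EM := modelDeriv Q.proj p

theorem contMDiff_act_left (Q : PrincipalBundle EM EP EG M P G) (p : P) :
    ContMDiff 𝓘(ℝ, EG) 𝓘(ℝ, EP) ∞ (fun c : G => Q.act p c) :=
  Q.contMDiff_act.comp (contMDiff_const.prodMk contMDiff_id)

theorem contMDiff_act_right (Q : PrincipalBundle EM EP EG M P G) (g : G) :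
    ContMDiff 𝓘(ℝ, EP) 𝓘(ℝ, EP) ∞ (fun p : P => Q.act p g) :=
  Q.contMDiff_act.comp (contMDiff_id.prodMk contMDiff_const)

theorem contMDiffAt_act (Q : PrincipalBundle EM EP EG M P G) {q : N → P} {g : N → G} {z : N}
    {n : WithTop ℕ∞} (hn : n ≤ ∞)
    (hq : ContMDiffAt 𝓘(ℝ, E) 𝓘(ℝ, EP) n q z) (hg : ContMDiffAt 𝓘(ℝ, E) 𝓘(ℝ, EG) n g z) :
    ContMDiffAt 𝓘(ℝ, E) 𝓘(ℝ, EP) n (fun w => Q.act (q w) (g w)) z :=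
  ContMDiffAt.comp (g := fun q : P × G => Q.act q.1 q.2) z
    ((Q.contMDiff_act.of_le hn) _) (hq.prodMk hg)

theorem mdifferentiableAt_act (Q : PrincipalBundle EM EP EG M P G) {q : N → P} {g : N → G} {z : N}
    (hq : MDifferentiableAt 𝓘(ℝ, E) 𝓘(ℝ, EP) q z) (hg : MDifferentiableAt 𝓘(ℝ, E) 𝓘(ℝ, EG) g z) :
    MDifferentiableAt 𝓘(ℝ, E) 𝓘(ℝ, EP) (fun w => Q.act (q w) (g w)) z :=
  MDifferentiableAt.comp (g := fun q : P × G => Q.act q.1 q.2) z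
    (Q.contMDiff_act.mdifferentiable (by simp) _) (hq.prodMk hg)

/-- The Leibniz rule for the action. -/
theorem modelDeriv_act_apply (Q : PrincipalBundle EM EP EG M P G) {q : N → P} {g : N → G} {z : N}
    (hq : MDifferentiableAt 𝓘(ℝ, E) 𝓘(ℝ, EP) q z) (hg : MDifferentiableAt 𝓘(ℝ, E) 𝓘(ℝ, EG) g z)
    (u : E) :
    (modelDeriv (fun w => Q.act (q w) (g w)) z : E →L[ℝ] EP) u =
      Q.translate (g z) (q z) (modelDeriv q z u) +
        (modelDeriv (fun c => Q.act (q z) c) (g z) : EG →L[ℝ] EP)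
          ((modelDeriv g z : E →L[ℝ] EG) u) := by
  have h1 := (Q.contMDiff_act.mdifferentiable (by simp) (q z, g z))
  have h2 := (h1.hasMFDerivAt.comp (f := fun w => (q w, g w)) z
    (hq.hasMFDerivAt.prodMk hg.hasMFDerivAt)).mfderiv
  have h3 := DFunLike.congr_fun (mfderiv_prod_eq_add_comp h1)
    (modelDeriv q z u, (modelDeriv g z : E →L[ℝ] EG) u)
  exact (DFunLike.congr_fun h2 u).trans h3

/-- The Leibniz rule for the action, at a point where the group factor is `1`. -/
theorem modelDeriv_act_of_eq_one (Q : PrincipalBundle EM EP EG M P G) {q : V → P} {k : V → G}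
    {z : V} {r : V →L[ℝ] EG} (hq : MDifferentiableAt 𝓘(ℝ, V) 𝓘(ℝ, EP) q z)
    (hk : HasLogDerivAt k r z) (hk1 : k z = 1) (u : V) :
    modelDeriv (fun w => Q.act (q w) (k w)) z u =
      modelDeriv q z u + Q.vertical (q z) (r u) := by
  have hkd : MDifferentiableAt 𝓘(ℝ, V) 𝓘(ℝ, EG) k z :=
    (hasMFDerivWithinAt_univ.1 hk.hasMFDerivWithinAt).mdifferentiableAt
  have h1 : modelDeriv k z = r := by
    rw [modelDeriv_eq_fderiv_extChartAt hkd]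
    have := hk.2
    rw [hasFDerivWithinAt_univ, hk1, inv_one] at this
    simpa [hk1] using this.fderiv
  rw [Q.modelDeriv_act_apply hq hkd, h1, hk1, vertical, translate]
  have h2 : (fun p' : P => Q.act p' 1) = fun p' => p' := funext Q.act_one
  rw [h2, modelDeriv_id]
  rfl

/-- The Leibniz rule for the action in terms of the logarithmic derivative of the group factor:
write `q g` as `q (g g₀⁻¹)` translated by `g₀`. -/
theorem modelDeriv_act (Q : PrincipalBundle EM EP EG M P G) {q : V → P} {g : V → G}
    {z : V} {r : V →L[ℝ] EG} (hq : MDifferentiableAt 𝓘(ℝ, V) 𝓘(ℝ, EP) q z)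
    (hg : HasLogDerivAt g r z) (u : V) :
    modelDeriv (fun w => Q.act (q w) (g w)) z u =
      Q.translate (g z) (q z) (modelDeriv q z u + Q.vertical (q z) (r u)) := by
  have hk : HasLogDerivAt (fun w => g w * (g z)⁻¹) r z := hg.mul_const _
  have hk1 : g z * (g z)⁻¹ = 1 := mul_inv_cancel _
  have hkd : MDifferentiableAt 𝓘(ℝ, V) 𝓘(ℝ, EG) (fun w => g w * (g z)⁻¹) z :=
    (hasMFDerivWithinAt_univ.1 hk.hasMFDerivWithinAt).mdifferentiableAt
  have h1 : (fun w => Q.act (q w) (g w)) =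
      fun w => Q.act (Q.act (q w) (g w * (g z)⁻¹)) (g z) := by
    ext w; rw [← Q.act_mul, inv_mul_cancel_right]
  rw [h1, modelDeriv_comp (g := fun p => Q.act p (g z))
    (f := fun w => Q.act (q w) (g w * (g z)⁻¹))
    (Q.contMDiff_act_right (g z) |>.mdifferentiable (by simp) _) (Q.mdifferentiableAt_act hq hkd),
    ContinuousLinearMap.comp_apply, Q.modelDeriv_act_of_eq_one hq hk hk1]
  simp only [hk1, Q.act_one]
  rfl

theorem projL_vertical (Q : PrincipalBundle EM EP EG M P G) (p : P) (ξ : EG) :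
    Q.projL p (Q.vertical p ξ) = 0 := by
  have h1 := modelDeriv_comp (g := Q.proj) (f := fun c => Q.act p c) (x := (1 : G))
    (Q.contMDiff_proj.mdifferentiable (by simp) _)
    (Q.contMDiff_act_left p |>.mdifferentiable (by simp) _)
  simp only [Q.proj_act, modelDeriv_const, Q.act_one] at h1
  exact (DFunLike.congr_fun h1 ξ).symm

end PrincipalBundle

namespace Connection

theorem formL_translate (A : Connection Q) (g : G) (p : P) (U : EP) :
    A.formL (Q.act p g) (Q.translate g p U) = AdL g⁻¹ (A.formL p U) :=
  (congrArg toModel (A.form_act p g U)).trans (toModel_Ad g⁻¹ (A.form p U))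

theorem formL_vertical (A : Connection Q) (p : P) (ξ : EG) :
    A.formL p (Q.vertical p ξ) = ξ := by
  have h : A.formL (Q.act p 1) (Q.vertical p ξ) = ξ := congrArg toModel (A.form_vertical p ξ)
  rwa [Q.act_one] at h

/-- The transformation of the pull-back of the connection form under a change of gauge. -/
theorem pullForm_act (A : Connection Q) {q : V → P} {g : V → G}
    {z : V} {r : V →L[ℝ] EG} (hq : MDifferentiableAt 𝓘(ℝ, V) 𝓘(ℝ, EP) q z)
    (hg : HasLogDerivAt g r z) (u : V) :
    A.pullForm (fun w => Q.act (q w) (g w)) z u = AdL (g z)⁻¹ (A.pullForm q z u + r u) := by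
  rw [pullForm, ContinuousLinearMap.comp_apply, Q.modelDeriv_act hq hg, A.formL_translate,
    map_add, A.formL_vertical]
  rfl

end Connection
end Action

end

/-! ### The curvature as a form on the base -/

section

variable {EM EP EG : Type*}
  [NormedAddCommGroup EM] [NormedSpace ℝ EM]
  [NormedAddCommGroup EP] [NormedSpace ℝ EP]
  [NormedAddCommGroup EG] [NormedSpace ℝ EG]
  {M P G : Type*}
  [TopologicalSpace M] [ChartedSpace EM M] [IsManifold 𝓘(ℝ, EM) ∞ M]
  [TopologicalSpace P] [ChartedSpace EP P] [IsManifold 𝓘(ℝ, EP) ∞ P]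
  [TopologicalSpace G] [ChartedSpace EG G] [Group G] [LieGroup 𝓘(ℝ, EG) ∞ G]
  {Q : PrincipalBundle EM EP EG M P G}
  {V : Type*} [NormedAddCommGroup V] [NormedSpace ℝ V]

section Horizontal

namespace PrincipalBundle

/-- The derivative of the projection to the base of a map from a vector space to the total
space. -/
def baseDeriv (Q : PrincipalBundle EM EP EG M P G) (q : V → P) (z : V) : V →L[ℝ] EM :=
  modelDeriv (fun w => Q.proj (q w)) z

/-- The kernel of the derivative of the projection consists of vertical vectors. -/
theorem exists_vertical_eq (Q : PrincipalBundle EM EP EG M P G) {p : P} {W : EP}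
    (hW : Q.projL p W = 0) : ∃ ξ, Q.vertical p ξ = W := by
  obtain ⟨U, hU, hx, s, ψ, hs, -, hψ, hact⟩ := Q.locallyTrivial (Q.proj p)
  have hpU : Q.proj ⁻¹' U ∈ 𝓝 p :=
    Q.contMDiff_proj.continuous.continuousAt.preimage_mem_nhds (hU.mem_nhds hx)
  have hsd : MDifferentiableAt 𝓘(ℝ, EM) 𝓘(ℝ, EP) s (Q.proj p) :=
    (hs.contMDiffAt (hU.mem_nhds hx)).mdifferentiableAt (by simp)
  have hpd := Q.contMDiff_proj.mdifferentiable (by simp) p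
  have hψd : MDifferentiableAt 𝓘(ℝ, EP) 𝓘(ℝ, EG) ψ p :=
    (hψ.contMDiffAt hpU).mdifferentiableAt (by simp)
  -- differentiate `s (proj p) ψ(p) = p` in the direction `W`
  have h1 : (fun p' => Q.act (s (Q.proj p')) (ψ p')) =ᶠ[𝓝 p] fun p' => p' := by
    filter_upwards [hpU] with p' hp' using hact p' hp'
  have h2 := Q.modelDeriv_act_apply (hsd.comp p hpd) hψd W
  have h3 : (modelDeriv (fun p' => s (Q.proj p')) p : EP →L[ℝ] EP) W = 0 := by
    rw [modelDeriv_comp hsd hpd]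
    exact (congrArg (modelDeriv s (Q.proj p) : EM →L[ℝ] EP) hW).trans (map_zero _)
  -- the orbit through the section is the orbit through `p`, translated
  have h4 : (fun c => Q.act (s (Q.proj p)) c) = fun c => Q.act p ((ψ p)⁻¹ * c) := by
    ext c
    have h := Q.act_mul (s (Q.proj p)) (ψ p) ((ψ p)⁻¹ * c)
    rwa [hact p hx, mul_inv_cancel_left] at h
  have h5 : MDifferentiableAt 𝓘(ℝ, EG) 𝓘(ℝ, EG) (fun c => (ψ p)⁻¹ * c) (ψ p) :=
    (contMDiff_mul_left (I := 𝓘(ℝ, EG)) (n := ∞) (a := (ψ p)⁻¹)).mdifferentiable (by simp) _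
  refine ⟨(modelDeriv (fun c => (ψ p)⁻¹ * c) (ψ p) : EG →L[ℝ] EG)
    ((modelDeriv ψ p : EP →L[ℝ] EG) W), ?_⟩
  have h6 := modelDeriv_comp (g := fun c => Q.act p c) (f := fun c => (ψ p)⁻¹ * c) (x := ψ p)
    (Q.contMDiff_act_left p |>.mdifferentiable (by simp) _) h5
  simp only [Function.comp_apply, h4] at h2
  rw [modelDeriv_congr (h1 : (fun p' => Q.act ((s ∘ Q.proj) p') (ψ p')) =ᶠ[𝓝 p] fun p' => p'),
    modelDeriv_id, h6, inv_mul_cancel] at h2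
  have h7 : (modelDeriv (s ∘ Q.proj) p : EP →L[ℝ] EP) W = 0 := h3
  rw [h7, map_zero, zero_add] at h2
  exact h2.symm

theorem exists_projL_eq (Q : PrincipalBundle EM EP EG M P G) (p : P) (u : EM) :
    ∃ W, Q.projL p W = u := by
  -- the derivative of a local section through `p` is a right inverse
  obtain ⟨U, hU, hx, s, ψ, hs, hsec, hψ, hact⟩ := Q.locallyTrivial (Q.proj p)
  have hsd : MDifferentiableAt 𝓘(ℝ, EM) 𝓘(ℝ, EP) s (Q.proj p) :=
    (hs.contMDiffAt (hU.mem_nhds hx)).mdifferentiableAt (by simp)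
  have hd : MDifferentiableAt 𝓘(ℝ, EM) 𝓘(ℝ, EP) (fun y => Q.act (s y) (ψ p)) (Q.proj p) :=
    Q.mdifferentiableAt_act hsd mdifferentiableAt_const
  have h1 := modelDeriv_comp (g := Q.proj) (Q.contMDiff_proj.mdifferentiable (by simp) _) hd
  have h2 : (fun y => Q.proj (Q.act (s y) (ψ p))) =ᶠ[𝓝 (Q.proj p)] fun y => y := by
    filter_upwards [hU.mem_nhds hx] with y hy
    rw [Q.proj_act, hsec y hy]
  rw [modelDeriv_congr h2, modelDeriv_id, hact p hx] at h1
  exact ⟨_, (DFunLike.congr_fun h1 u).symm⟩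

end PrincipalBundle

namespace Connection

/-- The horizontal lift of a vector, in the model spaces. -/
def horizontalL (A : Connection Q) (p : P) (u : EM) : EP := A.horizontalVector p u

/-- Every vector of the base has a horizontal lift: subtract from any lift its vertical part. -/
theorem horizontalL_spec (A : Connection Q) (p : P) (u : EM) :
    Q.projL p (A.horizontalL p u) = u ∧ A.formL p (A.horizontalL p u) = 0 := by
  have h : ∃ U : TangentSpace 𝓘(ℝ, EP) p, mfderiv 𝓘(ℝ, EP) 𝓘(ℝ, EM) Q.proj p U = u ∧
      A.form p U = 0 := by
    obtain ⟨W, hW⟩ := Q.exists_projL_eq p u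
    refine ⟨W - Q.vertical p (A.formL p W), ?_, ?_⟩
    · change Q.projL p (W - Q.vertical p (A.formL p W)) = u
      rw [map_sub, Q.projL_vertical, hW, sub_zero]
    · change A.formL p (W - Q.vertical p (A.formL p W)) = 0
      rw [map_sub, A.formL_vertical, sub_self]
  exact Classical.epsilon_spec h

/-- The decomposition of a vector into its horizontal and vertical parts. -/
theorem eq_horizontalL_add_vertical (A : Connection Q) (p : P) (W : EP) :
    W = A.horizontalL p (Q.projL p W) + Q.vertical p (A.formL p W) := by
  have h := A.horizontalL_spec p (Q.projL p W)
  obtain ⟨ξ, hξ⟩ := Q.exists_vertical_eq (p := p)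
    (W := W - A.horizontalL p (Q.projL p W)) (by rw [map_sub, h.1, sub_self])
  have h1 : A.formL p W = ξ := by
    rw [← A.formL_vertical p ξ, hξ, map_sub, h.2, sub_zero]
  rw [h1, hξ]; abel

end Connection
end Horizontal

theorem Connection.pullForm_comp (A : Connection Q) {V' : Type*} [NormedAddCommGroup V']
    [NormedSpace ℝ V'] {q : V → P} {H : V' → V} {z : V'}
    (hq : MDifferentiableAt 𝓘(ℝ, V) 𝓘(ℝ, EP) q (H z)) (hH : DifferentiableAt ℝ H z) :
    A.pullForm (fun w => q (H w)) z = (A.pullForm q (H z)).comp (fderiv ℝ H z) := by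
  rw [pullForm, modelDeriv_comp hq hH.mdifferentiableAt, modelDeriv_eq_fderiv]
  rfl

theorem adL_skew (v w : EG) : adL EG G v w = -adL EG G w v := by
  have h1 := adL_apply (EG := EG) (G := G) (ofModel v) (ofModel w)
  have h2 := adL_apply (EG := EG) (G := G) (ofModel w) (ofModel v)
  have h3 (a b : GroupLieAlgebra 𝓘(ℝ, EG) G) : ⁅a, b⁆ = -⁅b, a⁆ := by
    rw [GroupLieAlgebra.bracket_def, GroupLieAlgebra.bracket_def]
    exact VectorField.mlieBracket_swap_apply
  exact h1.trans ((congrArg toModel (h3 _ _)).trans (congrArg Neg.neg h2.symm))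

section Curvature

variable [FiniteDimensional ℝ EP] [FiniteDimensional ℝ EG]

namespace Connection

theorem curvatureL_skew (A : Connection Q) (p : P) (U U' : EP) :
    A.curvatureL p U U' = -A.curvatureL p U' U := by
  rw [curvatureL, curvatureL, adL_skew (G := G)]
  abel

theorem curvatureL_add_right (A : Connection Q) (p : P) (U U' U'' : EP) :
    A.curvatureL p U (U' + U'') = A.curvatureL p U U' + A.curvatureL p U U'' := by
  simp only [curvatureL, map_add, add_apply]
  abel

theorem curvatureL_add_left (A : Connection Q) (p : P) (U U' U'' : EP) :
    A.curvatureL p (U + U') U'' = A.curvatureL p U U'' + A.curvatureL p U' U'' := by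
  rw [curvatureL_skew, curvatureL_add_right, neg_add, ← curvatureL_skew, ← curvatureL_skew]

/-- The curvature form is horizontal: naturality is applied to the surface `(a, b) ↦ c(a) k(b)`,
where `c` is a curve with velocity `U` and `k` a one-parameter subgroup. -/
theorem curvatureL_vertical (A : Connection Q) (p : P) (U : EP) (ξ : EG) :
    A.curvatureL p U (Q.vertical p ξ) = 0 := by
  obtain ⟨k, hk0, hk⟩ := exists_hasLogDerivAt (G := G) (ξ := fun _ => ξ) continuous_const 1
  have hks : ContMDiff 𝓘(ℝ, ℝ) 𝓘(ℝ, EG) ∞ k :=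
    contMDiff_of_hasLogDerivAt hk fun n _ => contDiff_const
  set y : EP := extChartAt 𝓘(ℝ, EP) p p with hy
  set c : ℝ → P := fun t => (extChartAt 𝓘(ℝ, EP) p).symm (y + t • U) with hc
  have hc0 : c 0 = p := by simp [hc, hy]
  have hline : ContDiff ℝ ∞ fun t : ℝ => y + t • U := by fun_prop
  have hymem : y ∈ (extChartAt 𝓘(ℝ, EP) p).target := mem_extChartAt_target p
  have htarget : ∀ᶠ t : ℝ in 𝓝 0, y + t • U ∈ (extChartAt 𝓘(ℝ, EP) p).target :=
    (hline.continuous.tendsto 0).eventually (by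
      rw [zero_smul, add_zero]; exact (isOpen_extChartAt_target p).mem_nhds hymem)
  have hcs' : ∀ᶠ t : ℝ in 𝓝 0, ContMDiffAt 𝓘(ℝ, ℝ) 𝓘(ℝ, EP) ∞ c t := by
    filter_upwards [htarget] with t ht
    exact ContMDiffAt.comp (g := (extChartAt 𝓘(ℝ, EP) p).symm) (f := fun t : ℝ => y + t • U)
      t ((contMDiffOn_extChartAt_symm p).contMDiffAt ((isOpen_extChartAt_target p).mem_nhds ht))
      hline.contMDiff.contMDiffAt
  have hcs := hcs'.self_of_nhds
  have hcd : modelDeriv c 0 (1 : ℝ) = U := by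
    rw [modelDeriv_eq_fderiv_extChartAt (hcs.mdifferentiableAt (by simp)), hc0]
    have h1 : (fun t => extChartAt 𝓘(ℝ, EP) p (c t)) =ᶠ[𝓝 0] fun t : ℝ => y + t • U := by
      filter_upwards [htarget] with t ht using (extChartAt 𝓘(ℝ, EP) p).right_inv ht
    rw [h1.fderiv_eq]
    have h3 : HasFDerivAt (fun t : ℝ => y + t • U)
      ((ContinuousLinearMap.id ℝ ℝ).smulRight U) 0 :=
      ((ContinuousLinearMap.id ℝ ℝ).smulRight U).hasFDerivAt.const_add y
    rw [h3.fderiv]; simp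
  set q : ℝ × ℝ → P := fun w => c w.1
  set g : ℝ × ℝ → G := fun w => k w.2
  have hqs : ContMDiffAt 𝓘(ℝ, ℝ × ℝ) 𝓘(ℝ, EP) ∞ q 0 :=
    ContMDiffAt.comp (g := c) (f := Prod.fst) (0 : ℝ × ℝ) hcs contDiff_fst.contMDiff.contMDiffAt
  have hgs : ContMDiff 𝓘(ℝ, ℝ × ℝ) 𝓘(ℝ, EG) ∞ g := hks.comp contDiff_snd.contMDiff
  have hgl (z) : HasLogDerivAt g ((spanL ξ).comp (ContinuousLinearMap.snd ℝ ℝ ℝ)) z :=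
    HasLogDerivWithinAt.comp (g := k) (f := Prod.snd) (hk z.2)
      hasFDerivAt_snd.hasFDerivWithinAt (mapsTo_univ _ _)
  have hg0 : g 0 = 1 := hk0
  have hq0 : q 0 = p := hc0
  have hpull : ∀ᶠ t : ℝ in 𝓝 0, ∀ b u, A.pullForm (fun w => Q.act (q w) (g w)) (t, b) u =
      AdL (k b)⁻¹ (A.pullForm c t u.1 + u.2 • ξ) := by
    filter_upwards [hcs'] with t ht b u
    have ht' := ht.mdifferentiableAt (by simp)
    have hqd : MDifferentiableAt 𝓘(ℝ, ℝ × ℝ) 𝓘(ℝ, EP) q (t, b) :=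
      MDifferentiableAt.comp (g := c) (f := Prod.fst) (t, b) ht'
        differentiableAt_fst.mdifferentiableAt
    rw [A.pullForm_act hqd (hgl _)]
    have h3 : A.pullForm q (t, b) u = A.pullForm c t u.1 := by
      rw [pullForm, modelDeriv_comp (f := Prod.fst) ht' differentiableAt_fst.mdifferentiableAt,
        modelDeriv_eq_fderiv, fderiv_fst]
      rfl
    rw [h3]
    rfl
  have hsm : ContMDiffAt 𝓘(ℝ, ℝ × ℝ) 𝓘(ℝ, EP) ∞ (fun w => Q.act (q w) (g w)) 0 :=
    Q.contMDiffAt_act le_rfl hqs hgs.contMDiffAt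
  have hD := ((A.contDiffAt_pullForm hsm).differentiableAt (by simp)).hasFDerivAt
  have hnat := A.curvatureL_modelDeriv hsm (1, 0) (0, 1)
  have hd (u : ℝ × ℝ) : modelDeriv (fun w => Q.act (q w) (g w)) 0 u = u.1 • U + u.2 • Q.vertical p ξ := by
    rw [Q.modelDeriv_act_of_eq_one (hqs.mdifferentiableAt (by simp)) (hgl 0) hg0,
      modelDeriv_comp (g := c) (f := Prod.fst) (hcs.mdifferentiableAt (by simp))
        differentiableAt_fst.mdifferentiableAt, modelDeriv_eq_fderiv, fderiv_fst, hq0]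
    have h1 : modelDeriv c 0 u.1 = u.1 • U := by
      rw [← hcd, ← map_smul, smul_eq_mul, mul_one]
    have h2 : Q.vertical p (u.2 • ξ) = u.2 • Q.vertical p ξ := map_smul _ _ _
    exact congrArg₂ (· + ·) h1 h2
  have hp0 : A.pullForm c 0 1 = A.formL p U := by
    rw [pullForm, ContinuousLinearMap.comp_apply, hcd, hc0]
  -- the derivative of the second component along the first coordinate vanishes
  have hD1 : fderiv ℝ (A.pullForm fun w => Q.act (q w) (g w)) 0 (1, 0) (0, 1) = 0 := by
    have h1 : HasDerivAt (fun t : ℝ => ((t, 0) : ℝ × ℝ)) (1, 0) 0 :=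
      (hasDerivAt_id (0 : ℝ)).prodMk (hasDerivAt_const _ _)
    have h2 := ((HasFDerivAt.comp_hasDerivAt (0 : ℝ) (f := fun t : ℝ => ((t, 0) : ℝ × ℝ)) hD h1).clm_apply
      (hasDerivAt_const (0 : ℝ) ((0, 1) : ℝ × ℝ)))
    have h3 : (fun t : ℝ => A.pullForm (fun w => Q.act (q w) (g w)) (t, 0) (0, 1))
        =ᶠ[𝓝 0] fun _ => ξ := by
      filter_upwards [hpull] with t ht
      rw [ht]; simp [hk0, AdL_one]
    have h4 := h2.unique ((hasDerivAt_const (0 : ℝ) ξ).congr_of_eventuallyEq h3)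
    simpa using h4
  have hD2 : fderiv ℝ (A.pullForm fun w => Q.act (q w) (g w)) 0 (0, 1) (1, 0) =
      -adL EG G ξ (A.formL p U) := by
    have h1 : HasDerivAt (fun t : ℝ => ((0, t) : ℝ × ℝ)) (0, 1) 0 :=
      (hasDerivAt_const _ _).prodMk (hasDerivAt_id (0 : ℝ))
    have h2 := ((HasFDerivAt.comp_hasDerivAt (0 : ℝ) (f := fun t : ℝ => ((0, t) : ℝ × ℝ)) hD h1).clm_apply
      (hasDerivAt_const (0 : ℝ) ((1, 0) : ℝ × ℝ)))
    have h3 : (fun t : ℝ => A.pullForm (fun w => Q.act (q w) (g w)) (0, t) (1, 0)) =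
        fun t => AdL (k t)⁻¹ (A.formL p U) := by
      ext t
      rw [hpull.self_of_nhds]; simp [hp0]
    have h4 := ((hk 0).inv.AdL_apply
      (hasFDerivAt_const (A.formL p U) (0 : ℝ)).hasFDerivWithinAt).hasFDerivAt univ_mem
    have h5 := h2.unique (h3 ▸ h4.hasDerivAt)
    simpa [hk0, AdL_one] using h5
  have hval : A.pullForm (fun w => Q.act (q w) (g w)) 0 (1, 0) = A.formL p U ∧
      A.pullForm (fun w => Q.act (q w) (g w)) 0 (0, 1) = ξ := by
    constructor
    · refine (hpull.self_of_nhds 0 (1, 0)).trans ?_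
      simp [hk0, hp0, AdL_one]
    · refine (hpull.self_of_nhds 0 (0, 1)).trans ?_
      simp [hk0, AdL_one]
  rw [hD1, hD2, hval.1, hval.2, hd, hd, adL_skew (G := G) (A.formL p U)] at hnat
  simpa [hq0, hg0, Q.act_one] using hnat

/-- The curvature of the connection, in the model spaces. -/
def baseCurvature (A : Connection Q) (p : P) (u v : EM) : EG :=
  A.curvatureL p (A.horizontalL p u) (A.horizontalL p v)

theorem toModel_curvature (A : Connection Q) (p : P) (u v : TangentSpace 𝓘(ℝ, EM) (Q.proj p)) :
    toModel (A.curvature p u v) = A.baseCurvature p u v :=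
  A.toModel_curvatureForm p _ _

/-- The curvature form is the pull-back of the curvature of the base, since both vertical parts drop
out. -/
theorem curvatureL_eq_baseCurvature (A : Connection Q) (p : P) (U W : EP) :
    A.curvatureL p U W = A.baseCurvature p (Q.projL p U) (Q.projL p W) := by
  conv_lhs => rw [A.eq_horizontalL_add_vertical p U, A.eq_horizontalL_add_vertical p W]
  rw [curvatureL_add_right, curvatureL_vertical, add_zero, curvatureL_add_left,
    A.curvatureL_skew p (Q.vertical p _), curvatureL_vertical, neg_zero, add_zero, baseCurvature]

/-- The structure equation: the curvature of the base along the projection of a map `q` into the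
total space, in the gauge `q`. -/
theorem baseCurvature_modelDeriv (A : Connection Q) {q : V → P} {z : V}
    (hq : ContMDiffAt 𝓘(ℝ, V) 𝓘(ℝ, EP) ∞ q z) (u v : V) :
    A.baseCurvature (q z) (Q.baseDeriv q z u) (Q.baseDeriv q z v) =
      fderiv ℝ (A.pullForm q) z u v - fderiv ℝ (A.pullForm q) z v u +
        adL EG G (A.pullForm q z u) (A.pullForm q z v) := by
  rw [← A.curvatureL_modelDeriv hq, curvatureL_eq_baseCurvature, PrincipalBundle.baseDeriv,
    modelDeriv_comp (Q.contMDiff_proj.mdifferentiable (by simp) _)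
      (hq.mdifferentiableAt (by simp))]
  rfl

end Connection
end Curvature

end

/-! ### The adjoint two-form -/

section TwoForm

variable {EM EP EG : Type*}
  [NormedAddCommGroup EM] [NormedSpace ℝ EM] [FiniteDimensional ℝ EM]
  [NormedAddCommGroup EP] [NormedSpace ℝ EP]
  [NormedAddCommGroup EG] [NormedSpace ℝ EG]
  {M P G : Type*}
  [TopologicalSpace M] [ChartedSpace EM M] [IsManifold 𝓘(ℝ, EM) ∞ M]
  [TopologicalSpace P] [ChartedSpace EP P] [IsManifold 𝓘(ℝ, EP) ∞ P]
  [TopologicalSpace G] [ChartedSpace EG G] [Group G] [LieGroup 𝓘(ℝ, EG) ∞ G]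
  {Q : PrincipalBundle EM EP EG M P G}
  {V : Type*} [NormedAddCommGroup V] [NormedSpace ℝ V]

theorem update_zero_pair (a b c : EM) : Function.update ![a, b] 0 c = ![c, b] := by
  ext i; fin_cases i <;> rfl

theorem update_one_pair (a b c : EM) : Function.update ![a, b] 1 c = ![a, c] := by
  ext i; fin_cases i <;> rfl

/-- A continuous alternating map of degree two as a bilinear map. -/
def alternatingBilin (w : EM [⋀^Fin 2]→L[ℝ] EG) : EM →L[ℝ] EM →L[ℝ] EG :=
  LinearMap.toContinuousLinearMap
    { toFun := fun u => LinearMap.toContinuousLinearMap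
        { toFun := fun v => w ![u, v]
          map_add' := fun v v' => by
            have h := w.map_update_add ![u, 0] 1 v v'
            rwa [update_one_pair, update_one_pair, update_one_pair] at h
          map_smul' := fun c v => by
            have h := w.map_update_smul ![u, 0] 1 c v
            rwa [update_one_pair, update_one_pair] at h }
      map_add' := fun u u' => by
        ext v
        have h := w.map_update_add ![0, v] 0 u u'
        rwa [update_zero_pair, update_zero_pair, update_zero_pair] at h
      map_smul' := fun c u => by
        ext v
        have h := w.map_update_smul ![0, v] 0 c u
        rwa [update_zero_pair, update_zero_pair] at h }

theorem alternatingBilin_self (w : EM [⋀^Fin 2]→L[ℝ] EG) (u : EM) :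
    alternatingBilin w u u = 0 :=
  w.map_eq_zero_of_eq ![u, u] (i := 0) (j := 1) rfl (by simp)

namespace AdjointTwoForm

/-- The value of the two-form in the gauge `p`, as a bilinear map of the model spaces. -/
def bilin (B : AdjointTwoForm Q) (p : P) : EM →L[ℝ] EM →L[ℝ] EG :=
  alternatingBilin (B.toFun p : EM [⋀^Fin 2]→L[ℝ] EG)

theorem bilin_self (B : AdjointTwoForm Q) (p : P) (u : EM) : B.bilin p u u = 0 :=
  alternatingBilin_self _ u

theorem bilin_skew (B : AdjointTwoForm Q) (p : P) (u v : EM) :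
    B.bilin p u v = -B.bilin p v u := by
  have h := B.bilin_self p (u + v)
  simp only [map_add, add_apply, bilin_self, zero_add, add_zero] at h
  exact eq_neg_of_add_eq_zero_right h

theorem bilin_act (B : AdjointTwoForm Q) (p : P) (g : G) (u v : EM) :
    B.bilin (Q.act p g) u v = AdL g⁻¹ (B.bilin p u v) :=
  (congrArg toModel (B.act p g u v)).trans (toModel_Ad _ _)

/-- The pull-back of the two-form along a map `q` into the total space, in the gauge `q`. -/
def pull (B : AdjointTwoForm Q) (q : V → P) (z : V) (u v : V) : EG :=
  B.bilin (q z) (Q.baseDeriv q z u) (Q.baseDeriv q z v)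

theorem pull_skew (B : AdjointTwoForm Q) (q : V → P) (z u v : V) :
    B.pull q z u v = -B.pull q z v u := B.bilin_skew _ _ _

/-- The pull-back of the two-form to the total space, in the chart centred at `c`. -/
def localBilin (B : AdjointTwoForm Q) (c : P) (y : EP) : EP →L[ℝ] EP →L[ℝ] EG :=
  (B.bilin ((extChartAt 𝓘(ℝ, EP) c).symm y)).bilinearComp
    ((Q.projL ((extChartAt 𝓘(ℝ, EP) c).symm y)).comp (modelDeriv (extChartAt 𝓘(ℝ, EP) c).symm y))
    ((Q.projL ((extChartAt 𝓘(ℝ, EP) c).symm y)).comp (modelDeriv (extChartAt 𝓘(ℝ, EP) c).symm y))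

theorem contDiffOn_localBilin [FiniteDimensional ℝ EP] (B : AdjointTwoForm Q) (c : P) :
    ContDiffOn ℝ ∞ (B.localBilin c) (extChartAt 𝓘(ℝ, EP) c).target :=
  contDiffOn_clm_apply.2 fun U => contDiffOn_clm_apply.2 fun U' => B.smooth c U U'

/-- The pull-back of the two-form, computed in a chart of the total space. -/
theorem pull_eventuallyEq (B : AdjointTwoForm Q) {q : V → P} {z : V}
    (hq : ContMDiffAt 𝓘(ℝ, V) 𝓘(ℝ, EP) 2 q z) (u v : V) :
    (fun w => B.pull q w u v) =ᶠ[𝓝 z]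
      fun w => B.localBilin (q z) (extChartAt 𝓘(ℝ, EP) (q z) (q w))
        (fderiv ℝ (fun w => extChartAt 𝓘(ℝ, EP) (q z) (q w)) w u)
        (fderiv ℝ (fun w => extChartAt 𝓘(ℝ, EP) (q z) (q w)) w v) := by
  have h1 : ∀ᶠ w in 𝓝 z, q w ∈ (extChartAt 𝓘(ℝ, EP) (q z)).source :=
    hq.continuousAt.eventually (extChartAt_source_mem_nhds (q z))
  have h2 := ((ContMDiffAt.extChartAt_comp hq).of_le one_le_two).eventually (by simp)
  filter_upwards [h1.eventually_nhds, h2] with w hw hd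
  have h3 : q =ᶠ[𝓝 w] fun m => (extChartAt 𝓘(ℝ, EP) (q z)).symm
      (extChartAt 𝓘(ℝ, EP) (q z) (q m)) := by
    filter_upwards [hw] with m hm
    exact ((extChartAt 𝓘(ℝ, EP) (q z)).left_inv hm).symm
  have h4 := (extChartAt 𝓘(ℝ, EP) (q z)).map_source hw.self_of_nhds
  have h5 : MDifferentiableAt 𝓘(ℝ, V) 𝓘(ℝ, EP) (fun m => (extChartAt 𝓘(ℝ, EP) (q z)).symm
      (extChartAt 𝓘(ℝ, EP) (q z) (q m))) w :=
    (mdifferentiableAt_extChartAt_symm h4).comp w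
      (hd.differentiableAt (by simp)).mdifferentiableAt
  have h6 : Q.baseDeriv q w = (Q.projL (q w)).comp
      ((modelDeriv (extChartAt 𝓘(ℝ, EP) (q z)).symm (extChartAt 𝓘(ℝ, EP) (q z) (q w))).comp
        (fderiv ℝ (fun w => extChartAt 𝓘(ℝ, EP) (q z) (q w)) w)) := by
    rw [PrincipalBundle.baseDeriv, modelDeriv_comp (Q.contMDiff_proj.mdifferentiable (by simp) _)
      (h3.symm.mdifferentiableAt_iff.1 h5), modelDeriv_congr h3, modelDeriv_comp
      (f := fun m => extChartAt 𝓘(ℝ, EP) (q z) (q m))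
      (mdifferentiableAt_extChartAt_symm h4) (hd.differentiableAt (by simp)).mdifferentiableAt,
      modelDeriv_eq_fderiv]
    rfl
  rw [pull, h6, localBilin, (extChartAt 𝓘(ℝ, EP) (q z)).left_inv hw.self_of_nhds]
  rfl

theorem contDiff_pull [FiniteDimensional ℝ EP] (B : AdjointTwoForm Q) {q : V → P}
    (hq : ContMDiff 𝓘(ℝ, V) 𝓘(ℝ, EP) ∞ q) (u v : V) :
    ContDiff ℝ ∞ (fun w => B.pull q w u v) := by
  refine contDiff_iff_contDiffAt.2 fun z => ?_
  have hy := ContMDiffAt.extChartAt_comp (hq z)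
  refine ContDiffAt.congr_of_eventuallyEq ?_
    (B.pull_eventuallyEq ((hq z).of_le (by exact ENat.LEInfty.out)) u v)
  have h1 : ContDiffAt ℝ ∞ (fun w => B.localBilin (q z) (extChartAt 𝓘(ℝ, EP) (q z) (q w))) z :=
    ContDiffAt.comp (g := B.localBilin (q z)) z ((B.contDiffOn_localBilin (q z)).contDiffAt
      (extChartAt_target_mem_nhds (q z))) hy
  have h2 := hy.fderiv_right (m := ∞) (by simp)
  exact (h1.clm_apply (h2.clm_apply contDiffAt_const)).clm_apply (h2.clm_apply contDiffAt_const)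

/-- The pull-back of the two-form under a change of gauge. -/
theorem pull_act (B : AdjointTwoForm Q) (q : V → P) (g : V → G) (z u v : V) :
    B.pull (fun w => Q.act (q w) (g w)) z u v = AdL (g z)⁻¹ (B.pull q z u v) := by
  simp only [pull, PrincipalBundle.baseDeriv, Q.proj_act, bilin_act]

theorem pull_comp (B : AdjointTwoForm Q) {V' : Type*} [NormedAddCommGroup V'] [NormedSpace ℝ V']
    {q : V → P} {H : V' → V} {z : V'} (hq : MDifferentiableAt 𝓘(ℝ, V) 𝓘(ℝ, EP) q (H z))
    (hH : DifferentiableAt ℝ H z) (u v : V') :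
    B.pull (fun w => q (H w)) z u v = B.pull q (H z) (fderiv ℝ H z u) (fderiv ℝ H z v) := by
  rw [pull, PrincipalBundle.baseDeriv, modelDeriv_comp (g := fun w => Q.proj (q w))
    ((Q.contMDiff_proj.mdifferentiable (by simp) _).comp (H z) hq) hH.mdifferentiableAt,
    modelDeriv_eq_fderiv]
  rfl

end AdjointTwoForm

end TwoForm

/-! ### Horizontal lifts -/

section Lifts

variable {EM EP EG : Type*}
  [NormedAddCommGroup EM] [NormedSpace ℝ EM]
  [NormedAddCommGroup EP] [NormedSpace ℝ EP]
  [NormedAddCommGroup EG] [NormedSpace ℝ EG]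
  {M P G : Type*}
  [TopologicalSpace M] [ChartedSpace EM M] [IsManifold 𝓘(ℝ, EM) ∞ M]
  [TopologicalSpace P] [ChartedSpace EP P] [IsManifold 𝓘(ℝ, EP) ∞ P]
  [TopologicalSpace G] [ChartedSpace EG G] [Group G] [LieGroup 𝓘(ℝ, EG) ∞ G]
  {Q : PrincipalBundle EM EP EG M P G}

namespace PrincipalBundle

theorem act_injective (Q : PrincipalBundle EM EP EG M P G) {p : P} {g h : G}
    (hgh : Q.act p g = Q.act p h) : g = h := by
  have h1 : Q.act (Q.act p h) (h⁻¹ * g) = Q.act p h := by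
    rw [← Q.act_mul, mul_inv_cancel_left, hgh]
  exact (inv_mul_eq_one.1 (Q.act_free _ _ h1)).symm

/-- The structure group acts transitively on the fibres. -/
theorem exists_act_eq (Q : PrincipalBundle EM EP EG M P G) {p p' : P} (h : Q.proj p = Q.proj p') :
    ∃ g, Q.act p g = p' := by
  obtain ⟨U, hU, hx, s, ψ, hs, -, hψ, hact⟩ := Q.locallyTrivial (Q.proj p)
  refine ⟨(ψ p)⁻¹ * ψ p', ?_⟩
  have h1 := Q.act_mul (s (Q.proj p)) (ψ p) ((ψ p)⁻¹ * ψ p')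
  rw [hact p hx, mul_inv_cancel_left] at h1
  rw [← h1, h]
  exact hact p' (by rw [mem_preimage, ← h]; exact hx)

/-- The group element that relates two maps to the total space with the same projection is a
smooth function of them. -/
theorem exists_eventuallyEq_division (Q : PrincipalBundle EM EP EG M P G) {Z : Type*}
    [TopologicalSpace Z] {q q' : Z → P} {g : Z → G} {z : Z} (hq : ContinuousAt q z)
    (h : ∀ᶠ w in 𝓝 z, Q.act (q w) (g w) = q' w) :
    ∃ ψ : P → G, ContMDiffAt 𝓘(ℝ, EP) 𝓘(ℝ, EG) ∞ ψ (q z) ∧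
      ContMDiffAt 𝓘(ℝ, EP) 𝓘(ℝ, EG) ∞ ψ (q' z) ∧
      g =ᶠ[𝓝 z] fun w => (ψ (q w))⁻¹ * ψ (q' w) := by
  obtain ⟨U, hU, hx, s, ψ, hs, -, hψ, hact⟩ := Q.locallyTrivial (Q.proj (q z))
  have hopen : IsOpen (Q.proj ⁻¹' U) := hU.preimage Q.contMDiff_proj.continuous
  have hproj : Q.proj (q' z) = Q.proj (q z) := by rw [← h.self_of_nhds, Q.proj_act]
  refine ⟨ψ, hψ.contMDiffAt (hopen.mem_nhds hx),
    hψ.contMDiffAt (hopen.mem_nhds (by rw [mem_preimage, hproj]; exact hx)), ?_⟩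
  filter_upwards [h, hq.eventually (hopen.mem_nhds hx)] with w hw hwU
  have h1 : Q.proj (q' w) = Q.proj (q w) := by rw [← hw, Q.proj_act]
  have h2 : Q.act (s (Q.proj (q w))) (ψ (q w) * g w) = Q.act (s (Q.proj (q w))) (ψ (q' w)) := by
    rw [Q.act_mul, hact _ hwU, hw, ← h1]
    exact (hact (q' w) (by rw [mem_preimage, h1]; exact hwU)).symm
  exact eq_inv_mul_iff_mul_eq.2 (Q.act_injective h2)

theorem contMDiffAt_division (Q : PrincipalBundle EM EP EG M P G) {Z : Type*}
    [NormedAddCommGroup Z] [NormedSpace ℝ Z] {q q' : Z → P} {g : Z → G} {z : Z}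
    (hq : ContMDiffAt 𝓘(ℝ, Z) 𝓘(ℝ, EP) ∞ q z) (hq' : ContMDiffAt 𝓘(ℝ, Z) 𝓘(ℝ, EP) ∞ q' z)
    (h : ∀ᶠ w in 𝓝 z, Q.act (q w) (g w) = q' w) : ContMDiffAt 𝓘(ℝ, Z) 𝓘(ℝ, EG) ∞ g z := by
  obtain ⟨ψ, h1, h2, h3⟩ := Q.exists_eventuallyEq_division hq.continuousAt h
  exact ((h1.comp z hq).inv.mul (h2.comp z hq')).congr_of_eventuallyEq h3

theorem mdifferentiableAt_division (Q : PrincipalBundle EM EP EG M P G) {Z : Type*}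
    [NormedAddCommGroup Z] [NormedSpace ℝ Z] {q q' : Z → P} {g : Z → G} {z : Z}
    (hq : MDifferentiableAt 𝓘(ℝ, Z) 𝓘(ℝ, EP) q z)
    (hq' : MDifferentiableAt 𝓘(ℝ, Z) 𝓘(ℝ, EP) q' z)
    (h : ∀ᶠ w in 𝓝 z, Q.act (q w) (g w) = q' w) : MDifferentiableAt 𝓘(ℝ, Z) 𝓘(ℝ, EG) g z := by
  obtain ⟨ψ, h1, h2, h3⟩ := Q.exists_eventuallyEq_division hq.continuousAt h
  have h4 := (h1.mdifferentiableAt (by simp)).comp z hq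
  have h5 := (h2.mdifferentiableAt (by simp)).comp z hq'
  have h6 : MDifferentiableAt 𝓘(ℝ, Z) 𝓘(ℝ, EG) (fun w => (ψ (q w))⁻¹) z :=
    ((contMDiff_inv 𝓘(ℝ, EG) ∞).mdifferentiable (by simp) _).comp z h4
  have h7 : MDifferentiableAt 𝓘(ℝ, Z) 𝓘(ℝ, EG) (fun w => (ψ (q w))⁻¹ * ψ (q' w)) z :=
    ((contMDiff_mul 𝓘(ℝ, EG) ∞).mdifferentiable (by simp) _).comp z (h6.prodMk h5)
  exact h7.congr_of_eventuallyEq h3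

end PrincipalBundle

/-- The curve `p` is, at the time `t`, a horizontal lift of the curve `x`. -/
def IsHorizontalAt (A : Connection Q) (x : ℝ → M) (p : ℝ → P) (t : ℝ) : Prop :=
  (∀ᶠ s in 𝓝 t, Q.proj (p s) = x s) ∧ MDifferentiableAt 𝓘(ℝ, ℝ) 𝓘(ℝ, EP) p t ∧
    A.pullForm p t 1 = 0

theorem IsHorizontalAt.congr {A : Connection Q} {x : ℝ → M} {p p' : ℝ → P} {t : ℝ}
    (h : IsHorizontalAt A x p t) (he : p =ᶠ[𝓝 t] p') : IsHorizontalAt A x p' t := by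
  refine ⟨?_, he.mdifferentiableAt_iff.1 h.2.1, ?_⟩
  · filter_upwards [h.1, he] with s hs hes
    rw [← hes, hs]
  · rw [Connection.pullForm, ← he.self_of_nhds, modelDeriv_congr he.symm]
    exact h.2.2

/-- Horizontal lifts are unique: the group element that relates two of them has vanishing logarithmic
derivative. -/
theorem IsHorizontalAt.eqOn {A : Connection Q} {x : ℝ → M} {p p' : ℝ → P} {a b t₁ : ℝ}
    (ht₁ : t₁ ∈ Ioo a b) (he : p t₁ = p' t₁) (h : ∀ t ∈ Ioo a b, IsHorizontalAt A x p t)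
    (h' : ∀ t ∈ Ioo a b, IsHorizontalAt A x p' t) : EqOn p p' (Ioo a b) := by
  have hex : ∀ t, ∃ g, t ∈ Ioo a b → Q.act (p t) g = p' t := by
    intro t
    by_cases ht : t ∈ Ioo a b
    · obtain ⟨g, hg⟩ := Q.exists_act_eq
        ((h t ht).1.self_of_nhds.trans (h' t ht).1.self_of_nhds.symm)
      exact ⟨g, fun _ => hg⟩
    · exact ⟨1, fun h => absurd h ht⟩
  choose g hg using hex
  have hlog : ∀ t ∈ Ioo a b, HasLogDerivAt g (0 : ℝ →L[ℝ] EG) t := by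
    intro t ht
    have h1 : ∀ᶠ s in 𝓝 t, Q.act (p s) (g s) = p' s := by
      filter_upwards [isOpen_Ioo.mem_nhds ht] with s hs using hg s hs
    have h2 := Q.mdifferentiableAt_division (h t ht).2.1 (h' t ht).2.1 h1
    have h3 := hasLogDerivAt_of_mdifferentiableAt h2
    have h4 := A.pullForm_act (h t ht).2.1 h3 1
    have h5 : A.pullForm (fun w => Q.act (p w) (g w)) t 1 = 0 :=
      ((h' t ht).congr (EventuallyEq.symm h1)).2.2
    rw [h5, (h t ht).2.2, zero_add] at h4
    have h6 : (logDeriv g t : ℝ →L[ℝ] EG) 1 = 0 := by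
      have h7 := AdL_apply_inv (g t) ((logDeriv g t : ℝ →L[ℝ] EG) 1)
      rw [← h4, map_zero] at h7
      exact h7.symm
    have h8 : (logDeriv g t : ℝ →L[ℝ] EG) = 0 := by
      ext; simpa using h6
    rwa [h8] at h3
  intro t ht
  have h1 := eq_of_hasLogDerivWithinAt_zero (convex_Ioo a b)
    (fun s hs => (hlog s hs).mono (subset_univ _)) ht₁ ht
  have h2 : g t₁ = 1 := Q.act_injective ((hg t₁ ht₁).trans (by rw [Q.act_one, he]))
  rw [← hg t ht, h1, h2, Q.act_one]

variable [FiniteDimensional ℝ EP] [FiniteDimensional ℝ EG]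
  {Λ : Type*} [NormedAddCommGroup Λ] [NormedSpace ℝ Λ] [FiniteDimensional ℝ Λ]

/-- A smooth self-map of a vector space which is the identity near a point and takes values in a
given neighbourhood of the point. -/
theorem exists_contDiff_localization {Z : Type*} [NormedAddCommGroup Z] [NormedSpace ℝ Z]
    [FiniteDimensional ℝ Z] {z₀ : Z} {U : Set Z} (hU : U ∈ 𝓝 z₀) :
    ∃ c : Z → Z, ContDiff ℝ ∞ c ∧ (∀ z, c z ∈ U) ∧ ∃ ε > 0, ∀ z ∈ Metric.ball z₀ ε, c z = z := by
  obtain ⟨δ, hδ, hball⟩ := Metric.mem_nhds_iff.1 hU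
  let f : ContDiffBump z₀ := ⟨δ / 2, δ, by positivity, by linarith⟩
  refine ⟨fun z => z₀ + f z • (z - z₀), ?_, fun z => hball ?_, δ / 2, by positivity, fun z hz => ?_⟩
  · exact contDiff_const.add (f.contDiff.smul (contDiff_id.sub contDiff_const))
  · rw [mem_ball_iff_norm, add_sub_cancel_left, norm_smul, Real.norm_of_nonneg f.nonneg]
    by_cases hz : z ∈ Metric.ball z₀ δ
    · rw [mem_ball_iff_norm] at hz
      calc f z * ‖z - z₀‖ ≤ 1 * ‖z - z₀‖ := by gcongr; exact f.le_one
        _ < δ := by rwa [one_mul]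
    · rw [f.zero_of_le_dist (not_lt.1 hz), zero_mul]; exact hδ
  · have h1 : f z = 1 := f.one_of_mem_closedBall (Metric.ball_subset_closedBall hz)
    simp [h1]

/-- Families of horizontal lifts exist locally. -/
theorem exists_local_horizontal (A : Connection Q) {X : ℝ × Λ → M}
    (hX : ContMDiff 𝓘(ℝ, ℝ × Λ) 𝓘(ℝ, EM) ∞ X) (z₀ : ℝ × Λ) :
    ∃ r : ℝ × Λ → P, ContMDiff 𝓘(ℝ, ℝ × Λ) 𝓘(ℝ, EP) ∞ r ∧ ∃ ε > 0, ∀ z ∈ Metric.ball z₀ ε,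
      Q.proj (r z) = X z ∧ A.pullForm r z (1, 0) = 0 := by
  obtain ⟨U, hU, hx, s, ψ, hs, hsec, hψ, hact⟩ := Q.locallyTrivial (X z₀)
  obtain ⟨c, hc, hcU, ε, hε, hcz⟩ := exists_contDiff_localization
    (hX.continuous.continuousAt.preimage_mem_nhds (hU.mem_nhds hx))
  -- a section over the family, defined everywhere since the family is localised near `z₀`
  set S : ℝ × Λ → P := fun z => s (X (c z)) with hS
  have hSs : ContMDiff 𝓘(ℝ, ℝ × Λ) 𝓘(ℝ, EP) ∞ S := fun z =>
    ContMDiffAt.comp (g := s) (f := fun z => X (c z)) z (hs.contMDiffAt (hU.mem_nhds (hcU z)))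
      (hX.comp hc.contMDiff z)
  set τ : ℝ × Λ → ℝ × Λ := fun z => (z₀.1 + z.1, z.2)
  have hτ : ContDiff ℝ ∞ τ := by fun_prop
  -- the group factor solves the parallel transport equation, started at the time of `z₀`
  set ξ : ℝ × Λ → EG := fun z => -A.pullForm S (τ z) (1, 0) with hξ
  have hξs : ContDiff ℝ ∞ ξ :=
    (((A.contDiff_pullForm hSs).comp hτ).clm_apply contDiff_const).neg
  have hex : ∀ l : Λ, ∃ g : ℝ → G, g 0 = 1 ∧ ∀ t, HasLogDerivAt g (spanL (ξ (t, l))) t :=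
    fun l => exists_hasLogDerivAt (hξs.continuous.comp (by fun_prop : Continuous fun t => (t, l))) 1
  choose g hg0 hg using hex
  have hgs := contMDiff_of_solution hξs (g := fun t l => g l t) hg0 hg
  have hgl := hasLogDerivAt_of_solution hξs (g := fun t l => g l t) hg0 hg
  set κ : ℝ × Λ → ℝ × Λ := fun z => (z.1 - z₀.1, z.2)
  have hκ : ContDiff ℝ ∞ κ := by fun_prop
  have hτκ (z) : τ (κ z) = z := by simp [τ, κ]
  have hκd (z) : HasFDerivAt κ (ContinuousLinearMap.id ℝ (ℝ × Λ)) z := by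
    have h1 := (hasFDerivAt_id (𝕜 := ℝ) z).sub_const ((z₀.1, 0) : ℝ × Λ)
    refine h1.congr_of_eventuallyEq (Eventually.of_forall fun w => ?_)
    ext <;> simp [κ]
  refine ⟨fun z => Q.act (S z) (g (κ z).2 (κ z).1), fun z =>
    Q.contMDiffAt_act le_rfl (hSs z) (hgs.comp hκ.contMDiff z), ε, hε, fun z hz => ⟨?_, ?_⟩⟩
  · rw [Q.proj_act, hS]
    simp only
    rw [hsec _ (hcU z), hcz z hz]
  · have h1 : HasLogDerivAt (fun z => g (κ z).2 (κ z).1) _ z :=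
      HasLogDerivWithinAt.comp (g := fun q : ℝ × Λ => g q.2 q.1) (f := κ) (hgl (κ z))
      (hκd z).hasFDerivWithinAt (mapsTo_univ _ _)
    rw [A.pullForm_act (hSs.mdifferentiable (by simp) z) h1]
    have h2 : ξ (κ z) = -A.pullForm S z (1, 0) := by rw [hξ]; simp only [hτκ]
    simp [h2]

/-- In a family that is horizontal along its first coordinate, the curves and their translates are
horizontal lifts. -/
theorem isHorizontalAt_slice {A : Connection Q} {X : ℝ × Λ → M} {r : ℝ × Λ → P} {σ : ℝ} {l : Λ}
    (hr : MDifferentiableAt 𝓘(ℝ, ℝ × Λ) 𝓘(ℝ, EP) r (σ, l))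
    (h : ∀ᶠ z in 𝓝 (σ, l), Q.proj (r z) = X z) (hz : A.pullForm r (σ, l) (1, 0) = 0) (k : G) :
    IsHorizontalAt A (fun t => X (t, l)) (fun t => Q.act (r (t, l)) k) σ := by
  have hd : HasFDerivAt (fun t : ℝ => (t, l)) (ContinuousLinearMap.inl ℝ ℝ Λ) σ :=
    hasFDerivAt_prodMk_left σ l
  have h1 : MDifferentiableAt 𝓘(ℝ, ℝ) 𝓘(ℝ, EP) (fun t : ℝ => r (t, l)) σ :=
    MDifferentiableAt.comp (g := r) (f := fun t : ℝ => (t, l)) σ hr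
      hd.differentiableAt.mdifferentiableAt
  refine ⟨?_, Q.mdifferentiableAt_act h1 mdifferentiableAt_const, ?_⟩
  · filter_upwards [hd.continuousAt.eventually h] with t ht
    rw [Q.proj_act, ht]
  · rw [A.pullForm_act h1 (hasLogDerivWithinAt_const k),
      A.pullForm_comp (q := r) (H := fun t : ℝ => (t, l)) hr hd.differentiableAt, hd.fderiv]
    simp [hz]

/-- Horizontal lifts of smooth curves exist for all time: glue the local lifts. -/
theorem exists_isHorizontalAt (A : Connection Q) {x : ℝ → M}
    (hx : ContMDiff 𝓘(ℝ, ℝ) 𝓘(ℝ, EM) ∞ x) {p₀ : P} (hp₀ : Q.proj p₀ = x 0) :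
    ∃ p : ℝ → P, p 0 = p₀ ∧ ∀ t, IsHorizontalAt A x p t := by
  refine exists_global_solution (IsHorizontalAt A x) (fun t p => Q.proj p = x t)
    (fun f f' t he h => h.congr he) (fun f t h => h.1.self_of_nhds) (fun t₀ => ?_)
    (fun a b f f' t₁ ht₁ he h h' => IsHorizontalAt.eqOn ht₁ he h h') hp₀
  have hX : ContMDiff 𝓘(ℝ, ℝ × ℝ) 𝓘(ℝ, EM) ∞ (fun z : ℝ × ℝ => x z.1) :=
    hx.comp contDiff_fst.contMDiff
  obtain ⟨r, hr, ε, hε, h⟩ := exists_local_horizontal A hX (t₀, 0)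
  have hmem : ∀ t ∈ Ioo (t₀ - ε) (t₀ + ε), (t, (0 : ℝ)) ∈ Metric.ball (t₀, (0 : ℝ)) ε := by
    intro t ht
    rw [← ball_prod_same, Real.ball_eq_Ioo]
    exact ⟨ht, Metric.mem_ball_self hε⟩
  refine ⟨ε, hε, fun t₁ ht₁ p hp => ?_⟩
  obtain ⟨k, hk⟩ := Q.exists_act_eq (((h _ (hmem t₁ ht₁)).1).trans hp.symm)
  refine ⟨fun t => Q.act (r (t, 0)) k, hk, fun t ht => ?_⟩
  refine isHorizontalAt_slice (X := fun z : ℝ × ℝ => x z.1) (hr.mdifferentiable (by simp) _) ?_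
    (h _ (hmem t ht)).2 k
  filter_upwards [Metric.isOpen_ball.mem_nhds (hmem t ht)] with z hz using (h z hz).1

/-- Smooth families of curves have smooth families of horizontal lifts. -/
theorem exists_horizontal_family (A : Connection Q) {X : ℝ × Λ → M}
    (hX : ContMDiff 𝓘(ℝ, ℝ × Λ) 𝓘(ℝ, EM) ∞ X) {q₀ : Λ → P}
    (hq₀ : ContMDiff 𝓘(ℝ, Λ) 𝓘(ℝ, EP) ∞ q₀) (hproj : ∀ l, Q.proj (q₀ l) = X (0, l)) :
    ∃ q : ℝ × Λ → P, ContMDiff 𝓘(ℝ, ℝ × Λ) 𝓘(ℝ, EP) ∞ q ∧ (∀ z, Q.proj (q z) = X z) ∧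
      (∀ l, q (0, l) = q₀ l) ∧ ∀ z, A.pullForm q z (1, 0) = 0 := by
  have hex : ∀ l, ∃ p : ℝ → P, p 0 = q₀ l ∧ ∀ t, IsHorizontalAt A (fun s => X (s, l)) p t :=
    fun l => exists_isHorizontalAt A (hX.comp (contDiff_prodMk_left l).contMDiff) (hproj l)
  choose p hp0 hp using hex
  set q : ℝ × Λ → P := fun z => p z.2 z.1 with hq
  -- near `(σ₁, l)` the lifts are translates of a smooth local family, so that smoothness in the
  -- parameter at one time propagates to smoothness at all nearby times
  have hloc : ∀ (σ₁ : ℝ) (l : Λ), ∃ ε > 0, ∀ σ₂ ∈ Ioo (σ₁ - ε) (σ₁ + ε),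
      ContMDiffAt 𝓘(ℝ, Λ) 𝓘(ℝ, EP) ∞ (fun m => q (σ₂, m)) l → ∀ σ₃ ∈ Ioo (σ₁ - ε) (σ₁ + ε),
        ContMDiffAt 𝓘(ℝ, ℝ × Λ) 𝓘(ℝ, EP) ∞ q (σ₃, l) := by
    intro σ₁ l
    obtain ⟨r, hr, ε, hε, h⟩ := exists_local_horizontal A hX (σ₁, l)
    have hmem : ∀ t ∈ Ioo (σ₁ - ε) (σ₁ + ε), ∀ m ∈ Metric.ball l ε,
        (t, m) ∈ Metric.ball (σ₁, l) ε := by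
      intro t ht m hm
      rw [← ball_prod_same, Real.ball_eq_Ioo]
      exact ⟨ht, hm⟩
    refine ⟨ε, hε, fun σ₂ hσ₂ hsm σ₃ hσ₃ => ?_⟩
    have hexk : ∀ m, ∃ k, m ∈ Metric.ball l ε → Q.act (r (σ₂, m)) k = q (σ₂, m) := by
      intro m
      by_cases hm : m ∈ Metric.ball l ε
      · obtain ⟨k, hk⟩ := Q.exists_act_eq (((h _ (hmem σ₂ hσ₂ m hm)).1).trans
          (hp m σ₂).1.self_of_nhds.symm)
        exact ⟨k, fun _ => hk⟩
      · exact ⟨1, fun h => absurd h hm⟩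
    choose k hk using hexk
    have hball : Metric.ball l ε ∈ 𝓝 l := Metric.ball_mem_nhds l hε
    have hks : ContMDiffAt 𝓘(ℝ, Λ) 𝓘(ℝ, EG) ∞ k l := by
      refine Q.contMDiffAt_division (q := fun m => r (σ₂, m))
        (hr.comp (contDiff_prodMk_right σ₂).contMDiff l) hsm ?_
      filter_upwards [hball] with m hm using hk m hm
    have heq : ∀ m ∈ Metric.ball l ε, EqOn (fun t => Q.act (r (t, m)) (k m))
        (p m) (Ioo (σ₁ - ε) (σ₁ + ε)) := by
      intro m hm
      refine IsHorizontalAt.eqOn hσ₂ (hk m hm) (fun t ht => ?_) (fun t _ => hp m t)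
      refine isHorizontalAt_slice (hr.mdifferentiable (by simp) _) ?_
        (h _ (hmem t ht m hm)).2 (k m)
      filter_upwards [Metric.isOpen_ball.mem_nhds (hmem t ht m hm)] with z hz using (h z hz).1
    have hev : q =ᶠ[𝓝 (σ₃, l)] fun z => Q.act (r z) (k z.2) := by
      rw [nhds_prod_eq]
      filter_upwards [prod_mem_prod (isOpen_Ioo.mem_nhds hσ₃) hball] with z hz
      exact (heq z.2 hz.2 hz.1).symm
    refine (Q.contMDiffAt_act le_rfl (hr _) ?_).congr_of_eventuallyEq hev
    exact ContMDiffAt.comp (g := k) (f := Prod.snd) (σ₃, l) hks contDiff_snd.contMDiff.contMDiffAt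
  -- the set of times at which the lifts are smooth in the parameter is open, closed and contains `0`
  have hall : ∀ (l : Λ) (σ : ℝ), ContMDiffAt 𝓘(ℝ, Λ) 𝓘(ℝ, EP) ∞ (fun m => q (σ, m)) l := by
    intro l
    set T : Set ℝ := {σ | ContMDiffAt 𝓘(ℝ, Λ) 𝓘(ℝ, EP) ∞ (fun m => q (σ, m)) l} with hT
    have hstep : ∀ σ₁ : ℝ, ∃ N ∈ 𝓝 σ₁, ∀ σ₂ ∈ N, σ₂ ∈ T → ∀ σ₃ ∈ N, σ₃ ∈ T := by
      intro σ₁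
      obtain ⟨ε, hε, h⟩ := hloc σ₁ l
      refine ⟨Ioo (σ₁ - ε) (σ₁ + ε), Ioo_mem_nhds (by linarith) (by linarith),
        fun σ₂ hσ₂ hsm σ₃ hσ₃ => ?_⟩
      exact ContMDiffAt.comp (g := q) (f := fun m => (σ₃, m)) l (h σ₂ hσ₂ hsm σ₃ hσ₃)
        (contDiff_prodMk_right σ₃).contMDiff.contMDiffAt
    have hclopen : IsClopen T := by
      constructor
      · rw [← isOpen_compl_iff, isOpen_iff_mem_nhds]
        intro σ hσ
        obtain ⟨N, hN, h⟩ := hstep σ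
        exact mem_of_superset hN fun σ' hσ' hT' => hσ (h σ' hσ' hT' σ (mem_of_mem_nhds hN))
      · rw [isOpen_iff_mem_nhds]
        intro σ hσ
        obtain ⟨N, hN, h⟩ := hstep σ
        exact mem_of_superset hN fun σ' hσ' => h σ (mem_of_mem_nhds hN) hσ σ' hσ'
    have h0 : (0 : ℝ) ∈ T := by
      have : (fun m => q (0, m)) = q₀ := funext hp0
      rw [hT, mem_ofPred_eq, this]
      exact hq₀ l
    have huniv := hclopen.eq_univ ⟨0, h0⟩
    intro σ
    have hσ : σ ∈ T := huniv ▸ mem_univ σ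
    exact hσ
  have hqs : ContMDiff 𝓘(ℝ, ℝ × Λ) 𝓘(ℝ, EP) ∞ q := by
    rintro ⟨σ, l⟩
    obtain ⟨ε, hε, h⟩ := hloc σ l
    have hσ : σ ∈ Ioo (σ - ε) (σ + ε) := ⟨by linarith, by linarith⟩
    exact h σ hσ (hall l σ) σ hσ
  refine ⟨q, hqs, fun z => (hp z.2 z.1).1.self_of_nhds, hp0, ?_⟩
  rintro ⟨σ, l⟩
  have hd : HasFDerivAt (fun t : ℝ => (t, l)) (ContinuousLinearMap.inl ℝ ℝ Λ) σ :=
    hasFDerivAt_prodMk_left σ l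
  have h1 := (hp l σ).2.2
  have h2 := A.pullForm_comp (q := q) (H := fun t : ℝ => (t, l))
    (hqs.mdifferentiable (by simp) (σ, l)) hd.differentiableAt
  rw [hd.fderiv] at h2
  exact ((DFunLike.congr_fun h2 1).symm.trans h1)

/-- The horizontal lift of a smooth curve is characterised by its properties. -/
theorem horizontalLift_eq (A : Connection Q) {x : ℝ → M} {p : ℝ → P}
    (hp : ∀ t, IsHorizontalAt A x p t) : horizontalLift A (p 0) x = p := by
  have h1 : IsHorizontalLift A (p 0) x p :=
    ⟨rfl, fun σ => (hp σ).1.self_of_nhds, fun σ => (hp σ).2.1, fun σ => (hp σ).2.2⟩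
  have h2 : IsHorizontalLift A (p 0) x (horizontalLift A (p 0) x) :=
    Classical.epsilon_spec (p := fun p' => IsHorizontalLift A (p 0) x p') ⟨p, h1⟩
  have h3 : ∀ t, IsHorizontalAt A x (horizontalLift A (p 0) x) t := fun t =>
    ⟨Eventually.of_forall h2.lift, h2.differentiable t, h2.horizontal t⟩
  ext t
  exact IsHorizontalAt.eqOn (a := -(|t| + 1)) (b := |t| + 1) (t₁ := 0)
    ⟨by have := abs_nonneg t; linarith, by have := abs_nonneg t; linarith⟩ h2.start
    (fun s _ => h3 s) (fun s _ => hp s) (abs_lt.1 (by linarith))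

end Lifts

/-! ### The loop space connection through horizontal lifts -/

section Holonomy

variable {EM EP EG : Type*}
  [NormedAddCommGroup EM] [NormedSpace ℝ EM] [FiniteDimensional ℝ EM]
  [NormedAddCommGroup EP] [NormedSpace ℝ EP] [FiniteDimensional ℝ EP]
  [NormedAddCommGroup EG] [NormedSpace ℝ EG] [FiniteDimensional ℝ EG]
  {M P G : Type*}
  [TopologicalSpace M] [ChartedSpace EM M] [IsManifold 𝓘(ℝ, EM) ∞ M]
  [TopologicalSpace P] [ChartedSpace EP P] [IsManifold 𝓘(ℝ, EP) ∞ P]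
  [TopologicalSpace G] [ChartedSpace EG G] [Group G] [LieGroup 𝓘(ℝ, EG) ∞ G]
  {Q : PrincipalBundle EM EP EG M P G} {A : Connection Q} {B : AdjointTwoForm Q} {p₀ : P}

/-- The transport equation of the loop space connection in terms of logarithmic derivatives. -/
theorem isLoopTransport_iff {Γ : ℝ × ℝ → M} {W : ℝ → G} :
    IsLoopTransport A B p₀ Γ W ↔ W 0 = 1 ∧ ∀ τ ∈ interval,
      HasLogDerivWithinAt W (spanL (-toModel (loopConnectionAt A B p₀ Γ τ))) interval τ := by
  have key (τ : ℝ) : (ContinuousLinearMap.toSpanSingleton ℝ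
        (-rightInvariant (loopConnectionAt A B p₀ Γ τ) (W τ)) : ℝ →L[ℝ] EG) =
      (modelDeriv (fun c => c * W τ) 1 : EG →L[ℝ] EG).comp
        (spanL (-toModel (loopConnectionAt A B p₀ Γ τ))) := by
    ext
    have h : -((modelDeriv (fun c => c * W τ) 1 : EG →L[ℝ] EG)
        (toModel (loopConnectionAt A B p₀ Γ τ))) =
        (modelDeriv (fun c => c * W τ) 1 : EG →L[ℝ] EG)
        (-toModel (loopConnectionAt A B p₀ Γ τ)) := (map_neg _ _).symm
    simp only [ContinuousLinearMap.comp_apply, ContinuousLinearMap.toSpanSingleton_apply, one_smul]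
    exact (one_smul ℝ _).trans h
  constructor
  · intro h
    refine ⟨h.start, fun τ hτ => HasMFDerivWithinAt.hasLogDerivWithinAt ?_⟩
    have h1 := h.equation τ hτ
    exact (key τ) ▸ h1
  · intro h
    refine ⟨h.1, fun τ hτ => ?_⟩
    have h1 := (h.2 τ hτ).hasMFDerivWithinAt
    have h2 := key τ
    unfold modelDeriv at h2
    exact h2 ▸ h1

/-- The holonomy is computed from any solution of the transport equation, written with
logarithmic derivatives. -/
theorem holonomy_eq {Γ : ℝ × ℝ → M} {ξ : ℝ → EG} {W : ℝ → G}
    (hξ : ∀ τ ∈ interval, toModel (loopConnectionAt A B p₀ Γ τ) = ξ τ) (hW0 : W 0 = 1)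
    (hW : ∀ τ ∈ interval, HasLogDerivWithinAt W (spanL (-ξ τ)) interval τ) :
    holonomy A B p₀ Γ = W (2 * Real.pi) := by
  have h1 : IsLoopTransport A B p₀ Γ W :=
    isLoopTransport_iff.2 ⟨hW0, fun τ hτ => by rw [hξ τ hτ]; exact hW τ hτ⟩
  have h2 : IsLoopTransport A B p₀ Γ
      (Classical.epsilon fun W : ℝ → G => IsLoopTransport A B p₀ Γ W) :=
    Classical.epsilon_spec (p := fun W' => IsLoopTransport A B p₀ Γ W') ⟨W, h1⟩
  have h2' := isLoopTransport_iff.1 h2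
  refine eqOn_of_hasLogDerivWithinAt (r := fun τ => spanL (-ξ τ)) (convex_Icc 0 (2 * Real.pi))
    (fun τ hτ => ?_) hW (z₀ := 0) ⟨le_rfl, Real.two_pi_pos.le⟩ (h2'.1.trans hW0.symm)
    ⟨Real.two_pi_pos.le, le_rfl⟩
  rw [← hξ τ hτ]; exact h2'.2 τ hτ

/-- The loop space connection in terms of a horizontal lift of the loop. -/
theorem toModel_loopConnectionAt {Γ : ℝ × ℝ → M} {τ : ℝ} {p : ℝ → P} (hp0 : p 0 = p₀)
    (hp : ∀ t, IsHorizontalAt A (fun σ => Γ (σ, τ)) p t) :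
    toModel (loopConnectionAt A B p₀ Γ τ) = ∫ σ in (0 : ℝ)..(2 * Real.pi),
      B.bilin (p σ) (modelDeriv (fun s => Γ (s, τ)) σ (1 : ℝ))
        (modelDeriv (fun t => Γ (σ, t)) τ (1 : ℝ)) := by
  have h1 : horizontalLift A p₀ (fun σ => Γ (σ, τ)) = p := hp0 ▸ horizontalLift_eq A hp
  have h2 : toModel (loopConnectionAt A B p₀ Γ τ) = ∫ σ in (0 : ℝ)..(2 * Real.pi),
      B.bilin (horizontalLift A p₀ (fun σ => Γ (σ, τ)) σ)
        (modelDeriv (fun s => Γ (s, τ)) σ (1 : ℝ))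
        (modelDeriv (fun t => Γ (σ, t)) τ (1 : ℝ)) := rfl
  rw [h2, h1]

/-- The loop space connection in terms of a family of horizontal lifts. -/
theorem toModel_loopConnectionAt_pull {Γ : ℝ × ℝ → M} {τ : ℝ} {q : ℝ × ℝ → P}
    (hq : ContMDiff 𝓘(ℝ, ℝ × ℝ) 𝓘(ℝ, EP) ∞ q) (hproj : ∀ z, Q.proj (q z) = Γ z)
    (hq0 : q (0, τ) = p₀) (hhor : ∀ σ, A.pullForm q (σ, τ) (1, 0) = 0) :
    toModel (loopConnectionAt A B p₀ Γ τ) = ∫ σ in (0 : ℝ)..(2 * Real.pi),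
      B.pull q (σ, τ) (1, 0) (0, 1) := by
  have hp : ∀ t, IsHorizontalAt A (fun σ => Γ (σ, τ)) (fun σ => q (σ, τ)) t := by
    intro t
    have h := isHorizontalAt_slice (X := Γ) (hq.mdifferentiable (by simp) (t, τ))
      (Eventually.of_forall hproj) (hhor t) 1
    simpa only [Q.act_one] using h
  rw [toModel_loopConnectionAt hq0 hp]
  congr 1
  ext σ
  obtain rfl : Γ = fun z => Q.proj (q z) := (funext hproj).symm
  have hΓ : MDifferentiableAt 𝓘(ℝ, ℝ × ℝ) 𝓘(ℝ, EM) (fun z => Q.proj (q z)) (σ, τ) :=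
    (Q.contMDiff_proj.comp hq).mdifferentiable (by simp) _
  have h1 := modelDeriv_comp (g := fun z => Q.proj (q z)) (f := fun s : ℝ => (s, τ)) hΓ
    (hasFDerivAt_prodMk_left σ τ).differentiableAt.mdifferentiableAt
  have h2 := modelDeriv_comp (g := fun z => Q.proj (q z)) (f := fun t : ℝ => (σ, t)) hΓ
    (hasFDerivAt_prodMk_right σ τ).differentiableAt.mdifferentiableAt
  rw [modelDeriv_eq_fderiv, (hasFDerivAt_prodMk_left σ τ).fderiv] at h1
  rw [modelDeriv_eq_fderiv, (hasFDerivAt_prodMk_right σ τ).fderiv] at h2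
  rw [h1, h2]
  rfl

/-- The commutator in the curvature of the loop space connection, in terms of horizontal lifts. -/
def localCommutator (A : Connection Q) (B : AdjointTwoForm Q) (x : ℝ → M) (p : ℝ → P) (σ' σ : ℝ)
    (u v : EM) : EG :=
  adL EG G (B.bilin (p σ') (modelDeriv x σ' (1 : ℝ)) u -
      A.baseCurvature (p σ') (modelDeriv x σ' (1 : ℝ)) u)
    (B.bilin (p σ) (modelDeriv x σ (1 : ℝ)) v)

/-- By the symmetry of the condition it is enough to consider `σ' < σ`. -/
theorem curvatureLocal_iff : CurvatureLocal A B p₀ ↔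
    ∀ x : ℝ → M, IsLoop EM (Q.proj p₀) x → ∀ p : ℝ → P, p 0 = p₀ →
      (∀ t, IsHorizontalAt A x p t) → ∀ σ ∈ interval, ∀ σ' ∈ interval, σ' < σ → ∀ u v : EM,
        localCommutator A B x p σ' σ u v = 0 := by
  have key (x : ℝ → M) (p : ℝ → P) (hp0 : p 0 = p₀) (hp : ∀ t, IsHorizontalAt A x p t)
      (σ' σ : ℝ) (u : TangentSpace 𝓘(ℝ, EM) (x σ')) (v : TangentSpace 𝓘(ℝ, EM) (x σ)) :
      toModel ⁅transportedB A B p₀ x σ' (velocity x σ') u -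
          transportedF A p₀ x σ' (velocity x σ') u, transportedB A B p₀ x σ (velocity x σ) v⁆ =
        localCommutator A B x p σ' σ u v := by
    have h1 : horizontalLift A p₀ x = p := hp0 ▸ horizontalLift_eq A hp
    have h2 (t : ℝ) (w : TangentSpace 𝓘(ℝ, EM) (x t)) :
        toModel (transportedF A p₀ x t (velocity x t) w) =
          A.baseCurvature (p t) (modelDeriv x t (1 : ℝ)) w := by
      rw [← h1]
      exact A.toModel_curvature _ _ _
    have h3 (t : ℝ) (w : TangentSpace 𝓘(ℝ, EM) (x t)) :
        toModel (transportedB A B p₀ x t (velocity x t) w) =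
          B.bilin (p t) (modelDeriv x t (1 : ℝ)) w := by
      rw [← h1]; rfl
    refine (adL_apply _ _).symm.trans ?_
    exact congrArg₂ (fun a b => adL EG G a b)
      (congrArg₂ (· - ·) (h3 σ' u) (h2 σ' u)) (h3 σ v)
  constructor
  · intro h x hx p hp0 hp σ hσ σ' hσ' hlt u v
    have h1 := h x hx σ hσ σ' hσ' u v
    rw [heaviside, heaviside, if_pos (by linarith), if_neg (by linarith), one_smul, zero_smul,
      sub_zero] at h1
    exact (key x p hp0 hp σ' σ u v).symm.trans (congrArg toModel h1)
  · intro h x hx σ hσ σ' hσ' u v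
    obtain ⟨p, hp0, hp⟩ := exists_isHorizontalAt A hx.smooth hx.start.symm
    rcases lt_trichotomy σ' σ with hlt | rfl | hlt
    · rw [heaviside, heaviside, if_pos (by linarith), if_neg (by linarith), one_smul, zero_smul,
        sub_zero]
      exact (key x p hp0 hp σ' σ u v).trans (h x hx p hp0 hp σ hσ σ' hσ' hlt u v)
    · simp [heaviside]
    · rw [heaviside, heaviside, if_neg (by linarith), if_pos (by linarith), one_smul, zero_smul,
        zero_sub, neg_eq_zero]
      exact (key x p hp0 hp σ σ' v u).trans (h x hx p hp0 hp σ' hσ' σ hσ hlt v u)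

end Holonomy

/-! ### Commutators, and covariant closedness on surfaces -/

section Commutator

variable {EG : Type*} [NormedAddCommGroup EG] [NormedSpace ℝ EG] [FiniteDimensional ℝ EG]
  {G : Type*} [TopologicalSpace G] [ChartedSpace EG G] [Group G] [LieGroup 𝓘(ℝ, EG) ∞ G]

/-- The adjoint action is by automorphisms of the Lie algebra. -/
theorem AdL_adL (g : G) (x y : EG) : AdL g (adL EG G x y) = adL EG G (AdL g x) (AdL g y) := by
  -- differentiate `Ad (g k(t) g⁻¹) Ad g = Ad g Ad k(t)` along a one-parameter subgroup
  obtain ⟨k, hk0, hk⟩ := exists_hasLogDerivAt (G := G) (ξ := fun _ => x) continuous_const 1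
  have h1 : HasDerivAt (fun t => AdL (k t) y) (adL EG G x y) 0 := by
    have h := ((hk 0).AdL_apply (hasFDerivAt_const y (0 : ℝ)).hasFDerivWithinAt).hasFDerivAt
      univ_mem
    simpa [hk0, AdL_one] using h.hasDerivAt
  have h2 : HasDerivAt (fun t => AdL (g * k t * g⁻¹) (AdL g y)) (adL EG G (AdL g x) (AdL g y)) 0 := by
    have h3 : HasLogDerivAt (fun t => g * k t * g⁻¹) ((AdL g).comp (spanL x)) 0 := by
      have h4 := ((hasLogDerivWithinAt_const g).mul (hk 0)).mul_const g⁻¹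
      rwa [zero_add] at h4
    have h := (h3.AdL_apply (hasFDerivAt_const (AdL g y) (0 : ℝ)).hasFDerivWithinAt).hasFDerivAt
      univ_mem
    simpa [hk0, AdL_one] using h.hasDerivAt
  have h5 : (fun t => AdL (g * k t * g⁻¹) (AdL g y)) = fun t => AdL g (AdL (k t) y) := by
    ext t
    rw [AdL_mul, AdL_mul]
    simp only [ContinuousLinearMap.comp_apply, AdL_inv_apply]
  rw [h5] at h2
  exact ((AdL g).hasFDerivAt.comp_hasDerivAt (0 : ℝ) h1).unique h2

/-- The integrated form of the vanishing of the nonlocal commutator: if the primitives `a₁`, `a₂` of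
`f₁`, `f₂` may be compared with those of `b₁`, `b₂` inside the commutators, then the integrand is
the derivative of the commutator of the primitives of `b₁` and `b₂`. -/
theorem integral_adL_sub_adL {b₁ b₂ a₁ a₂ f₁ f₂ : ℝ → EG} {L : ℝ} (hL : 0 ≤ L)
    (hb₁ : Continuous b₁) (hb₂ : Continuous b₂)
    (ha₁ : ∀ t, HasDerivAt a₁ (f₁ t) t) (ha₂ : ∀ t, HasDerivAt a₂ (f₂ t) t)
    (h₁ : a₁ 0 = 0) (h₂ : a₂ 0 = 0)
    (hc₁ : ∀ t ∈ Icc 0 L, ∀ t' ∈ Ico 0 t, adL EG G (b₁ t' - f₁ t') (b₂ t) = 0)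
    (hc₂ : ∀ t ∈ Icc 0 L, ∀ t' ∈ Ico 0 t, adL EG G (b₂ t' - f₂ t') (b₁ t) = 0) :
    ∫ t in (0 : ℝ)..L, (adL EG G (a₁ t) (b₂ t) - adL EG G (a₂ t) (b₁ t)) =
      adL EG G (∫ t in (0 : ℝ)..L, b₁ t) (∫ t in (0 : ℝ)..L, b₂ t) := by
  have : CompleteSpace EG := FiniteDimensional.complete ℝ EG
  have hprim {b : ℝ → EG} (hb : Continuous b) (t : ℝ) :
      HasDerivAt (fun t => ∫ u in (0 : ℝ)..t, b u) (b t) t :=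
    intervalIntegral.integral_hasDerivAt_right (hb.intervalIntegrable _ _)
      (hb.stronglyMeasurableAtFilter _ _) hb.continuousAt
  have key {b b' a f : ℝ → EG} (hb : Continuous b) (ha : ∀ t, HasDerivAt a (f t) t)
      (h0 : a 0 = 0) (hc : ∀ t ∈ Icc 0 L, ∀ t' ∈ Ico 0 t, adL EG G (b t' - f t') (b' t) = 0)
      (t : ℝ) (ht : t ∈ Icc 0 L) :
      adL EG G (a t) (b' t) = adL EG G (∫ u in (0 : ℝ)..t, b u) (b' t) := by
    -- for fixed `t`, the commutator with `b' t` of the difference of the primitives is constant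
    have hd (t' : ℝ) : HasDerivAt
        (fun t' => (adL EG G).flip (b' t) ((∫ u in (0 : ℝ)..t', b u) - a t'))
        ((adL EG G).flip (b' t) (b t' - f t')) t' :=
      ((adL EG G).flip (b' t)).hasFDerivAt.comp_hasDerivAt t' ((hprim hb t').sub (ha t'))
    have h := constant_of_has_deriv_right_zero (a := 0) (b := t)
      (continuous_iff_continuousAt.2 fun t' => (hd t').continuousAt).continuousOn
      (fun t' ht' => (hc t ht t' ht') ▸ (hd t').hasDerivWithinAt) t ⟨ht.1, le_rfl⟩
    simp only [intervalIntegral.integral_same, h0, sub_self, map_zero, map_sub, sub_eq_zero] at h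
    exact h.symm
  have h3 : ∀ t ∈ uIcc 0 L, adL EG G (a₁ t) (b₂ t) - adL EG G (a₂ t) (b₁ t) =
      adL EG G (∫ u in (0 : ℝ)..t, b₁ u) (b₂ t) + adL EG G (b₁ t) (∫ u in (0 : ℝ)..t, b₂ u) := by
    intro t ht
    rw [uIcc_of_le hL] at ht
    rw [key hb₁ ha₁ h₁ hc₁ t ht, key hb₂ ha₂ h₂ hc₂ t ht, adL_skew (b₁ t), sub_eq_add_neg]
  rw [intervalIntegral.integral_congr h3]
  have hcont {b : ℝ → EG} (hb : Continuous b) : Continuous fun t => ∫ u in (0 : ℝ)..t, b u :=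
    continuous_iff_continuousAt.2 fun t => (hprim hb t).continuousAt
  have hd (t : ℝ) : HasDerivAt
      (fun t => adL EG G (∫ u in (0 : ℝ)..t, b₁ u) (∫ u in (0 : ℝ)..t, b₂ u))
      (adL EG G (∫ u in (0 : ℝ)..t, b₁ u) (b₂ t) + adL EG G (b₁ t) (∫ u in (0 : ℝ)..t, b₂ u)) t := by
    have h := ((adL EG G).hasFDerivAt.comp_hasDerivAt t (hprim hb₁ t)).clm_apply (hprim hb₂ t)
    rw [add_comm]
    exact h
  rw [intervalIntegral.integral_eq_sub_of_hasDerivAt (fun t _ => hd t)]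
  · simp
  · refine Continuous.intervalIntegrable ?_ _ _
    exact (((adL EG G).continuous.comp (hcont hb₁)).clm_apply hb₂).add
      (((adL EG G).continuous.comp hb₁).clm_apply (hcont hb₂))

end Commutator

section Bianchi

/-- The area form of the plane. -/
def area : ℝ × ℝ →L[ℝ] ℝ × ℝ →L[ℝ] ℝ :=
  (ContinuousLinearMap.mul ℝ ℝ).bilinearComp (ContinuousLinearMap.fst ℝ ℝ ℝ)
      (ContinuousLinearMap.snd ℝ ℝ ℝ) -
    (ContinuousLinearMap.mul ℝ ℝ).bilinearComp (ContinuousLinearMap.snd ℝ ℝ ℝ)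
      (ContinuousLinearMap.fst ℝ ℝ ℝ)

theorem area_apply (v w : ℝ × ℝ) : area v w = v.1 * w.2 - v.2 * w.1 := rfl

theorem area_skew (v w : ℝ × ℝ) : area v w = -area w v := by
  rw [area_apply, area_apply]; ring

theorem area_cyclic (u v w : ℝ × ℝ) : area v w • u + area w u • v + area u v • w = 0 := by
  simp only [area_apply]
  ext <;> simp <;> ring

variable {EM EP EG : Type*}
  [NormedAddCommGroup EM] [NormedSpace ℝ EM] [FiniteDimensional ℝ EM]
  [NormedAddCommGroup EP] [NormedSpace ℝ EP] [FiniteDimensional ℝ EP]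
  [NormedAddCommGroup EG] [NormedSpace ℝ EG] [FiniteDimensional ℝ EG]
  {M P G : Type*}
  [TopologicalSpace M] [ChartedSpace EM M] [IsManifold 𝓘(ℝ, EM) ∞ M]
  [TopologicalSpace P] [ChartedSpace EP P] [IsManifold 𝓘(ℝ, EP) ∞ P]
  [TopologicalSpace G] [ChartedSpace EG G] [Group G] [LieGroup 𝓘(ℝ, EG) ∞ G]
  {Q : PrincipalBundle EM EP EG M P G} {A : Connection Q} {B : AdjointTwoForm Q} {p₀ : P}
  {Z : Type*} [NormedAddCommGroup Z] [NormedSpace ℝ Z]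

/-- On a surface, the pull-back of the two-form is a multiple of the area form. -/
theorem AdjointTwoForm.pull_eq_area (B : AdjointTwoForm Q) (q : ℝ × ℝ → P) (y v w : ℝ × ℝ) :
    B.pull q y v w = area v w • B.pull q y (1, 0) (0, 1) := by
  set D : ℝ × ℝ →L[ℝ] EM := Q.baseDeriv q y
  have h (v : ℝ × ℝ) : D v = v.1 • D (1, 0) + v.2 • D (0, 1) := by
    rw [← map_smul, ← map_smul, ← map_add]; simp
  change B.bilin (q y) (D v) (D w) = area v w • B.bilin (q y) (D (1, 0)) (D (0, 1))
  rw [h v, h w, area_apply]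
  simp only [map_add, map_smul, add_apply, smul_apply, B.bilin_self,
    B.bilin_skew (q y) (D (0, 1)) (D (1, 0))]
  module

/-- The pull-back of the two-form along a map which factors through a surface is covariantly
closed. -/
theorem covariant_pull_cyclic {q : ℝ × ℝ → P} (hq : ContMDiff 𝓘(ℝ, ℝ × ℝ) 𝓘(ℝ, EP) ∞ q)
    {F : Z → ℝ × ℝ} (hF : ContDiff ℝ ∞ F) {g : Z → G} (r : Z → Z →L[ℝ] EG)
    (hg : ∀ z, HasLogDerivAt g (r z) z) (z u v w : Z) :
    (fderiv ℝ (fun z => B.pull (fun z => Q.act (q (F z)) (g z)) z v w) z u +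
      adL EG G (A.pullForm (fun z => Q.act (q (F z)) (g z)) z u)
        (B.pull (fun z => Q.act (q (F z)) (g z)) z v w)) +
    (fderiv ℝ (fun z => B.pull (fun z => Q.act (q (F z)) (g z)) z w u) z v +
      adL EG G (A.pullForm (fun z => Q.act (q (F z)) (g z)) z v)
        (B.pull (fun z => Q.act (q (F z)) (g z)) z w u)) +
    (fderiv ℝ (fun z => B.pull (fun z => Q.act (q (F z)) (g z)) z u v) z w +
      adL EG G (A.pullForm (fun z => Q.act (q (F z)) (g z)) z w)
        (B.pull (fun z => Q.act (q (F z)) (g z)) z u v)) = 0 := by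
  set β : ℝ × ℝ → EG := fun y => B.pull q y (1, 0) (0, 1) with hβ
  have hβs : ContDiff ℝ ∞ β := B.contDiff_pull hq _ _
  have hqd := hq.mdifferentiable (by simp)
  have hFd := hF.differentiable (by simp)
  have hqF : MDifferentiable 𝓘(ℝ, Z) 𝓘(ℝ, EP) (fun z => q (F z)) := fun z =>
    (hqd (F z)).comp z (hFd z).mdifferentiableAt
  set T := fderiv ℝ (fderiv ℝ F) z with hT
  have hTd : HasFDerivAt (fderiv ℝ F) T z :=
    ((hF.fderiv_right (m := ∞) (by simp)).differentiable (by simp) z).hasFDerivAt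
  have hsymm : ∀ u v, T u v = T v u := fun u v =>
    hF.contDiffAt.isSymmSndFDerivAt (x := z) (by
      rw [minSmoothness_of_isRCLikeNormedField]; exact ENat.LEInfty.out) u v
  have hb (z v w : Z) : B.pull (fun z => Q.act (q (F z)) (g z)) z v w =
      AdL (g z)⁻¹ (area (fderiv ℝ F z v) (fderiv ℝ F z w) • β (F z)) := by
    rw [B.pull_act, B.pull_comp (hqd _) (hFd z), B.pull_eq_area]
  have ha (u : Z) : A.pullForm (fun z => Q.act (q (F z)) (g z)) z u =
      AdL (g z)⁻¹ (A.pullForm q (F z) (fderiv ℝ F z u) + r z u) := by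
    rw [A.pullForm_act (hqF z) (hg z), A.pullForm_comp (q := q) (H := F) (hqd _) (hFd z)]
    rfl
  set D := fderiv ℝ F z with hD
  -- one of the three terms; the derivative of the gauge transformation `g` cancels against `r`
  have hterm (u v w : Z) :
      fderiv ℝ (fun z => B.pull (fun z => Q.act (q (F z)) (g z)) z v w) z u +
        adL EG G (A.pullForm (fun z => Q.act (q (F z)) (g z)) z u)
          (B.pull (fun z => Q.act (q (F z)) (g z)) z v w) =
      adL EG G (AdL (g z)⁻¹ (A.pullForm q (F z) (area (D v) (D w) • D u))) (AdL (g z)⁻¹ (β (F z))) +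
        AdL (g z)⁻¹ ((area (T u v) (D w) + area (D v) (T u w)) • β (F z) +
          fderiv ℝ β (F z) (area (D v) (D w) • D u)) := by
    have h1 : HasFDerivAt (fun z => area (fderiv ℝ F z v) (fderiv ℝ F z w)) _ z :=
      (area.hasFDerivAt.comp z (hTd.clm_apply (hasFDerivAt_const v z))).clm_apply
        (hTd.clm_apply (hasFDerivAt_const w z))
    have h2 : HasFDerivAt (fun z => β (F z)) _ z :=
      HasFDerivAt.comp z (hβs.differentiable (by simp) (F z)).hasFDerivAt (hFd z).hasFDerivAt
    have h3 := ((hg z).inv.AdL_apply (h1.smul h2).hasFDerivWithinAt).hasFDerivAt univ_mem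
    have h4 : (fun z => B.pull (fun z => Q.act (q (F z)) (g z)) z v w) =
        fun z => AdL (g z)⁻¹ (area (fderiv ℝ F z v) (fderiv ℝ F z w) • β (F z)) :=
      funext fun z => hb z v w
    rw [h4]
    have h5 := DFunLike.congr_fun h3.fderiv u
    refine (congrArg₂ (· + ·) h5 rfl).trans ?_
    rw [ha, hb]
    simp only [add_apply, ContinuousLinearMap.comp_apply,
      ContinuousLinearMap.flip_apply, neg_apply, smul_apply,
      ContinuousLinearMap.smulRight_apply, map_add, map_smul, map_neg, zero_apply, map_zero,
      zero_add, ← hD, add_smul, Function.comp_apply, Pi.smul_apply', smul_add]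
    module
  rw [hterm u v w, hterm v w u, hterm w u v]
  have hcyc := area_cyclic (D u) (D v) (D w)
  -- the cyclic sums of the connection terms, of the second derivatives of `F`, and of the
  -- derivatives of the density `β` vanish separately
  have e1 : adL EG G (AdL (g z)⁻¹ (A.pullForm q (F z) (area (D v) (D w) • D u)))
        (AdL (g z)⁻¹ (β (F z))) +
      adL EG G (AdL (g z)⁻¹ (A.pullForm q (F z) (area (D w) (D u) • D v)))
        (AdL (g z)⁻¹ (β (F z))) +
      adL EG G (AdL (g z)⁻¹ (A.pullForm q (F z) (area (D u) (D v) • D w)))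
        (AdL (g z)⁻¹ (β (F z))) = 0 := by
    rw [← add_apply, ← add_apply, ← map_add, ← map_add, ← map_add, ← map_add, ← map_add, ← map_add,
      hcyc]
    simp
  have e2 : (area (T u v) (D w) + area (D v) (T u w)) + (area (T v w) (D u) + area (D w) (T v u)) +
      (area (T w u) (D v) + area (D u) (T w v)) = 0 := by
    rw [hsymm v u, hsymm w u, hsymm w v, area_skew (D w), area_skew (D u), area_skew (D v)]
    ring
  have e3 : fderiv ℝ β (F z) (area (D v) (D w) • D u) + fderiv ℝ β (F z) (area (D w) (D u) • D v) +
      fderiv ℝ β (F z) (area (D u) (D v) • D w) = 0 := by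
    rw [← map_add, ← map_add, hcyc, map_zero]
  have e4 := congrArg (fun c : ℝ => AdL (g z)⁻¹ (c • β (F z))) e2
  have e5 := congrArg (fun y => AdL (g z)⁻¹ y) e3
  simp only [add_smul, map_add, zero_smul, map_zero] at e4 e5 ⊢
  linear_combination (norm := module) e1 + e4 + e5

end Bianchi

/-! ### Flatness of the loop space connection -/

section

section FlatFamilies

variable {EG : Type*} [NormedAddCommGroup EG] [NormedSpace ℝ EG] [FiniteDimensional ℝ EG]
  {G : Type*} [TopologicalSpace G] [ChartedSpace EG G] [Group G] [LieGroup 𝓘(ℝ, EG) ∞ G]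
  [T2Space G]

/-- Homotopy invariance of the transport of a flat connection `a dτ + b ds` on a strip, when the
end points are fixed, that is, when `b` vanishes there. -/
theorem transport_eq_of_flat {a b : ℝ × ℝ → EG} (ha : ContDiff ℝ ∞ a) (hb : ContDiff ℝ ∞ b)
    {T : ℝ} (hT : 0 ≤ T)
    (hflat : ∀ τ ∈ Ioo 0 T, ∀ s ∈ Ioo (0 : ℝ) 1,
      fderiv ℝ a (τ, s) (0, 1) - fderiv ℝ b (τ, s) (1, 0) = adL EG G (a (τ, s)) (b (τ, s)))
    (hb0 : ∀ s ∈ Ioo (0 : ℝ) 1, b (0, s) = 0) (hbT : ∀ s ∈ Ioo (0 : ℝ) 1, b (T, s) = 0)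
    {W : ℝ → ℝ → G} (hW0 : ∀ s, W 0 s = 1)
    (hW : ∀ s t, HasLogDerivAt (fun t => W t s) (spanL (-a (t, s))) t) : W T 0 = W T 1 := by
  have : CompleteSpace EG := FiniteDimensional.complete ℝ EG
  have hξ : ContDiff ℝ ∞ fun q => -a q := ha.neg
  have hWs := contMDiff_of_solution hξ hW0 hW
  have hWl := hasLogDerivAt_of_solution hξ hW0 hW
  have hWsl (s : ℝ) : ContMDiff 𝓘(ℝ, ℝ) 𝓘(ℝ, EG) ∞ (fun t => W t s) :=
    hWs.comp (contDiff_prodMk_left s).contMDiff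
  have hWtr (t : ℝ) : ContMDiff 𝓘(ℝ, ℝ) 𝓘(ℝ, EG) ∞ (fun s => W t s) :=
    hWs.comp (contDiff_prodMk_right t).contMDiff
  -- the derivative of the transport with respect to `s` vanishes
  have hvar : ∀ s ∈ Ioo (0 : ℝ) 1, paramVariation (fun q => -a q) W (T, s) = 0 := by
    intro s hs
    have hda (τ : ℝ) : HasFDerivAt a (fderiv ℝ a (τ, s)) (τ, s) :=
      (ha.differentiable (by simp) _).hasFDerivAt
    have hAc : Continuous fun τ => AdL (W τ s)⁻¹ :=
      (contDiff_AdL_comp (contMDiff_inv_comp (hWsl s))).continuous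
    have hdac : Continuous fun τ : ℝ => fderiv ℝ a (τ, s) :=
      (ha.continuous_fderiv (by simp)).comp (by fun_prop)
    -- `AdL W⁻¹ b` is a primitive of the integrand
    have hprim (τ : ℝ) : HasDerivAt (fun τ => AdL (W τ s)⁻¹ (b (τ, s)))
        (adL EG G (AdL (W τ s)⁻¹ (a (τ, s))) (AdL (W τ s)⁻¹ (b (τ, s))) +
          AdL (W τ s)⁻¹ (fderiv ℝ b (τ, s) (1, 0))) τ := by
      have h1 : HasFDerivAt (fun τ : ℝ => b (τ, s)) _ τ :=
        HasFDerivAt.comp τ (f := fun τ : ℝ => (τ, s))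
          (hb.differentiable (by simp) (τ, s)).hasFDerivAt (hasFDerivAt_prodMk_left τ s)
      have h2 := ((hW s τ).inv.AdL_apply h1.hasFDerivWithinAt).hasFDerivAt univ_mem
      simpa using h2.hasDerivAt
    have hint : ∫ τ in (0 : ℝ)..T, AdL (W τ s)⁻¹ (fderiv ℝ a (τ, s) (0, 1)) = 0 := by
      rw [intervalIntegral.integral_eq_sub_of_hasDerivAt_of_le
        (f := fun τ => AdL (W τ s)⁻¹ (b (τ, s))) hT
        (continuous_iff_continuousAt.2 fun τ => (hprim τ).continuousAt).continuousOn ?_ ?_]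
      · rw [hb0 s hs, hbT s hs, map_zero, map_zero, sub_zero]
      · intro τ hτ
        have h3 := hprim τ
        rw [← AdL_adL, ← map_add, ← hflat τ hτ s hs, sub_add_cancel] at h3
        exact h3
      · exact (hAc.clm_apply (hdac.clm_apply continuous_const)).intervalIntegrable _ _
    ext
    rw [paramVariation, ContinuousLinearMap.intervalIntegral_apply]
    · have h4 : (fun τ => ((AdL (W τ s)⁻¹).comp ((fderiv ℝ (fun q => -a q) (τ, s)).comp
          (ContinuousLinearMap.inr ℝ ℝ ℝ))) 1) =
          fun τ => -AdL (W τ s)⁻¹ (fderiv ℝ a (τ, s) (0, 1)) := by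
        ext τ
        rw [fderiv_fun_neg]
        simp
      simp only [h4, intervalIntegral.integral_neg, hint]
      simp
    · refine Continuous.intervalIntegrable ?_ _ _
      refine hAc.clm_comp (Continuous.clm_comp ?_ continuous_const)
      exact (hξ.continuous_fderiv (by simp)).comp (by fun_prop)
  have hlog : ∀ s ∈ Ioo (0 : ℝ) 1, HasLogDerivAt (fun s => W T s) (0 : ℝ →L[ℝ] EG) s := by
    intro s hs
    have h1 : HasLogDerivAt (fun s => W T s) _ s :=
      HasLogDerivWithinAt.comp (g := fun q : ℝ × ℝ => W q.1 q.2) (f := fun s : ℝ => (T, s))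
        (hWl (T, s)) (hasFDerivAt_prodMk_right T s).hasFDerivWithinAt (mapsTo_univ _ _)
    rw [hvar s hs] at h1
    convert h1 using 1
    ext; simp
  have hconst : ∀ s ∈ Ioo (0 : ℝ) 1, W T s = W T (1 / 2) := fun s hs =>
    eq_of_hasLogDerivWithinAt_zero (convex_Ioo 0 1) (fun s hs => (hlog s hs).mono (subset_univ _))
      (z := 1 / 2) (by norm_num) hs
  have hclos : EqOn (fun s => W T s) (fun _ => W T (1 / 2)) (closure (Ioo (0 : ℝ) 1)) :=
    EqOn.closure hconst (hWtr T).continuous continuous_const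
  rw [closure_Ioo zero_ne_one] at hclos
  exact (hclos (left_mem_Icc.2 zero_le_one)).trans (hclos (right_mem_Icc.2 zero_le_one)).symm

end FlatFamilies

section LoopFamilies

variable {EM EP EG : Type*}
  [NormedAddCommGroup EM] [NormedSpace ℝ EM] [FiniteDimensional ℝ EM]
  [NormedAddCommGroup EP] [NormedSpace ℝ EP] [FiniteDimensional ℝ EP]
  [NormedAddCommGroup EG] [NormedSpace ℝ EG] [FiniteDimensional ℝ EG]
  {M P G : Type*}
  [TopologicalSpace M] [ChartedSpace EM M] [IsManifold 𝓘(ℝ, EM) ∞ M]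
  [TopologicalSpace P] [ChartedSpace EP P] [IsManifold 𝓘(ℝ, EP) ∞ P]
  [TopologicalSpace G] [ChartedSpace EG G] [Group G] [LieGroup 𝓘(ℝ, EG) ∞ G]
  {Q : PrincipalBundle EM EP EG M P G} {A : Connection Q} {B : AdjointTwoForm Q} {p₀ : P}

/-- In a family of horizontal lifts, the connection form on the velocities in the direction of the
parameters changes along the lifts by the curvature. -/
theorem hasDerivAt_pullForm_of_horizontal {Λ : Type*} [NormedAddCommGroup Λ] [NormedSpace ℝ Λ]
    {q : ℝ × Λ → P} (hq : ContMDiff 𝓘(ℝ, ℝ × Λ) 𝓘(ℝ, EP) ∞ q)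
    (hhor : ∀ z, A.pullForm q z (1, 0) = 0) (σ : ℝ) (l : Λ) (u : ℝ × Λ) :
    HasDerivAt (fun σ : ℝ => A.pullForm q (σ, l) u)
      (A.baseCurvature (q (σ, l)) (Q.baseDeriv q (σ, l) (1, 0)) (Q.baseDeriv q (σ, l) u)) σ := by
  have has : ContDiff ℝ ∞ (A.pullForm q) := A.contDiff_pullForm hq
  have hfd : fderiv ℝ (A.pullForm q) (σ, l) u (1, 0) = 0 := by
    have h1 := ((has.differentiable (by simp) (σ, l)).hasFDerivAt).clm_apply
      (hasFDerivAt_const ((1, 0) : ℝ × Λ) (σ, l))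
    have h2 : (fun z => A.pullForm q z (1, 0)) = fun _ => (0 : EG) := funext hhor
    rw [h2] at h1
    have h3 := DFunLike.congr_fun (h1.unique (hasFDerivAt_const (0 : EG) (σ, l))) u
    simpa using h3
  rw [A.baseCurvature_modelDeriv (hq (σ, l)), hhor, hfd, map_zero, zero_apply, sub_zero, add_zero]
  have h1 : HasDerivAt (fun σ : ℝ => A.pullForm q (σ, l))
      (fderiv ℝ (A.pullForm q) (σ, l) (1, 0)) σ :=
    HasFDerivAt.comp_hasDerivAt σ (f := fun σ : ℝ => (σ, l))
      (has.differentiable (by simp) (σ, l)).hasFDerivAt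
      ((hasDerivAt_id σ).prodMk (hasDerivAt_const _ _))
  simpa using h1.clm_apply (hasDerivAt_const σ u)

/-- The loop space curvature of a two-parameter family of loops, with horizontal lifts
`p (·, τ, s)`, vanishes if the loop space connection is curvature local, the pull-back of the
two-form is covariantly closed, and the family is degenerate at the base point. -/
theorem loopConnection_flat (hCL : CurvatureLocal A B p₀) {p : ℝ × ℝ × ℝ → P}
    (hp : ContMDiff 𝓘(ℝ, ℝ × ℝ × ℝ) 𝓘(ℝ, EP) ∞ p)
    (hhor : ∀ z, A.pullForm p z (1, 0, 0) = 0)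
    (hclosed : ∀ z u v w,
      (fderiv ℝ (fun z => B.pull p z v w) z u + adL EG G (A.pullForm p z u) (B.pull p z v w)) +
      (fderiv ℝ (fun z => B.pull p z w u) z v + adL EG G (A.pullForm p z v) (B.pull p z w u)) +
      (fderiv ℝ (fun z => B.pull p z u v) z w + adL EG G (A.pullForm p z w) (B.pull p z u v)) = 0)
    {τ s : ℝ} (hp0 : ∀ᶠ l : ℝ × ℝ in 𝓝 (τ, s), p (0, l) = p₀)
    (hend : Q.proj (p (2 * Real.pi, τ, s)) = Q.proj p₀)
    (hb0 : B.pull p (0, τ, s) (0, 1, 0) (0, 0, 1) = 0)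
    (hb1 : B.pull p (2 * Real.pi, τ, s) (0, 1, 0) (0, 0, 1) = 0) :
    fderiv ℝ (fun l : ℝ × ℝ => ∫ σ in (0 : ℝ)..(2 * Real.pi),
        B.pull p (σ, l) (1, 0, 0) (0, 1, 0)) (τ, s) (0, 1) -
      fderiv ℝ (fun l : ℝ × ℝ => ∫ σ in (0 : ℝ)..(2 * Real.pi),
        B.pull p (σ, l) (1, 0, 0) (0, 0, 1)) (τ, s) (1, 0) =
      adL EG G (∫ σ in (0 : ℝ)..(2 * Real.pi), B.pull p (σ, τ, s) (1, 0, 0) (0, 1, 0))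
        (∫ σ in (0 : ℝ)..(2 * Real.pi), B.pull p (σ, τ, s) (1, 0, 0) (0, 0, 1)) := by
  have : CompleteSpace EG := FiniteDimensional.complete ℝ EG
  set D : ℝ → ℝ × ℝ × ℝ →L[ℝ] EM := fun σ => Q.baseDeriv p (σ, τ, s) with hD
  have hbs (v w : ℝ × ℝ × ℝ) : ContDiff ℝ ∞ fun z => B.pull p z v w := B.contDiff_pull hp v w
  have has : ContDiff ℝ ∞ (A.pullForm p) := A.contDiff_pullForm hp
  have hline : Continuous fun σ : ℝ => (σ, τ, s) := by fun_prop
  have hlined (σ : ℝ) : HasDerivAt (fun σ : ℝ => (σ, τ, s)) (1, 0, 0) σ :=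
    (hasDerivAt_id σ).prodMk (hasDerivAt_const _ _)
  have hbc (v w : ℝ × ℝ × ℝ) : Continuous fun σ : ℝ => B.pull p (σ, τ, s) v w :=
    (hbs v w).continuous.comp hline
  have hdbc (u v w : ℝ × ℝ × ℝ) :
      Continuous fun σ : ℝ => fderiv ℝ (fun z => B.pull p z v w) (σ, τ, s) u :=
    (((hbs v w).continuous_fderiv (by simp)).comp hline).clm_apply continuous_const
  have hac (u : ℝ × ℝ × ℝ) : Continuous fun σ : ℝ => A.pullForm p (σ, τ, s) u :=
    (has.continuous.comp hline).clm_apply continuous_const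
  have hder (v w : ℝ × ℝ × ℝ) (l : ℝ × ℝ) :
      fderiv ℝ (fun l : ℝ × ℝ => ∫ σ in (0 : ℝ)..(2 * Real.pi), B.pull p (σ, l) v w) (τ, s) l =
        ∫ σ in (0 : ℝ)..(2 * Real.pi), fderiv ℝ (fun z => B.pull p z v w) (σ, τ, s) (0, l) := by
    have h1 := hasFDerivAt_parametric_integral (F := fun z : ℝ × ℝ × ℝ => B.pull p z v w)
      ((hbs v w).of_le (by simp)) 0 (2 * Real.pi) (τ, s)
    have h2 : Continuous fun σ : ℝ => (fderiv ℝ (fun z => B.pull p z v w) (σ, τ, s)).comp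
        (ContinuousLinearMap.inr ℝ ℝ (ℝ × ℝ)) :=
      (((hbs v w).continuous_fderiv (by simp)).comp hline).clm_comp continuous_const
    rw [h1.fderiv, ContinuousLinearMap.intervalIntegral_apply (h2.intervalIntegrable _ _)]
    rfl
  have hcurv (u : ℝ × ℝ × ℝ) (σ : ℝ) : HasDerivAt (fun σ : ℝ => A.pullForm p (σ, τ, s) u)
      (A.baseCurvature (p (σ, τ, s)) (D σ (1, 0, 0)) (D σ u)) σ :=
    hasDerivAt_pullForm_of_horizontal hp hhor σ (τ, s) u
  -- the lifts start at a fixed point, so that the primitives of the curvature vanish there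
  have ha0 (l : ℝ × ℝ) : A.pullForm p (0, τ, s) (0, l) = 0 := by
    have h1 := A.pullForm_comp (q := p) (H := fun l : ℝ × ℝ => ((0 : ℝ), l)) (z := (τ, s))
      (hp.mdifferentiable (by simp) _) (hasFDerivAt_prodMk_right 0 (τ, s)).differentiableAt
    rw [(hasFDerivAt_prodMk_right (0 : ℝ) (τ, s)).fderiv, Connection.pullForm,
      modelDeriv_congr (f := fun _ => p₀) hp0, modelDeriv_const] at h1
    have h2 := DFunLike.congr_fun h1 l
    simpa using h2.symm
  -- curvature locality along the loop
  have hhorp (t : ℝ) : IsHorizontalAt A (fun σ => Q.proj (p (σ, τ, s)))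
      (fun σ => p (σ, τ, s)) t := by
    have h := isHorizontalAt_slice (X := fun z => Q.proj (p z)) (hp.mdifferentiable (by simp) (t, τ, s))
      (Eventually.of_forall fun _ => rfl) (hhor _) 1
    simpa only [Q.act_one] using h
  have hloop : IsLoop EM (Q.proj p₀) (fun σ => Q.proj (p (σ, τ, s))) := by
    refine ⟨Q.contMDiff_proj.comp (hp.comp ?_), by rw [hp0.self_of_nhds], hend⟩
    exact (contDiff_prodMk_left (τ, s)).contMDiff
  have hvel (σ : ℝ) : modelDeriv (fun σ => Q.proj (p (σ, τ, s))) σ (1 : ℝ) =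
      D σ (1, 0, 0) := by
    rw [modelDeriv_comp (g := fun w => Q.proj (p w)) (f := fun σ : ℝ => (σ, τ, s))
      ((Q.contMDiff_proj.comp hp).mdifferentiable (by simp) _)
      (hasFDerivAt_prodMk_left σ (τ, s)).differentiableAt.mdifferentiableAt, modelDeriv_eq_fderiv,
      (hasFDerivAt_prodMk_left σ (τ, s)).fderiv]
    exact congrArg (D σ) (ContinuousLinearMap.inl_apply (R := ℝ) (M₁ := ℝ) (M₂ := ℝ × ℝ) 1)
  have hlocal (v w : ℝ × ℝ × ℝ) : ∀ t ∈ Icc 0 (2 * Real.pi), ∀ t' ∈ Ico 0 t,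
      adL EG G (B.pull p (t', τ, s) (1, 0, 0) v -
        A.baseCurvature (p (t', τ, s)) (D t' (1, 0, 0)) (D t' v))
        (B.pull p (t, τ, s) (1, 0, 0) w) = 0 := by
    intro t ht t' ht'
    have h := curvatureLocal_iff.1 hCL _ hloop (fun σ => p (σ, τ, s)) hp0.self_of_nhds hhorp t ht t'
      ⟨ht'.1, ht'.2.le.trans ht.2⟩ ht'.2 (D t' v) (D t w)
    rw [localCommutator, hvel, hvel] at h
    exact h
  rw [← integral_adL_sub_adL Real.two_pi_pos.le (hbc _ _) (hbc _ _) (hcurv (0, 1, 0))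
    (hcurv (0, 0, 1)) (ha0 (1, 0)) (ha0 (0, 1)) (hlocal _ _) (hlocal _ _), hder, hder,
    ← intervalIntegral.integral_sub ((hdbc _ _ _).intervalIntegrable _ _)
      ((hdbc _ _ _).intervalIntegrable _ _)]
  -- the remaining term of the covariant closedness is a total derivative
  have htot : ∫ σ in (0 : ℝ)..(2 * Real.pi),
      fderiv ℝ (fun z => B.pull p z (0, 1, 0) (0, 0, 1)) (σ, τ, s) (1, 0, 0) = 0 := by
    rw [intervalIntegral.integral_eq_sub_of_hasDerivAt
      (f := fun σ => B.pull p (σ, τ, s) (0, 1, 0) (0, 0, 1)) (fun σ _ => ?_)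
      ((hdbc _ _ _).intervalIntegrable _ _), hb0, hb1, sub_zero]
    exact HasFDerivAt.comp_hasDerivAt σ (f := fun σ : ℝ => (σ, τ, s))
      ((hbs (0, 1, 0) (0, 0, 1)).differentiable (by simp) (σ, τ, s)).hasFDerivAt (hlined σ)
  have hpt (σ : ℝ) : fderiv ℝ (fun z => B.pull p z (1, 0, 0) (0, 1, 0)) (σ, τ, s) (0, 0, 1) -
        fderiv ℝ (fun z => B.pull p z (1, 0, 0) (0, 0, 1)) (σ, τ, s) (0, 1, 0) =
      (adL EG G (A.pullForm p (σ, τ, s) (0, 1, 0)) (B.pull p (σ, τ, s) (1, 0, 0) (0, 0, 1)) -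
        adL EG G (A.pullForm p (σ, τ, s) (0, 0, 1)) (B.pull p (σ, τ, s) (1, 0, 0) (0, 1, 0))) -
      fderiv ℝ (fun z => B.pull p z (0, 1, 0) (0, 0, 1)) (σ, τ, s) (1, 0, 0) := by
    have h1 := hclosed (σ, τ, s) (1, 0, 0) (0, 1, 0) (0, 0, 1)
    have h2 : (fun z => B.pull p z (0, 0, 1) (1, 0, 0)) =
        fun z => -B.pull p z (1, 0, 0) (0, 0, 1) := funext fun z => B.pull_skew p z _ _
    have h3 : fderiv ℝ (fun z => -B.pull p z (1, 0, 0) (0, 0, 1)) (σ, τ, s) =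
        -fderiv ℝ (fun z => B.pull p z (1, 0, 0) (0, 0, 1)) (σ, τ, s) := fderiv_fun_neg
    rw [h2, h3, hhor, B.pull_skew p (σ, τ, s) (0, 0, 1), map_zero, zero_apply, map_neg,
      neg_apply] at h1
    linear_combination (norm := module) h1
  refine (intervalIntegral.integral_congr fun σ _ => hpt σ).trans ?_
  rw [intervalIntegral.integral_sub, htot, sub_zero]
  · refine Continuous.intervalIntegrable ?_ _ _
    exact (((adL EG G).continuous.comp (hac _)).clm_apply (hbc _ _)).sub
      (((adL EG G).continuous.comp (hac _)).clm_apply (hbc _ _))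
  · exact (hdbc _ _ _).intervalIntegrable _ _

end LoopFamilies

end

/-! ### From curvature locality to r-flatness -/

section Forward

theorem zero_mem_interval : (0 : ℝ) ∈ interval := ⟨le_rfl, Real.two_pi_pos.le⟩

theorem two_pi_mem_interval : 2 * Real.pi ∈ interval := ⟨Real.two_pi_pos.le, le_rfl⟩

theorem mem_frontier_square {z : ℝ × ℝ} (h1 : z.1 ∈ interval) (h2 : z.2 ∈ interval)
    (h : z.1 = 0 ∨ z.1 = 2 * Real.pi ∨ z.2 = 0 ∨ z.2 = 2 * Real.pi) : z ∈ frontier square := by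
  rw [frontier_prod_eq, frontier_Icc Real.two_pi_pos.le, isClosed_Icc.closure_eq]
  rcases h with h | h | h | h
  · exact Or.inr ⟨Or.inl h, h2⟩
  · exact Or.inr ⟨Or.inr h, h2⟩
  · exact Or.inl ⟨h1, Or.inl h⟩
  · exact Or.inl ⟨h1, Or.inr h⟩

variable {EM EP EG : Type*}
  [NormedAddCommGroup EM] [NormedSpace ℝ EM] [FiniteDimensional ℝ EM]
  [NormedAddCommGroup EP] [NormedSpace ℝ EP] [FiniteDimensional ℝ EP]
  [NormedAddCommGroup EG] [NormedSpace ℝ EG] [FiniteDimensional ℝ EG]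
  {M P G : Type*}
  [TopologicalSpace M] [ChartedSpace EM M] [IsManifold 𝓘(ℝ, EM) ∞ M]
  [TopologicalSpace P] [ChartedSpace EP P] [IsManifold 𝓘(ℝ, EP) ∞ P] [T2Space P]
  [TopologicalSpace G] [ChartedSpace EG G] [Group G] [LieGroup 𝓘(ℝ, EG) ∞ G] [T2Space G]
  {Q : PrincipalBundle EM EP EG M P G} {A : Connection Q} {B : AdjointTwoForm Q} {p₀ : P}

/-- A loop of loops has a family of horizontal lifts that start at the base point of the bundle. -/
theorem exists_surface_lift (A : Connection Q) {Γ : ℝ × ℝ → M}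
    (hΓ : IsLoopOfLoops EM (Q.proj p₀) Γ) :
    ∃ q : ℝ × ℝ → P, ContMDiff 𝓘(ℝ, ℝ × ℝ) 𝓘(ℝ, EP) ∞ q ∧ (∀ z, Q.proj (q z) = Γ z) ∧
      (∀ τ ∈ interval, q (0, τ) = p₀) ∧ ∀ z, A.pullForm q z (1, 0) = 0 := by
  -- a horizontal lift of the left edge, which is constant where the edge is
  obtain ⟨q₁, hq₁, hproj₁, hstart₁, hhor₁⟩ := exists_horizontal_family A (Λ := ℝ)
    (X := fun z : ℝ × ℝ => Γ (0, z.1)) (hΓ.smooth.comp (contDiff_const.prodMk contDiff_fst).contMDiff)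
    (q₀ := fun _ => p₀) contMDiff_const (fun _ => (hΓ.left 0 zero_mem_interval).symm)
  set q₀ : ℝ → P := fun t => q₁ (t, 0) with hq₀
  have hq₀s : ContMDiff 𝓘(ℝ, ℝ) 𝓘(ℝ, EP) ∞ q₀ := hq₁.comp (contDiff_prodMk_left 0).contMDiff
  have hconst : EqOn q₀ (fun _ => q₀ Real.pi) (Ioo 0 (2 * Real.pi)) := by
    have hpi : Real.pi ∈ Ioo 0 (2 * Real.pi) := ⟨Real.pi_pos, by linarith [Real.pi_pos]⟩
    refine IsHorizontalAt.eqOn (A := A) (x := fun t => Γ (0, t)) hpi rfl (fun t _ => ?_)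
      (fun t ht => ⟨?_, mdifferentiableAt_const, ?_⟩)
    · have h := isHorizontalAt_slice (X := fun z : ℝ × ℝ => Γ (0, z.1))
        (hq₁.mdifferentiable (by simp) (t, 0)) (Eventually.of_forall hproj₁) (hhor₁ _) 1
      simpa only [Q.act_one] using h
    · filter_upwards [isOpen_Ioo.mem_nhds ht] with s hs
      rw [hq₀]
      simp only [hproj₁]
      rw [hΓ.left _ (Ioo_subset_Icc_self hpi), hΓ.left _ (Ioo_subset_Icc_self hs)]
    · rw [Connection.pullForm, modelDeriv_const, ContinuousLinearMap.comp_zero, zero_apply]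
  have hclos := hconst.closure hq₀s.continuous continuous_const
  rw [closure_Ioo Real.two_pi_pos.ne] at hclos
  have hq₀p : ∀ τ ∈ interval, q₀ τ = p₀ := fun τ hτ =>
    (hclos hτ).trans ((hclos zero_mem_interval).symm.trans (hstart₁ 0))
  obtain ⟨q, hq, hproj, hstart, hhor⟩ := exists_horizontal_family A hΓ.smooth hq₀s
    (fun l => hproj₁ (l, 0))
  exact ⟨q, hq, hproj, fun τ hτ => (hstart τ).trans (hq₀p τ hτ), hhor⟩

/-- A homotopy of the square, relative to its boundary, does not change the holonomy of a
curvature local loop space connection. -/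
theorem holonomy_eq_of_homotopy (hCL : CurvatureLocal A B p₀) {Γ : ℝ × ℝ → M}
    (hΓ : IsLoopOfLoops EM (Q.proj p₀) Γ) {F : ℝ × ℝ × ℝ → ℝ × ℝ} (hF : ContDiff ℝ ∞ F)
    (hFb : ∀ s ∈ Icc (0 : ℝ) 1, ∀ z ∈ frontier square, F (z.1, z.2, s) = z) :
    holonomy A B p₀ (fun z => Γ (F (z.1, z.2, 0))) =
      holonomy A B p₀ (fun z => Γ (F (z.1, z.2, 1))) := by
  obtain ⟨q, hq, hproj, hstart, -⟩ := exists_surface_lift A hΓ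
  have hFd := hF.differentiable (by simp)
  have hqF : ContMDiff 𝓘(ℝ, ℝ × ℝ × ℝ) 𝓘(ℝ, EP) ∞ (fun z => q (F z)) := hq.comp hF.contMDiff
  -- the lifts `q (F z)` are not horizontal in the first coordinate; correct them by the group
  set ξ : ℝ × ℝ × ℝ → EG := fun z => -A.pullForm (fun z => q (F z)) z (1, 0, 0) with hξ
  have hξs : ContDiff ℝ ∞ ξ := ((A.contDiff_pullForm hqF).clm_apply contDiff_const).neg
  have hex : ∀ l : ℝ × ℝ, ∃ g : ℝ → G, g 0 = 1 ∧ ∀ t, HasLogDerivAt g (spanL (ξ (t, l))) t :=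
    fun l => exists_hasLogDerivAt (hξs.continuous.comp (by fun_prop : Continuous fun t => (t, l))) 1
  choose g hg0 hg using hex
  have hgs := contMDiff_of_solution hξs (g := fun t l => g l t) hg0 hg
  have hgl := hasLogDerivAt_of_solution hξs (g := fun t l => g l t) hg0 hg
  set p : ℝ × ℝ × ℝ → P := fun z => Q.act (q (F z)) (g z.2 z.1) with hp
  have hps : ContMDiff 𝓘(ℝ, ℝ × ℝ × ℝ) 𝓘(ℝ, EP) ∞ p := fun z =>
    Q.contMDiffAt_act le_rfl (hqF z) (hgs z)
  have hhor (z) : A.pullForm p z (1, 0, 0) = 0 := by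
    rw [hp, A.pullForm_act (hqF.mdifferentiable (by simp) z) (hgl z)]
    have h1 : ((0 : ℝ), (0 : ℝ)) = 0 := rfl
    have h2 : ((spanL (ξ z)).comp (ContinuousLinearMap.fst ℝ ℝ (ℝ × ℝ)) +
        (AdL (g z.2 z.1)).comp ((paramVariation ξ (fun t l => g l t) z).comp
          (ContinuousLinearMap.snd ℝ ℝ (ℝ × ℝ)))) (1, 0, 0) = ξ z := by
      simp only [add_apply, ContinuousLinearMap.comp_apply, ContinuousLinearMap.coe_fst',
        ContinuousLinearMap.coe_snd', h1, map_zero, add_zero,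
        ContinuousLinearMap.toSpanSingleton_apply, one_smul]
    rw [h2, hξ]
    simp only [add_neg_cancel, map_zero]
  have hp0 {τ s : ℝ} (hτ : τ ∈ interval) (hs : s ∈ Icc (0 : ℝ) 1) : p (0, τ, s) = p₀ := by
    have h1 := hFb s hs (0, τ) (mem_frontier_square zero_mem_interval hτ (Or.inl rfl))
    simp only at h1
    rw [hp]
    simp only
    rw [h1, hg0, Q.act_one, hstart τ hτ]
  have hpproj (z) : Q.proj (p z) = Γ (F z) := by
    rw [hp]
    simp only
    rw [Q.proj_act, hproj]
  -- the variation in the parameter of the homotopy vanishes on the boundary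
  have hFs {z : ℝ × ℝ} (hz : z ∈ frontier square) {s : ℝ} (hs : s ∈ Ioo (0 : ℝ) 1) :
      fderiv ℝ F (z.1, z.2, s) (0, 0, 1) = 0 := by
    have h1 : HasDerivAt (fun t : ℝ => (z.1, z.2, t)) (0, 0, 1) s :=
      (hasDerivAt_const s z.1).prodMk ((hasDerivAt_const s z.2).prodMk (hasDerivAt_id s))
    have h2 : HasDerivAt (fun t : ℝ => F (z.1, z.2, t)) _ s :=
      HasFDerivAt.comp_hasDerivAt s (f := fun t : ℝ => (z.1, z.2, t)) (hFd _).hasFDerivAt h1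
    refine h2.unique ((hasDerivAt_const s z).congr_of_eventuallyEq ?_)
    filter_upwards [isOpen_Ioo.mem_nhds hs] with t ht using hFb t (Ioo_subset_Icc_self ht) z hz
  have hpull {z : ℝ × ℝ} (hz : z ∈ frontier square) {s : ℝ} (hs : s ∈ Ioo (0 : ℝ) 1)
      (v : ℝ × ℝ × ℝ) : B.pull p (z.1, z.2, s) v (0, 0, 1) = 0 := by
    rw [hp, B.pull_act, B.pull_comp (hq.mdifferentiable (by simp) _) (hFd _), hFs hz hs,
      AdjointTwoForm.pull, map_zero, map_zero, map_zero]
  -- the loop space connection on the strip: `a` along the loops of loops, `b` along the homotopy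
  set a : ℝ × ℝ → EG := fun l => ∫ σ in (0 : ℝ)..(2 * Real.pi), B.pull p (σ, l) (1, 0, 0) (0, 1, 0)
    with ha
  set b : ℝ × ℝ → EG := fun l => ∫ σ in (0 : ℝ)..(2 * Real.pi), B.pull p (σ, l) (1, 0, 0) (0, 0, 1)
    with hb
  have has : ContDiff ℝ ∞ a :=
    contDiff_parametric_integral (n := ⊤) (F := fun z : ℝ × ℝ × ℝ => B.pull p z (1, 0, 0) (0, 1, 0))
      (B.contDiff_pull hps _ _) _ _
  have hbs : ContDiff ℝ ∞ b :=
    contDiff_parametric_integral (n := ⊤) (F := fun z : ℝ × ℝ × ℝ => B.pull p z (1, 0, 0) (0, 0, 1))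
      (B.contDiff_pull hps _ _) _ _
  have hexW : ∀ s : ℝ, ∃ W : ℝ → G, W 0 = 1 ∧ ∀ t, HasLogDerivAt W (spanL (-a (t, s))) t :=
    fun s => exists_hasLogDerivAt
      (has.neg.continuous.comp (by fun_prop : Continuous fun t : ℝ => (t, s))) 1
  choose W hW0 hW using hexW
  have hhol {s : ℝ} (hs : s ∈ Icc (0 : ℝ) 1) :
      holonomy A B p₀ (fun z => Γ (F (z.1, z.2, s))) = W s (2 * Real.pi) := by
    refine holonomy_eq (ξ := fun τ => a (τ, s)) (fun τ hτ => ?_) (hW0 s)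
      (fun τ _ => (hW s τ).mono (subset_univ _))
    set ι : ℝ × ℝ → ℝ × ℝ × ℝ := fun z => (z.1, z.2, s)
    have hι (z) : HasFDerivAt ι ((ContinuousLinearMap.fst ℝ ℝ ℝ).prod
        ((ContinuousLinearMap.snd ℝ ℝ ℝ).prod 0)) z :=
      hasFDerivAt_fst.prodMk (hasFDerivAt_snd.prodMk (hasFDerivAt_const s z))
    have hιs : ContDiff ℝ ∞ ι := by fun_prop
    rw [toModel_loopConnectionAt_pull (q := fun z => p (ι z)) (hps.comp hιs.contMDiff)
      (fun z => hpproj _) (hp0 hτ hs) (fun σ => ?_), ha]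
    · refine intervalIntegral.integral_congr fun σ _ => ?_
      refine Eq.trans (b := B.pull p (ι (σ, τ)) (1, 0, 0) (0, 1, 0)) ?_ rfl
      rw [B.pull_comp (hps.mdifferentiable (by simp) _) (hι _).differentiableAt, (hι _).fderiv]
      rfl
    · rw [A.pullForm_comp (q := p) (H := ι) (hps.mdifferentiable (by simp) _)
        (hι _).differentiableAt, (hι _).fderiv]
      exact hhor _
  rw [hhol (left_mem_Icc.2 zero_le_one), hhol (right_mem_Icc.2 zero_le_one)]
  refine transport_eq_of_flat (W := fun t s => W s t) has hbs Real.two_pi_pos.le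
    (fun τ hτ s hs => ?_) (fun s hs => ?_) (fun s hs => ?_) hW0 hW
  · have hτ' := Ioo_subset_Icc_self hτ
    have hs' := Ioo_subset_Icc_self hs
    have hleft : (0, τ) ∈ frontier square :=
      mem_frontier_square zero_mem_interval hτ' (Or.inl rfl)
    have hright : (2 * Real.pi, τ) ∈ frontier square :=
      mem_frontier_square two_pi_mem_interval hτ' (Or.inr (Or.inl rfl))
    refine loopConnection_flat hCL hps hhor (fun z u v w => covariant_pull_cyclic hq hF _ hgl z u v w)
      ?_ ?_ (hpull hleft hs _) (hpull hright hs _)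
    · rw [nhds_prod_eq]
      filter_upwards [prod_mem_prod (isOpen_Ioo.mem_nhds hτ) (isOpen_Ioo.mem_nhds hs)] with l hl
      exact hp0 (Ioo_subset_Icc_self hl.1) (Ioo_subset_Icc_self hl.2)
    · have h1 := hFb s hs' _ hright
      simp only at h1
      rw [hpproj, h1, hΓ.right τ hτ']
  · refine (intervalIntegral.integral_congr (g := fun _ => 0) fun σ hσ => ?_).trans (by simp)
    rw [uIcc_of_le Real.two_pi_pos.le] at hσ
    exact hpull (mem_frontier_square (z := (σ, 0)) hσ zero_mem_interval
      (Or.inr (Or.inr (Or.inl rfl)))) hs _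
  · refine (intervalIntegral.integral_congr (g := fun _ => 0) fun σ hσ => ?_).trans (by simp)
    rw [uIcc_of_le Real.two_pi_pos.le] at hσ
    exact hpull (mem_frontier_square (z := (σ, 2 * Real.pi)) hσ two_pi_mem_interval
      (Or.inr (Or.inr (Or.inr rfl)))) hs _

/-- The path of diffeomorphisms that connects a reparametrisation to the identity is a homotopy of the
square relative to its boundary. -/
theorem rFlat_of_curvatureLocal (hCL : CurvatureLocal A B p₀) : RFlat A B p₀ := by
  intro Γ hΓ h hh
  obtain ⟨hd, H, hH, hHd, hH0, hH1⟩ := hh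
  -- correct the path outside the square, so that its end points are the identity and `h`
  set F : ℝ × ℝ × ℝ → ℝ × ℝ := fun w => H w.2.2 (w.1, w.2.1) +
    w.2.2 • (h (w.1, w.2.1) - H 1 (w.1, w.2.1)) +
      (1 - w.2.2) • ((w.1, w.2.1) - H 0 (w.1, w.2.1)) with hF
  have hFs : ContDiff ℝ ∞ F := by
    have h1 (s : ℝ) : ContDiff ℝ ∞ fun w : ℝ × ℝ × ℝ => H s (w.1, w.2.1) :=
      hH.comp (f := fun w : ℝ × ℝ × ℝ => (s, w.1, w.2.1)) (by fun_prop)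
    have h2 : ContDiff ℝ ∞ fun w : ℝ × ℝ × ℝ => H w.2.2 (w.1, w.2.1) :=
      hH.comp (f := fun w : ℝ × ℝ × ℝ => (w.2.2, w.1, w.2.1)) (by fun_prop)
    have h3 : ContDiff ℝ ∞ fun w : ℝ × ℝ × ℝ => h (w.1, w.2.1) := hd.smooth.comp (by fun_prop)
    have h4 := h1 0
    have h5 := h1 1
    have h6 : ContDiff ℝ ∞ fun w : ℝ × ℝ × ℝ => w.2.2 := by fun_prop
    have h7 : ContDiff ℝ ∞ fun w : ℝ × ℝ × ℝ => (w.1, w.2.1) := by fun_prop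
    exact (h2.add (h6.smul (h3.sub h5))).add ((contDiff_const.sub h6).smul (h7.sub h4))
  have hsub : frontier square ⊆ square :=
    (isClosed_Icc.prod isClosed_Icc).frontier_subset
  have hFb : ∀ s ∈ Icc (0 : ℝ) 1, ∀ z ∈ frontier square, F (z.1, z.2, s) = z := by
    intro s hs z hz
    simp only [hF]
    rw [(hHd s hs).boundary z hz, hd.boundary z hz, hH1 z (hsub hz), hH0 z (hsub hz),
      hd.boundary z hz]
    simp
  have h0 : (fun z : ℝ × ℝ => Γ (F (z.1, z.2, 0))) = Γ := by
    ext z; simp [hF]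
  have h1 : (fun z : ℝ × ℝ => Γ (F (z.1, z.2, 1))) = Γ ∘ h := by
    ext z; simp [hF]
  have := holonomy_eq_of_homotopy hCL hΓ hFs hFb
  rw [h0, h1] at this
  exact this.symm

end Forward

/-! ### Reparametrisations of the square and time profiles -/

section SquareDiffeomorphisms

theorem interior_square : interior square = Ioo 0 (2 * Real.pi) ×ˢ Ioo 0 (2 * Real.pi) := by
  rw [interior_prod_eq, interior_Icc]

/-- A smooth perturbation of the identity, supported in the square and a contraction, gives a
diffeomorphism of the square. -/
theorem isSquareDiffeo_add {v : ℝ × ℝ → ℝ × ℝ} (hv : ContDiff ℝ ∞ v)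
    (h0 : ∀ z ∉ interior square, v z = 0) {K : ℝ≥0} (hK : LipschitzWith K v) (hK1 : K < 1) :
    IsSquareDiffeo (fun z => z + v z) := by
  set Φ : ℝ × ℝ → ℝ × ℝ := fun z => z + v z with hΦ
  have hΦs : ContDiff ℝ ∞ Φ := contDiff_id.add hv
  have happrox : ApproximatesLinearOn Φ
      ((ContinuousLinearEquiv.refl ℝ (ℝ × ℝ) : (ℝ × ℝ) ≃L[ℝ] (ℝ × ℝ)) : (ℝ × ℝ) →L[ℝ] (ℝ × ℝ))
      univ K := by
    intro z _ w _
    have := hK.dist_le_mul z w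
    rw [dist_eq_norm, dist_eq_norm] at this
    have h1 : Φ z - Φ w - (z - w) = v z - v w := by simp only [hΦ]; abel
    change ‖Φ z - Φ w - (z - w)‖ ≤ _
    rwa [h1]
  have hsub : ‖(((ContinuousLinearEquiv.refl ℝ (ℝ × ℝ)).symm : (ℝ × ℝ) ≃L[ℝ] (ℝ × ℝ)) :
      (ℝ × ℝ) →L[ℝ] (ℝ × ℝ))‖₊ = 1 := by
    rw [ContinuousLinearEquiv.refl_symm, ContinuousLinearEquiv.coe_refl]
    exact ContinuousLinearMap.nnnorm_id
  -- a perturbation of the identity by a contraction is a homeomorphism of the plane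
  set e : (ℝ × ℝ) ≃ₜ (ℝ × ℝ) := happrox.toHomeomorph Φ (Or.inr (by rw [hsub, inv_one]; exact hK1))
    with he
  have heΦ (z) : e z = Φ z := rfl
  have hfix {z} (hz : z ∉ interior square) : Φ z = z := by
    simp only [hΦ]
    rw [h0 z hz, add_zero]
  -- a point that leaves the square is fixed from then on, against injectivity
  have hmaps : ∀ z ∈ square, Φ z ∈ square := by
    intro z hz
    by_contra hcon
    have h1 : Φ (Φ z) = Φ z := hfix fun h => hcon (interior_subset h)
    have h2 : Φ z = z := e.injective h1
    exact hcon (h2.symm ▸ hz)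
  have hmaps' : ∀ z ∈ square, e.symm z ∈ square := by
    intro z hz
    by_contra hcon
    have h1 : Φ (e.symm z) = e.symm z := hfix fun h => hcon (interior_subset h)
    rw [← heΦ, e.apply_symm_apply] at h1
    exact hcon (h1 ▸ hz)
  have hsymm : ContDiff ℝ ∞ e.symm := by
    have hd (z : ℝ × ℝ) : ∃ L : (ℝ × ℝ) ≃L[ℝ] (ℝ × ℝ), HasFDerivAt e (L : (ℝ × ℝ) →L[ℝ] (ℝ × ℝ)) z := by
      have hnorm : ‖fderiv ℝ v z‖ < 1 :=
        (norm_fderiv_le_of_lipschitz ℝ hK).trans_lt (by exact_mod_cast hK1)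
      have hnorm' : ‖-fderiv ℝ v z‖ < 1 := by rwa [norm_neg]
      refine ⟨ContinuousLinearEquiv.unitsEquiv ℝ (ℝ × ℝ) (Units.oneSub _ hnorm'), ?_⟩
      have h1 : HasFDerivAt Φ _ z :=
        (hasFDerivAt_id z).add (hv.differentiable (by simp) z).hasFDerivAt
      have h2 : ((ContinuousLinearEquiv.unitsEquiv ℝ (ℝ × ℝ) (Units.oneSub _ hnorm') :
          (ℝ × ℝ) ≃L[ℝ] (ℝ × ℝ)) : (ℝ × ℝ) →L[ℝ] (ℝ × ℝ)) =
          ContinuousLinearMap.id ℝ (ℝ × ℝ) + fderiv ℝ v z := by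
        refine ContinuousLinearMap.ext fun w => ?_
        change (1 - -fderiv ℝ v z) w = w + fderiv ℝ v z w
        rw [sub_neg_eq_add]
        rfl
      rw [h2]
      exact h1
    choose L hL using hd
    exact e.contDiff_symm hL hΦs
  exact ⟨hΦs, hmaps, ⟨e.symm, hsymm, hmaps', fun z _ => e.symm_apply_apply z,
    fun z _ => e.apply_symm_apply z⟩, fun z hz => hfix hz.2⟩

/-- Small multiples of a vector field that is supported in the square generate
reparametrisations. -/
theorem exists_isReparametrization {v : ℝ × ℝ → ℝ × ℝ} (hv : ContDiff ℝ ∞ v)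
    (h0 : ∀ z ∉ interior square, v z = 0) :
    ∃ ε₀ > (0 : ℝ), ∀ ε : ℝ, 0 ≤ ε → ε ≤ ε₀ → IsReparametrization (fun z => z + ε • v z) := by
  have hcs : HasCompactSupport v := HasCompactSupport.intro (isCompact_Icc.prod isCompact_Icc)
    fun z hz => h0 z fun h => hz (interior_subset h)
  obtain ⟨K, hK⟩ := hv.lipschitzWith_of_hasCompactSupport hcs (by simp)
  have hpos : (0 : ℝ) < K + 1 := by positivity
  have hdiff : ∀ ε : ℝ, 0 ≤ ε → ε ≤ (K + 1 : ℝ)⁻¹ → IsSquareDiffeo (fun z => z + ε • v z) := by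
    intro ε hε hε'
    have hlip : LipschitzWith (‖ε‖₊ * K) (fun z => ε • v z) := (lipschitzWith_smul ε).comp hK
    refine isSquareDiffeo_add (hv.const_smul ε) (fun z hz => by rw [h0 z hz, smul_zero]) hlip ?_
    rw [← NNReal.coe_lt_coe]
    push_cast
    rw [Real.norm_of_nonneg hε]
    calc ε * K ≤ (K + 1 : ℝ)⁻¹ * K := by gcongr
      _ < (K + 1 : ℝ)⁻¹ * (K + 1) := by gcongr; linarith
      _ = 1 := inv_mul_cancel₀ hpos.ne'
  refine ⟨(K + 1 : ℝ)⁻¹, by positivity, fun ε hε hε' => ⟨hdiff ε hε hε',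
    fun s z => z + (s * ε) • v z, ?_, fun s hs => hdiff _ (mul_nonneg hs.1 hε)
      ((mul_le_of_le_one_left hε hs.2).trans hε'), fun z _ => by simp, fun z _ => by simp⟩⟩
  have := hv.comp (f := fun q : ℝ × ℝ × ℝ => q.2) contDiff_snd
  exact contDiff_snd.add ((contDiff_fst.mul contDiff_const).smul this)

/-- A smooth function on the line with values in `[0, 1]` that separates two closed sets. -/
theorem exists_smooth_zero_one {s t : Set ℝ} (hs : IsClosed s) (ht : IsClosed t)
    (hd : Disjoint s t) :
    ∃ f : ℝ → ℝ, ContDiff ℝ ∞ f ∧ (∀ x ∈ s, f x = 0) ∧ (∀ x ∈ t, f x = 1) ∧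
      ∀ x, f x ∈ Icc (0 : ℝ) 1 := by
  obtain ⟨f, hf0, hf1, hf⟩ := exists_contMDiffMap_zero_one_of_isClosed (n := ⊤) 𝓘(ℝ, ℝ) hs ht hd
  exact ⟨f, f.contMDiff.contDiff, hf0, hf1, hf⟩

end SquareDiffeomorphisms

section TimeProfiles

/-- A smooth plateau: it rises on `[c, c + 1]` and falls on `[d, d + 1]`. -/
def plateau (c d r : ℝ) : ℝ := Real.smoothTransition (r - c) - Real.smoothTransition (r - d)

theorem contDiff_plateau (c d : ℝ) : ContDiff ℝ ∞ (plateau c d) :=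
  (Real.smoothTransition.contDiff.comp (contDiff_id.sub contDiff_const)).sub
    (Real.smoothTransition.contDiff.comp (contDiff_id.sub contDiff_const))

theorem plateau_of_le {c d r : ℝ} (hcd : c ≤ d) (h : r ≤ c) : plateau c d r = 0 := by
  rw [plateau, Real.smoothTransition.zero_of_nonpos (by linarith),
    Real.smoothTransition.zero_of_nonpos (by linarith), sub_zero]

theorem plateau_of_ge {c d r : ℝ} (hcd : c ≤ d) (h : d + 1 ≤ r) : plateau c d r = 0 := by
  rw [plateau, Real.smoothTransition.one_of_one_le (by linarith),
    Real.smoothTransition.one_of_one_le (by linarith), sub_self]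

theorem plateau_eq_one {c d r : ℝ} (h1 : c + 1 ≤ r) (h2 : r ≤ d) : plateau c d r = 1 := by
  rw [plateau, Real.smoothTransition.one_of_one_le (by linarith),
    Real.smoothTransition.zero_of_nonpos (by linarith), sub_zero]

theorem deriv_plateau {c d r : ℝ} (hcd : c + 1 ≤ d)
    (h : r < c ∨ (c + 1 < r ∧ r < d) ∨ d + 1 < r) : deriv (plateau c d) r = 0 := by
  rcases h with h | ⟨h1, h2⟩ | h
  · refine (EventuallyEq.deriv_eq (f := fun _ => (0 : ℝ)) ?_).trans (deriv_const _ _)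
    filter_upwards [Iio_mem_nhds h] with x hx using plateau_of_le (by linarith) (le_of_lt hx)
  · refine (EventuallyEq.deriv_eq (f := fun _ => (1 : ℝ)) ?_).trans (deriv_const _ _)
    filter_upwards [Ioo_mem_nhds h1 h2] with x hx using plateau_eq_one hx.1.le hx.2.le
  · refine (EventuallyEq.deriv_eq (f := fun _ => (0 : ℝ)) ?_).trans (deriv_const _ _)
    filter_upwards [Ioi_mem_nhds h] with x hx using plateau_of_ge (by linarith) (le_of_lt hx)

/-- Two time profiles `a`, `b` of loops in the parameter plane, and a shift in time of `b`. The
curve `(a, b)` switches `b` on and off while `a = 1`, that is, it runs along `(0, 0)`, `(1, 0)`,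
`(1, 1)`, `(1, 0)`, `(0, 0)`. After the shift it runs once around the unit square:
it passes `(0, 1)` before `(1, 1)`, and `(1, 0)` after it. -/
theorem exists_time_profiles {κ : ℝ → ℝ} (hκ : ∀ t, κ t ∈ Icc (0 : ℝ) 1)
    (hκ1 : ∀ t ∈ Icc (2 : ℝ) 4, κ t = 1) {ε : ℝ} (hε : 0 < ε) (hε' : ε ≤ 1 / 5) :
    ∃ a b b' : ℝ → ℝ, ∃ t₁ t₂ : ℝ, ContDiff ℝ ∞ a ∧ ContDiff ℝ ∞ b ∧ ContDiff ℝ ∞ b' ∧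
      (∀ t, b (t + ε * κ t) = b' t) ∧ 0 < t₁ ∧ t₁ < t₂ ∧ t₂ < 2 * Real.pi ∧
      (∀ t ∈ ({0, 2 * Real.pi} : Set ℝ), a t = 0 ∧ b t = 0 ∧ b' t = 0) ∧
      (∀ t, deriv a t = 0 ∨ b t = 0) ∧
      (∀ t < t₂, deriv b' t = 0 ∨ a t = 0) ∧ (∀ t, t₁ < t → deriv a t = 0 ∨ b' t = 0) ∧
      ∀ t ∈ Icc t₁ t₂, a t = 1 ∧ b' t = 1 := by
  have hpi := Real.pi_gt_three
  -- in the rescaled time `r` the delay by `ε` is a translation by `2`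
  set r : ℝ → ℝ := fun t => 2 / ε * (t - 3) with hr
  have hrs : ContDiff ℝ ∞ r := contDiff_const.mul (contDiff_id.sub contDiff_const)
  have hε10 : 10 ≤ 2 / ε := by rw [le_div_iff₀ hε]; linarith
  have hrd (t : ℝ) : HasDerivAt r (2 / ε) t := by
    simpa using ((hasDerivAt_id t).sub_const 3).const_mul (2 / ε)
  have hder (c d t : ℝ) : deriv (fun t => plateau c d (r t)) t = deriv (plateau c d) (r t) * (2 / ε) := by
    have h1 : HasDerivAt (plateau c d) (deriv (plateau c d) (r t)) (r t) :=
      ((contDiff_plateau c d).differentiable (by simp) _).hasDerivAt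
    exact (h1.comp t (hrd t)).deriv
  have hlow {t : ℝ} (ht : t ≤ 2) : r t ≤ -10 := by simp only [hr]; nlinarith
  have hhigh {t : ℝ} (ht : 4 ≤ t) : 10 ≤ r t := by simp only [hr]; nlinarith
  have hr1 {x : ℝ} : r (3 + x * ε / 2) = x := by simp only [hr]; field_simp; ring
  have hmono {s t : ℝ} (h : s < t) : r s < r t := by simp only [hr]; nlinarith
  have hmono' {s t : ℝ} (h : s ≤ t) : r s ≤ r t := by simp only [hr]; nlinarith
  refine ⟨fun t => plateau 0 6 (r t), fun t => plateau 1 4 (r t), fun t => plateau (-1) 2 (r t),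
    3 + 1 * ε / 2, 3 + 2 * ε / 2, (contDiff_plateau _ _).comp hrs, (contDiff_plateau _ _).comp hrs,
    (contDiff_plateau _ _).comp hrs, fun t => ?_, by linarith, by linarith, by linarith, ?_,
    fun t => ?_, fun t ht => ?_, fun t ht => ?_, fun t ht => ?_⟩
  · simp only
    have hκt := hκ t
    have hmul0 : 0 ≤ ε * κ t := mul_nonneg hε.le hκt.1
    have hmul1 : ε * κ t ≤ 1 / 5 := by nlinarith [hκt.1, hκt.2]
    rcases lt_or_ge t 2 with h2 | h2
    · have h3 : r (t + ε * κ t) ≤ 0 := by simp only [hr]; nlinarith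
      rw [plateau_of_le (by norm_num) (h3.trans zero_le_one),
        plateau_of_le (by norm_num) ((hlow h2.le).trans (by norm_num))]
    · rcases lt_or_ge 4 t with h4 | h4
      · rw [plateau_of_ge (by norm_num) (le_trans (by norm_num) (hhigh (by linarith))),
          plateau_of_ge (by norm_num) (le_trans (by norm_num) (hhigh h4.le))]
      · have h5 : r (t + ε * κ t) = r t + 2 := by
          rw [hκ1 t ⟨h2, h4⟩]; simp only [hr]; field_simp; ring
        rw [h5, plateau, plateau]
        ring_nf
  · intro t ht
    have h0 := hlow (t := 0) (by norm_num)
    have h1 := hhigh (t := 2 * Real.pi) (by linarith)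
    rcases ht with rfl | rfl
    · refine ⟨?_, ?_, ?_⟩ <;> exact plateau_of_le (by norm_num) (by linarith)
    · refine ⟨?_, ?_, ?_⟩ <;> exact plateau_of_ge (by norm_num) (by linarith)
  · rw [hder]
    rcases le_or_gt (r t) 1 with h | h
    · exact Or.inr (plateau_of_le (by norm_num) h)
    · rcases le_or_gt 5 (r t) with h5 | h5
      · exact Or.inr (plateau_of_ge (by norm_num) (by linarith))
      · exact Or.inl (by rw [deriv_plateau (by norm_num) (Or.inr (Or.inl ⟨by linarith, by linarith⟩)),
          zero_mul])
  · rw [hder]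
    have h2 := hmono ht
    rw [hr1] at h2
    rcases le_or_gt (r t) 0 with h | h
    · exact Or.inr (plateau_of_le (by norm_num) h)
    · exact Or.inl (by rw [deriv_plateau (by norm_num) (Or.inr (Or.inl ⟨by linarith, by linarith⟩)),
          zero_mul])
  · rw [hder]
    have h2 := hmono ht
    rw [hr1] at h2
    rcases le_or_gt 3 (r t) with h | h
    · exact Or.inr (plateau_of_ge (by norm_num) (by linarith))
    · exact Or.inl (by rw [deriv_plateau (by norm_num) (Or.inr (Or.inl ⟨by linarith, by linarith⟩)),
          zero_mul])
  · have h1 := hmono' ht.1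
    have h2 := hmono' ht.2
    rw [hr1] at h1 h2
    exact ⟨plateau_eq_one (by linarith) (by linarith), plateau_eq_one (by linarith) (by linarith)⟩

end TimeProfiles

/-! ### Variations of a curve -/

section Variations

variable {EM : Type*} [NormedAddCommGroup EM] [NormedSpace ℝ EM] [FiniteDimensional ℝ EM]
  {M : Type*} [TopologicalSpace M] [ChartedSpace EM M] [IsManifold 𝓘(ℝ, EM) ∞ M]

/-- Every tangent vector at a point of a curve is, up to scaling, the velocity of a smooth variation
of the curve. -/
theorem exists_variation {x : ℝ → M} (hx : ContMDiff 𝓘(ℝ, ℝ) 𝓘(ℝ, EM) ∞ x) (σ₁ : ℝ) (u : EM) :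
    ∃ Y : ℝ × ℝ → M, ContMDiff 𝓘(ℝ, ℝ × ℝ) 𝓘(ℝ, EM) ∞ Y ∧ (∀ σ, Y (σ, 0) = x σ) ∧
      ∃ c : ℝ, c ≠ 0 ∧ modelDeriv (fun a => Y (σ₁, a)) 0 (1 : ℝ) = c • u := by
  -- a cut-off translation by a multiple of `u` in a chart; the multiple `c` is so small that the
  -- translated curve stays in the chart
  set χ := extChartAt 𝓘(ℝ, EM) (x σ₁) with hχ
  have hsrc : x ⁻¹' χ.source ∈ 𝓝 σ₁ :=
    hx.continuous.continuousAt (extChartAt_source_mem_nhds (I := 𝓘(ℝ, EM)) (x σ₁))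
  obtain ⟨δ, hδ, hball⟩ := Metric.nhds_basis_closedBall.mem_iff.1 hsrc
  have hopen : IsOpen χ.target := isOpen_extChartAt_target (I := 𝓘(ℝ, EM)) (x σ₁)
  have hxc : ContMDiffOn 𝓘(ℝ, ℝ) 𝓘(ℝ, EM) ∞ (fun σ => χ (x σ)) (x ⁻¹' χ.source) := by
    refine ContMDiffOn.comp (g := χ) (t := χ.source) ?_ hx.contMDiffOn subset_rfl
    rw [hχ, extChartAt_source]
    exact contMDiffOn_extChartAt
  have hK : IsCompact ((fun σ => χ (x σ)) '' Metric.closedBall σ₁ δ) :=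
    (isCompact_closedBall _ _).image_of_continuousOn (hxc.continuousOn.mono hball)
  obtain ⟨r, hr, hthick⟩ := hK.exists_thickening_subset_open hopen
    (by rintro _ ⟨σ, hσ, rfl⟩; exact χ.map_source (hball hσ))
  set φ : ContDiffBump σ₁ := ⟨δ / 3, δ / 2, by linarith, by linarith⟩ with hφ
  set c : ℝ := r / (‖u‖ + 1) with hc
  have hcpos : 0 < c := by positivity
  have hcu : c * ‖u‖ < r := by
    rw [hc, div_mul_eq_mul_div, div_lt_iff₀ (by positivity)]
    nlinarith [norm_nonneg u]
  -- the sine keeps the variation bounded, so that it stays in the chart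
  set w : ℝ × ℝ → EM := fun z => χ (x z.1) + (Real.sin z.2 * φ z.1 * c) • u with hw
  have hwt {z : ℝ × ℝ} (hz : z.1 ∈ Metric.closedBall σ₁ δ) : w z ∈ χ.target := by
    refine hthick (Metric.mem_thickening_iff.2 ⟨χ (x z.1), mem_image_of_mem _ hz, ?_⟩)
    rw [hw, dist_eq_norm, add_sub_cancel_left, norm_smul, norm_mul, norm_mul,
      Real.norm_of_nonneg hcpos.le, Real.norm_of_nonneg φ.nonneg, Real.norm_eq_abs]
    have h1 := Real.abs_sin_le_one z.2
    have h2 : φ z.1 ≤ 1 := φ.le_one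
    have h3 : |Real.sin z.2| * φ z.1 ≤ 1 := by nlinarith [φ.nonneg (x := z.1), abs_nonneg (Real.sin z.2)]
    calc |Real.sin z.2| * φ z.1 * c * ‖u‖ ≤ 1 * c * ‖u‖ := by gcongr
      _ < r := by rwa [one_mul]
  have hws {z : ℝ × ℝ} (hz : z.1 ∈ Metric.ball σ₁ δ) :
      ContMDiffAt 𝓘(ℝ, ℝ × ℝ) 𝓘(ℝ, EM) ∞ (fun z => χ.symm (w z)) z := by
    have h1 : ContMDiffAt 𝓘(ℝ, ℝ) 𝓘(ℝ, EM) ∞ (fun σ => χ (x σ)) z.1 :=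
      hxc.contMDiffAt (mem_of_superset (Metric.isOpen_ball.mem_nhds hz)
        (Metric.ball_subset_closedBall.trans hball))
    have h2 : ContDiffAt ℝ ∞ w z := by
      refine (ContDiffAt.comp z (contMDiffAt_iff_contDiffAt.1 h1) contDiffAt_fst).add ?_
      refine ContDiffAt.smul ?_ contDiffAt_const
      refine ContDiffAt.mul (ContDiffAt.mul ?_ ?_) contDiffAt_const
      · exact (Real.contDiff_sin.comp contDiff_snd).contDiffAt
      · exact (φ.contDiff.comp contDiff_fst).contDiffAt
    refine ContMDiffAt.comp z (g := χ.symm) ?_ h2.contMDiffAt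
    exact (contMDiffOn_extChartAt_symm (x σ₁)).contMDiffAt
      (hopen.mem_nhds (hwt (Metric.ball_subset_closedBall hz)))
  have hw0 {z : ℝ × ℝ} (hz : z.1 ∈ Metric.ball σ₁ δ) (h : Real.sin z.2 * φ z.1 = 0) :
      χ.symm (w z) = x z.1 := by
    rw [hw]
    simp only [h, zero_mul, zero_smul, add_zero]
    exact χ.left_inv (hball (Metric.ball_subset_closedBall hz))
  classical
  set Y : ℝ × ℝ → M := fun z => if z.1 ∈ Metric.ball σ₁ δ then χ.symm (w z) else x z.1 with hY
  have hσ₁ : σ₁ ∈ Metric.ball σ₁ δ := Metric.mem_ball_self hδ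
  refine ⟨Y, fun z => ?_, fun σ => ?_, c, hcpos.ne', ?_⟩
  · by_cases hz : z.1 ∈ Metric.ball σ₁ δ
    · refine (hws hz).congr_of_eventuallyEq ?_
      filter_upwards [(Metric.isOpen_ball.preimage continuous_fst).mem_nhds hz] with z' hz'
      exact if_pos hz'
    · refine ((hx.comp contDiff_fst.contMDiff) z).congr_of_eventuallyEq ?_
      have hfar : (Metric.closedBall σ₁ (δ / 2))ᶜ ∈ 𝓝 z.1 := by
        refine Metric.isClosed_closedBall.isOpen_compl.mem_nhds fun h => hz ?_
        exact Metric.closedBall_subset_ball (by linarith) h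
      filter_upwards [continuousAt_fst hfar] with z' hz'
      have hφ0 : φ z'.1 = 0 := φ.zero_of_le_dist (by
        have : ¬ dist z'.1 σ₁ ≤ δ / 2 := hz'
        exact (not_le.1 this).le)
      by_cases hz1 : z'.1 ∈ Metric.ball σ₁ δ
      · exact (if_pos hz1).trans (hw0 hz1 (by rw [hφ0, mul_zero]))
      · exact if_neg hz1
  · by_cases hz : σ ∈ Metric.ball σ₁ δ
    · exact (if_pos hz).trans (hw0 (z := (σ, 0)) hz (by simp))
    · exact if_neg hz
  · have hYa (a : ℝ) : Y (σ₁, a) = χ.symm (w (σ₁, a)) := if_pos hσ₁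
    have hY0 : Y (σ₁, 0) = x σ₁ := (hYa 0).trans (hw0 (z := (σ₁, 0)) hσ₁ (by simp))
    have hd : MDifferentiableAt 𝓘(ℝ, ℝ) 𝓘(ℝ, EM) (fun a => Y (σ₁, a)) 0 := by
      simp only [hYa]
      exact ((hws (z := (σ₁, 0)) hσ₁).comp 0 (contDiff_prodMk_right σ₁).contMDiff.contMDiffAt).mdifferentiableAt
        (by simp)
    rw [modelDeriv_eq_fderiv_extChartAt hd, hY0]
    have h1 : (fun a => extChartAt 𝓘(ℝ, EM) (x σ₁) (Y (σ₁, a))) =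
        fun a => χ (x σ₁) + (Real.sin a * c) • u := by
      ext a
      have h2 : φ σ₁ = 1 := φ.one_of_mem_closedBall (Metric.mem_closedBall_self (by
        simp only [hφ]; linarith))
      rw [hYa, ← hχ, χ.right_inv (hwt (Metric.ball_subset_closedBall hσ₁)), hw]
      simp only [h2, mul_one]
    rw [h1]
    have h2 : HasDerivAt (fun a => χ (x σ₁) + (Real.sin a * c) • u) ((Real.cos 0 * c) • u) 0 :=
      (((Real.hasDerivAt_sin 0).mul_const c).smul_const u).const_add _
    rw [Real.cos_zero, one_mul] at h2
    rw [h2.hasFDerivAt.fderiv]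
    simp

end Variations

/-! ### Two separated variations of a loop -/

section SeparatedVariations

variable {EM EP EG : Type*}
  [NormedAddCommGroup EM] [NormedSpace ℝ EM] [FiniteDimensional ℝ EM]
  [NormedAddCommGroup EP] [NormedSpace ℝ EP] [FiniteDimensional ℝ EP]
  [NormedAddCommGroup EG] [NormedSpace ℝ EG] [FiniteDimensional ℝ EG]
  {M P G : Type*}
  [TopologicalSpace M] [ChartedSpace EM M] [IsManifold 𝓘(ℝ, EM) ∞ M]
  [TopologicalSpace P] [ChartedSpace EP P] [IsManifold 𝓘(ℝ, EP) ∞ P] [T2Space P]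
  [TopologicalSpace G] [ChartedSpace EG G] [Group G] [LieGroup 𝓘(ℝ, EG) ∞ G] [T2Space G]
  {Q : PrincipalBundle EM EP EG M P G} {A : Connection Q} {B : AdjointTwoForm Q} {p₀ : P}

/-- Two variations `Z₁`, `Z₂` of the same loop, the first of which changes it only before the
parameter `m₁` and the second only between `m₂` and `m₃`, with `m₁ < m < m₂`, together with their
families `q₁`, `q₂` of horizontal lifts and the group elements `k` that relate these lifts between
`m₁` and `m₂`. -/
structure SeparatedVariations (A : Connection Q) (p₀ : P) (m₁ m m₂ m₃ : ℝ) (Z₁ Z₂ : ℝ × ℝ → M)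
    (q₁ q₂ : ℝ × ℝ → P) (k : ℝ → G) : Prop where
  pos : 0 < m₁
  lt_left : m₁ < m
  lt_right : m < m₂
  lt_end : m₂ < m₃
  end_lt : m₃ < 2 * Real.pi
  smooth₁ : ContMDiff 𝓘(ℝ, ℝ × ℝ) 𝓘(ℝ, EM) ∞ Z₁
  smooth₂ : ContMDiff 𝓘(ℝ, ℝ × ℝ) 𝓘(ℝ, EM) ∞ Z₂
  same : ∀ σ, Z₁ (σ, 0) = Z₂ (σ, 0)
  const₁ : ∀ σ a, m₁ < σ → Z₁ (σ, a) = Z₁ (σ, 0)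
  const₂ : ∀ σ b, σ < m₂ → Z₂ (σ, b) = Z₂ (σ, 0)
  const_end : ∀ σ b, m₃ < σ → Z₂ (σ, b) = Z₂ (σ, 0)
  start : ∀ a, Z₁ (0, a) = Q.proj p₀
  finish : Z₂ (2 * Real.pi, 0) = Q.proj p₀
  lift₁ : ContMDiff 𝓘(ℝ, ℝ × ℝ) 𝓘(ℝ, EP) ∞ q₁
  lift₂ : ContMDiff 𝓘(ℝ, ℝ × ℝ) 𝓘(ℝ, EP) ∞ q₂
  proj₁ : ∀ z, Q.proj (q₁ z) = Z₁ z
  proj₂ : ∀ z, Q.proj (q₂ z) = Z₂ z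
  start₁ : ∀ a, q₁ (0, a) = p₀
  hor₁ : ∀ z, A.pullForm q₁ z (1, 0) = 0
  hor₂ : ∀ z, A.pullForm q₂ z (1, 0) = 0
  smooth_k : ContMDiff 𝓘(ℝ, ℝ) 𝓘(ℝ, EG) ∞ k
  k_zero : k 0 = 1
  act_k : ∀ σ ∈ Ioo m₁ m₂, ∀ a b, Q.act (q₂ (σ, b)) (k a) = q₁ (σ, a)
  same_lift : ∀ σ, q₁ (σ, 0) = q₂ (σ, 0)

theorem isHorizontalAt_act_slice {X : ℝ × ℝ → M} {q : ℝ × ℝ → P}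
    (hq : ContMDiff 𝓘(ℝ, ℝ × ℝ) 𝓘(ℝ, EP) ∞ q) (hproj : ∀ z, Q.proj (q z) = X z)
    (hhor : ∀ z, A.pullForm q z (1, 0) = 0) (g : G) (l t : ℝ) :
    IsHorizontalAt A (fun σ => X (σ, l)) (fun σ => Q.act (q (σ, l)) g) t :=
  isHorizontalAt_slice (hq.mdifferentiable (by simp) _) (Eventually.of_forall hproj) (hhor _) g

theorem IsHorizontalAt.congr_base {x x' : ℝ → M} {p : ℝ → P} {t : ℝ}
    (h : IsHorizontalAt A x p t) (he : x =ᶠ[𝓝 t] x') : IsHorizontalAt A x' p t :=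
  ⟨by filter_upwards [h.1, he] with s hs hes; rw [hs, hes], h.2⟩

/-- Separated variations of a loop have lifts. -/
theorem exists_separatedVariations (A : Connection Q) {m₁ m m₂ m₃ : ℝ} {Z₁ Z₂ : ℝ × ℝ → M}
    (pos : 0 < m₁) (lt_left : m₁ < m) (lt_right : m < m₂) (lt_end : m₂ < m₃)
    (end_lt : m₃ < 2 * Real.pi)
    (smooth₁ : ContMDiff 𝓘(ℝ, ℝ × ℝ) 𝓘(ℝ, EM) ∞ Z₁)
    (smooth₂ : ContMDiff 𝓘(ℝ, ℝ × ℝ) 𝓘(ℝ, EM) ∞ Z₂)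
    (same : ∀ σ, Z₁ (σ, 0) = Z₂ (σ, 0))
    (const₁ : ∀ σ a, m₁ < σ → Z₁ (σ, a) = Z₁ (σ, 0))
    (const₂ : ∀ σ b, σ < m₂ → Z₂ (σ, b) = Z₂ (σ, 0))
    (const_end : ∀ σ b, m₃ < σ → Z₂ (σ, b) = Z₂ (σ, 0))
    (start : ∀ a, Z₁ (0, a) = Q.proj p₀)
    (finish : Z₂ (2 * Real.pi, 0) = Q.proj p₀) :
    ∃ (q₁ q₂ : ℝ × ℝ → P) (k : ℝ → G), SeparatedVariations A p₀ m₁ m m₂ m₃ Z₁ Z₂ q₁ q₂ k := by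
  have h0m₂ : (0 : ℝ) < m₂ := by linarith
  obtain ⟨q₁, lift₁, proj₁, start₁, hor₁⟩ := exists_horizontal_family A smooth₁
    (q₀ := fun _ => p₀) contMDiff_const (fun a => (start a).symm)
  obtain ⟨q₂, lift₂, proj₂, start₂, hor₂⟩ := exists_horizontal_family A smooth₂
    (q₀ := fun _ => p₀) contMDiff_const
    (fun a => by rw [const₂ _ _ h0m₂, ← same, start])
  have hm : m ∈ Ioo m₁ m₂ := ⟨lt_left, lt_right⟩
  have h₁ (g : G) (a t : ℝ) := isHorizontalAt_act_slice lift₁ proj₁ hor₁ g a t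
  have h₂ (g : G) (a t : ℝ) := isHorizontalAt_act_slice lift₂ proj₂ hor₂ g a t
  have hx₁ (a : ℝ) {t : ℝ} (ht : m₁ < t) : (fun σ => Z₁ (σ, a)) =ᶠ[𝓝 t] fun σ => Z₂ (σ, 0) := by
    filter_upwards [Ioi_mem_nhds ht] with σ hσ
    rw [const₁ _ _ hσ, same]
  have hx₂ (b : ℝ) {t : ℝ} (ht : t < m₂) : (fun σ => Z₂ (σ, b)) =ᶠ[𝓝 t] fun σ => Z₂ (σ, 0) := by
    filter_upwards [Iio_mem_nhds ht] with σ hσ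
    rw [const₂ _ _ hσ]
  have same_lift : ∀ σ, q₁ (σ, 0) = q₂ (σ, 0) := by
    intro σ
    have h := IsHorizontalAt.eqOn (A := A) (a := -|σ| - 1) (b := |σ| + 1) (t₁ := 0)
      (x := fun σ => Z₂ (σ, 0)) (p := fun σ => Q.act (q₁ (σ, 0)) 1)
      (p' := fun σ => Q.act (q₂ (σ, 0)) 1) ⟨by linarith [abs_nonneg σ], by linarith [abs_nonneg σ]⟩
      (by simp only [start₁, start₂])
      (fun t _ => (h₁ 1 0 t).congr_base (Eventually.of_forall same)) (fun t _ => h₂ 1 0 t)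
    have h' := h (x := σ) ⟨by linarith [neg_abs_le σ], by linarith [le_abs_self σ]⟩
    simpa only [Q.act_one] using h'
  -- the second variation does not change the loop before `m₂`
  have hq₂ (b : ℝ) : q₂ (m, b) = q₂ (m, 0) := by
    have h := IsHorizontalAt.eqOn (A := A) (a := -1) (b := m₂) (t₁ := 0)
      (x := fun σ => Z₂ (σ, 0)) (p := fun σ => Q.act (q₂ (σ, b)) 1)
      (p' := fun σ => Q.act (q₂ (σ, 0)) 1) ⟨by norm_num, h0m₂⟩
      (by simp only [start₂])
      (fun t ht => (h₂ 1 b t).congr_base (hx₂ b ht.2)) (fun t _ => h₂ 1 0 t)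
    have h' := h (x := m) ⟨by linarith, lt_right⟩
    simpa only [Q.act_one] using h'
  have hk : ∀ a, ∃ k, Q.act (q₂ (m, 0)) k = q₁ (m, a) := fun a =>
    Q.exists_act_eq (by rw [proj₁, proj₂, const₁ _ _ lt_left, same])
  choose k hk using hk
  refine ⟨q₁, q₂, k, pos, lt_left, lt_right, lt_end, end_lt, smooth₁, smooth₂, same, const₁, const₂,
    const_end, start, finish, lift₁, lift₂, proj₁, proj₂, start₁, hor₁, hor₂, fun a => ?_,
    Q.act_injective ((hk 0).trans (by rw [Q.act_one, same_lift])), fun σ hσ a b => ?_, same_lift⟩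
  · exact Q.contMDiffAt_division (q := fun _ => q₂ (m, 0)) (q' := fun a => q₁ (m, a))
      contMDiffAt_const ((lift₁.comp (contDiff_prodMk_right m).contMDiff) a)
      (Eventually.of_forall hk)
  · have h := IsHorizontalAt.eqOn (A := A) (a := m₁) (b := m₂) (t₁ := m)
      (x := fun σ => Z₂ (σ, 0)) (p := fun σ => Q.act (q₂ (σ, b)) (k a))
      (p' := fun σ => Q.act (q₁ (σ, a)) 1) hm (by simp only [hq₂, hk, Q.act_one])
      (fun t ht => (h₂ (k a) b t).congr_base (hx₂ b ht.2))
      (fun t ht => (h₁ 1 a t).congr_base (hx₁ a ht.1))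
    have h' := h hσ
    simpa only [Q.act_one] using h'

/-- The family of loops that two separated variations define: at the time `τ` the first variation has
reached the parameter `a τ` and the second the parameter `b τ`. -/
def glue (m : ℝ) (Z₁ Z₂ : ℝ × ℝ → M) (a b : ℝ → ℝ) (z : ℝ × ℝ) : M :=
  open scoped Classical in if z.1 < m then Z₁ (z.1, a z.2) else Z₂ (z.1, b z.2)

namespace SeparatedVariations

variable {m₁ m m₂ m₃ : ℝ} {Z₁ Z₂ : ℝ × ℝ → M} {q₁ q₂ : ℝ × ℝ → P} {k : ℝ → G}
  (S : SeparatedVariations A p₀ m₁ m m₂ m₃ Z₁ Z₂ q₁ q₂ k)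
include S

theorem glue_left (a b : ℝ → ℝ) {σ : ℝ} (hσ : σ < m₂) (τ : ℝ) :
    glue m Z₁ Z₂ a b (σ, τ) = Z₁ (σ, a τ) := by
  by_cases h : σ < m
  · exact if_pos h
  · have h1 : m₁ < σ := S.lt_left.trans_le (not_lt.1 h)
    exact (if_neg h).trans (by rw [S.const₁ _ _ h1, S.const₂ _ _ hσ, S.same])

theorem glue_right (a b : ℝ → ℝ) {σ : ℝ} (hσ : m₁ < σ) (τ : ℝ) :
    glue m Z₁ Z₂ a b (σ, τ) = Z₂ (σ, b τ) := by
  by_cases h : σ < m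
  · have h1 : σ < m₂ := h.trans S.lt_right
    exact (if_pos h).trans (by rw [S.const₁ _ _ hσ, S.const₂ _ _ h1, S.same])
  · exact if_neg h

theorem isLoopOfLoops {a b : ℝ → ℝ} (ha : ContDiff ℝ ∞ a) (hb : ContDiff ℝ ∞ b)
    (hab : ∀ t ∈ ({0, 2 * Real.pi} : Set ℝ), a t = 0 ∧ b t = 0) :
    IsLoopOfLoops EM (Q.proj p₀) (glue m Z₁ Z₂ a b) := by
  have h0 : (0 : ℝ) < m₂ := by linarith [S.pos, S.lt_left, S.lt_right]
  have h1 : m₁ < 2 * Real.pi := by linarith [S.lt_left, S.lt_right, S.lt_end, S.end_lt]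
  obtain ⟨ha0, hb0⟩ := hab 0 (by simp)
  obtain ⟨ha1, hb1⟩ := hab (2 * Real.pi) (by simp)
  refine ⟨fun z => ?_, fun τ _ => ?_, fun τ _ => ?_, fun σ _ => ?_⟩
  · by_cases hz : z.1 < m
    · have h2 : ContMDiff 𝓘(ℝ, ℝ × ℝ) 𝓘(ℝ, EM) ∞ fun z : ℝ × ℝ => Z₁ (z.1, a z.2) :=
        S.smooth₁.comp (contDiff_fst.prodMk (ha.comp contDiff_snd)).contMDiff
      refine (h2 z).congr_of_eventuallyEq ?_
      filter_upwards [(isOpen_Iio.preimage continuous_fst).mem_nhds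
        (show z.1 ∈ Iio m from hz)] with w hw
      exact S.glue_left a b (lt_trans hw S.lt_right) w.2
    · have h2 : ContMDiff 𝓘(ℝ, ℝ × ℝ) 𝓘(ℝ, EM) ∞ fun z : ℝ × ℝ => Z₂ (z.1, b z.2) :=
        S.smooth₂.comp (contDiff_fst.prodMk (hb.comp contDiff_snd)).contMDiff
      refine (h2 z).congr_of_eventuallyEq ?_
      filter_upwards [(isOpen_Ioi.preimage continuous_fst).mem_nhds
        (show z.1 ∈ Ioi m₁ from S.lt_left.trans_le (not_lt.1 hz))] with w hw
      exact S.glue_right a b hw w.2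
  · rw [S.glue_left a b h0, S.start]
  · rw [S.glue_right a b h1, S.const_end _ _ S.end_lt, S.finish]
  · by_cases hσ : σ < m₂
    · rw [S.glue_left a b hσ, S.glue_left a b hσ, ha0, ha1]
    · have h2 : m₁ < σ := (S.lt_left.trans S.lt_right).trans_le (not_lt.1 hσ)
      rw [S.glue_right a b h2, S.glue_right a b h2, hb0, hb1]

theorem isHorizontalAt_glue (a b : ℝ → ℝ) (τ t : ℝ) :
    IsHorizontalAt A (fun σ => glue m Z₁ Z₂ a b (σ, τ))
      (fun σ => open scoped Classical in
        if σ < m then q₁ (σ, a τ) else Q.act (q₂ (σ, b τ)) (k (a τ))) t := by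
  rcases lt_or_ge t m with h | h
  · have h1 := isHorizontalAt_act_slice S.lift₁ S.proj₁ S.hor₁ 1 (a τ) t
    simp only [Q.act_one] at h1
    refine (h1.congr_base ?_).congr ?_
    · filter_upwards [Iio_mem_nhds h] with σ hσ
      exact (S.glue_left a b (lt_trans hσ S.lt_right) τ).symm
    · filter_upwards [Iio_mem_nhds h] with σ hσ
      exact (if_pos hσ).symm
  · have h' := S.lt_left.trans_le h
    refine ((isHorizontalAt_act_slice S.lift₂ S.proj₂ S.hor₂ (k (a τ)) (b τ) t).congr_base
      ?_).congr ?_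
    · filter_upwards [Ioi_mem_nhds h'] with σ hσ
      exact (S.glue_right a b hσ τ).symm
    · filter_upwards [Ioi_mem_nhds h'] with σ hσ
      by_cases hm : σ < m
      · exact (S.act_k σ ⟨hσ, hm.trans S.lt_right⟩ _ _).trans (if_pos hm).symm
      · exact (if_neg hm).symm

end SeparatedVariations

/-- The velocities of a two-parameter map along its first parameter, and along a time profile of
its second parameter. -/
theorem modelDeriv_slices {X : ℝ × ℝ → M} {q : ℝ × ℝ → P}
    (hq : ContMDiff 𝓘(ℝ, ℝ × ℝ) 𝓘(ℝ, EP) ∞ q) (hproj : ∀ z, Q.proj (q z) = X z) {a : ℝ → ℝ}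
    {τ : ℝ} (ha : DifferentiableAt ℝ a τ) (σ : ℝ) :
    modelDeriv (fun s => X (s, a τ)) σ (1 : ℝ) = Q.baseDeriv q (σ, a τ) (1, 0) ∧
      modelDeriv (fun t => X (σ, a t)) τ (1 : ℝ) = deriv a τ • Q.baseDeriv q (σ, a τ) (0, 1) := by
  obtain rfl : X = fun z => Q.proj (q z) := (funext hproj).symm
  have hΓ : MDifferentiableAt 𝓘(ℝ, ℝ × ℝ) 𝓘(ℝ, EM) (fun z => Q.proj (q z)) (σ, a τ) :=
    (Q.contMDiff_proj.comp hq).mdifferentiable (by simp) _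
  have h1 := modelDeriv_comp (g := fun z => Q.proj (q z)) (f := fun s : ℝ => (s, a τ)) hΓ
    (hasFDerivAt_prodMk_left σ (a τ)).differentiableAt.mdifferentiableAt
  have h3 : HasDerivAt (fun t : ℝ => (σ, a t)) (0, deriv a τ) τ :=
    (hasDerivAt_const τ σ).prodMk ha.hasDerivAt
  have h2 := modelDeriv_comp (g := fun z => Q.proj (q z)) (f := fun t : ℝ => (σ, a t)) hΓ
    h3.differentiableAt.mdifferentiableAt
  rw [modelDeriv_eq_fderiv, (hasFDerivAt_prodMk_left σ (a τ)).fderiv] at h1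
  rw [modelDeriv_eq_fderiv, h3.hasFDerivAt.fderiv] at h2
  rw [h1, h2]
  refine ⟨rfl, ?_⟩
  rw [← map_smul, PrincipalBundle.baseDeriv]
  refine congrArg (modelDeriv (fun z => Q.proj (q z)) (σ, a τ)) ?_
  simp

/-- The contribution of the parameters between `s` and `t` to the loop space connection, on a family
of curves with horizontal lifts `q (·, a)`, in the direction of the parameter `a`. -/
def loopForm (B : AdjointTwoForm Q) (q : ℝ × ℝ → P) (s t : ℝ) (a : ℝ) : EG :=
  ∫ σ in s..t, B.pull q (σ, a) (1, 0) (0, 1)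

theorem contDiff_loopForm (B : AdjointTwoForm Q) {q : ℝ × ℝ → P}
    (hq : ContMDiff 𝓘(ℝ, ℝ × ℝ) 𝓘(ℝ, EP) ∞ q) (s t : ℝ) : ContDiff ℝ ∞ (loopForm B q s t) :=
  contDiff_parametric_integral (n := ⊤) (F := fun z : ℝ × ℝ => B.pull q z (1, 0) (0, 1))
    (B.contDiff_pull hq _ _) _ _

namespace SeparatedVariations

variable {m₁ m m₂ m₃ : ℝ} {Z₁ Z₂ : ℝ × ℝ → M} {q₁ q₂ : ℝ × ℝ → P} {k : ℝ → G}
  (S : SeparatedVariations A p₀ m₁ m m₂ m₃ Z₁ Z₂ q₁ q₂ k)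
include S

/-- The loop space connection along the glued family is the sum of the contributions of the two
variations; the second is seen from the base point through the lift of the first, hence through
`k`. -/
theorem toModel_loopConnectionAt {a b : ℝ → ℝ} {τ : ℝ} (ha : DifferentiableAt ℝ a τ)
    (hb : DifferentiableAt ℝ b τ) :
    toModel (loopConnectionAt A B p₀ (glue m Z₁ Z₂ a b) τ) =
      deriv a τ • loopForm B q₁ 0 m (a τ) +
        deriv b τ • AdL (k (a τ))⁻¹ (loopForm B q₂ m (2 * Real.pi) (b τ)) := by
  have : CompleteSpace EG := FiniteDimensional.complete ℝ EG
  have hm0 : 0 < m := S.pos.trans S.lt_left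
  have hm1 : m < 2 * Real.pi := by linarith [S.lt_right, S.lt_end, S.end_lt]
  have hcont {q : ℝ × ℝ → P} (hq : ContMDiff 𝓘(ℝ, ℝ × ℝ) 𝓘(ℝ, EP) ∞ q) (l : ℝ) :
      Continuous fun σ : ℝ => B.pull q (σ, l) (1, 0) (0, 1) :=
    (B.contDiff_pull hq _ _).continuous.comp (by fun_prop)
  refine (LoopSpace.toModel_loopConnectionAt (A := A) (B := B) (p₀ := p₀) (Γ := glue m Z₁ Z₂ a b)
    (τ := τ) ((if_pos hm0).trans (S.start₁ _)) (S.isHorizontalAt_glue a b τ)).trans ?_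
  set f : ℝ → EG := fun σ => B.bilin (open scoped Classical in
        if σ < m then q₁ (σ, a τ) else Q.act (q₂ (σ, b τ)) (k (a τ)))
      (modelDeriv (fun s => glue m Z₁ Z₂ a b (s, τ)) σ (1 : ℝ))
      (modelDeriv (fun t => glue m Z₁ Z₂ a b (σ, t)) τ (1 : ℝ)) with hf
  have hleft : ∀ σ < m₂, f σ = deriv a τ • B.pull q₁ (σ, a τ) (1, 0) (0, 1) := by
    intro σ hσ
    have h1 : (fun s => glue m Z₁ Z₂ a b (s, τ)) =ᶠ[𝓝 σ] fun s => Z₁ (s, a τ) := by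
      filter_upwards [Iio_mem_nhds hσ] with s hs using S.glue_left a b hs τ
    have h2 : (fun t => glue m Z₁ Z₂ a b (σ, t)) = fun t => Z₁ (σ, a t) :=
      funext fun t => S.glue_left a b hσ t
    have h3 : (open scoped Classical in
        if σ < m then q₁ (σ, a τ) else Q.act (q₂ (σ, b τ)) (k (a τ))) = q₁ (σ, a τ) := by
      by_cases h : σ < m
      · exact if_pos h
      · exact (if_neg h).trans (S.act_k σ ⟨S.lt_left.trans_le (not_lt.1 h), hσ⟩ _ _)
    obtain ⟨h4, h5⟩ := modelDeriv_slices S.lift₁ S.proj₁ ha σ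
    simp only [hf]
    rw [h3, modelDeriv_congr h1, h2, h4, h5, map_smul, AdjointTwoForm.pull]
  have hright : ∀ σ ≥ m, f σ =
      deriv b τ • AdL (k (a τ))⁻¹ (B.pull q₂ (σ, b τ) (1, 0) (0, 1)) := by
    intro σ hσ
    have hσ' := S.lt_left.trans_le hσ
    have h1 : (fun s => glue m Z₁ Z₂ a b (s, τ)) =ᶠ[𝓝 σ] fun s => Z₂ (s, b τ) := by
      filter_upwards [Ioi_mem_nhds hσ'] with s hs using S.glue_right a b hs τ
    have h2 : (fun t => glue m Z₁ Z₂ a b (σ, t)) = fun t => Z₂ (σ, b t) :=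
      funext fun t => S.glue_right a b hσ' t
    obtain ⟨h4, h5⟩ := modelDeriv_slices S.lift₂ S.proj₂ hb σ
    simp only [hf]
    rw [if_neg (not_lt.2 hσ), modelDeriv_congr h1, h2, h4, h5, map_smul, B.bilin_act,
      AdjointTwoForm.pull]
  have hl : EqOn f (fun σ => deriv a τ • B.pull q₁ (σ, a τ) (1, 0) (0, 1)) (uIcc 0 m) := by
    intro σ hσ
    rw [uIcc_of_le hm0.le] at hσ
    exact hleft σ (hσ.2.trans_lt S.lt_right)
  have hr : EqOn f (fun σ => deriv b τ • AdL (k (a τ))⁻¹ (B.pull q₂ (σ, b τ) (1, 0) (0, 1)))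
      (uIcc m (2 * Real.pi)) := by
    intro σ hσ
    rw [uIcc_of_le hm1.le] at hσ
    exact hright σ hσ.1
  have hcl := (hcont S.lift₁ (a τ)).const_smul (deriv a τ)
  have hcr := ((AdL (k (a τ))⁻¹).continuous.comp (hcont S.lift₂ (b τ))).const_smul (deriv b τ)
  rw [← intervalIntegral.integral_add_adjacent_intervals
    (a := 0) (b := m) (c := 2 * Real.pi)
    ((hcl.intervalIntegrable _ _).congr (hl.symm.mono uIoc_subset_uIcc))
    ((hcr.intervalIntegrable _ _).congr (hr.symm.mono uIoc_subset_uIcc)),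
    intervalIntegral.integral_congr hl, intervalIntegral.integral_congr hr,
    intervalIntegral.integral_smul, intervalIntegral.integral_smul, loopForm, loopForm,
    ContinuousLinearMap.intervalIntegral_comp_comm]
  exact (hcont S.lift₂ (b τ)).intervalIntegrable _ _

end SeparatedVariations
end SeparatedVariations

/-! ### The holonomy along two separated variations -/

section LogDerivCurves

variable {EG : Type*} [NormedAddCommGroup EG] [NormedSpace ℝ EG]
  {G : Type*} [TopologicalSpace G] [ChartedSpace EG G] [Group G] [LieGroup 𝓘(ℝ, EG) ∞ G]
  {g h : ℝ → G} {ξ η : EG} {t : ℝ}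

theorem HasLogDerivAt.comp_curve {a : ℝ → ℝ} {a' : ℝ}
    (hg : HasLogDerivAt g (spanL ξ) (a t)) (ha : HasDerivAt a a' t) :
    HasLogDerivAt (fun s => g (a s)) (spanL (a' • ξ)) t := by
  have h1 : HasLogDerivAt (fun s => g (a s)) _ t :=
    HasLogDerivWithinAt.comp (g := g) (f := a) hg ha.hasFDerivAt.hasFDerivWithinAt (mapsTo_univ _ _)
  convert h1 using 1
  ext
  simp

theorem HasLogDerivAt.mul_curve (hg : HasLogDerivAt g (spanL ξ) t)
    (hh : HasLogDerivAt h (spanL η) t) :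
    HasLogDerivAt (fun s => g s * h s) (spanL (ξ + AdL (g t) η)) t := by
  have h1 : HasLogDerivAt (fun s => g s * h s) _ t := HasLogDerivWithinAt.mul hg hh
  convert h1 using 1
  ext
  simp

theorem HasLogDerivAt.inv_curve (hg : HasLogDerivAt g (spanL ξ) t) :
    HasLogDerivAt (fun s => (g s)⁻¹) (spanL (-AdL (g t)⁻¹ ξ)) t := by
  have h1 : HasLogDerivAt (fun s => (g s)⁻¹) _ t := HasLogDerivWithinAt.inv hg
  convert h1 using 1
  ext
  simp

theorem exists_hasLogDerivAt_spanL (hg : ContMDiff 𝓘(ℝ, ℝ) 𝓘(ℝ, EG) ∞ g) (t : ℝ) :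
    ∃ ξ : EG, HasLogDerivAt g (spanL ξ) t := by
  have h1 : HasLogDerivAt g _ t := LoopSpace.ContMDiff.hasLogDerivAt hg t
  refine ⟨logDeriv (EG := EG) g t (1 : ℝ), ?_⟩
  convert h1 using 1
  ext
  simp

variable {k U V : ℝ → G} {κ u v : EG} {a b : ℝ → ℝ} {a' b' τ : ℝ}

/-- A transport along a pair `(a, b)` of profiles one of which is at rest while the other moves. -/
theorem hasLogDerivAt_mul_of_rest (hU0 : U 0 = 1) (hk0 : k 0 = 1)
    (hU : HasLogDerivAt U (spanL (-u)) (a τ)) (hV : HasLogDerivAt V (spanL (-v)) (b τ))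
    (ha : HasDerivAt a a' τ) (hb : HasDerivAt b b' τ) (h : b' = 0 ∨ a τ = 0) :
    HasLogDerivAt (fun t => U (a t) * V (b t)) (spanL (-(a' • u + b' • AdL (k (a τ))⁻¹ v))) τ := by
  have h1 := (hU.comp_curve ha).mul_curve (hV.comp_curve hb)
  convert h1 using 2
  rcases h with h | h
  · simp [h]
  · simp [h, hU0, hk0, AdL_one, add_comm]

/-- The transport along a pair `(a, b)` of profiles in the opposite order, for which `V` has to be
conjugated by `k`. -/
theorem hasLogDerivAt_conj_mul_of_rest (hV0 : V 0 = 1)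
    (hk : HasLogDerivAt k (spanL κ) (a τ))
    (hU : HasLogDerivAt U (spanL (-u)) (a τ)) (hV : HasLogDerivAt V (spanL (-v)) (b τ))
    (ha : HasDerivAt a a' τ) (hb : HasDerivAt b b' τ) (h : a' = 0 ∨ b τ = 0) :
    HasLogDerivAt (fun t => (k (a t))⁻¹ * (V (b t) * (k (a t) * U (a t))))
      (spanL (-(a' • u + b' • AdL (k (a τ))⁻¹ v))) τ := by
  have hk' := hk.comp_curve ha
  have h1 := hk'.inv_curve.mul_curve
    ((hV.comp_curve hb).mul_curve (hk'.mul_curve (hU.comp_curve ha)))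
  convert h1 using 2
  rcases h with h | h
  · simp [h]
  · simp only [h, hV0, AdL_one, map_add, map_smul, map_neg, smul_neg,
      ContinuousLinearMap.id_apply, AdL_inv_apply]
    module

end LogDerivCurves

section Holonomies

variable {EM EP EG : Type*}
  [NormedAddCommGroup EM] [NormedSpace ℝ EM] [FiniteDimensional ℝ EM]
  [NormedAddCommGroup EP] [NormedSpace ℝ EP] [FiniteDimensional ℝ EP]
  [NormedAddCommGroup EG] [NormedSpace ℝ EG] [FiniteDimensional ℝ EG]
  {M P G : Type*}
  [TopologicalSpace M] [ChartedSpace EM M] [IsManifold 𝓘(ℝ, EM) ∞ M]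
  [TopologicalSpace P] [ChartedSpace EP P] [IsManifold 𝓘(ℝ, EP) ∞ P] [T2Space P]
  [TopologicalSpace G] [ChartedSpace EG G] [Group G] [LieGroup 𝓘(ℝ, EG) ∞ G] [T2Space G]
  {Q : PrincipalBundle EM EP EG M P G} {A : Connection Q} {B : AdjointTwoForm Q} {p₀ : P}

namespace SeparatedVariations

variable {m₁ m m₂ m₃ : ℝ} {Z₁ Z₂ : ℝ × ℝ → M} {q₁ q₂ : ℝ × ℝ → P} {k : ℝ → G}
  (S : SeparatedVariations A p₀ m₁ m m₂ m₃ Z₁ Z₂ q₁ q₂ k)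
include S

/-- Nothing is enclosed by the profiles, and the holonomy is trivial, if the second one is at zero
while the first one moves. -/
theorem holonomy_glue_of_rest {U V : ℝ → G} (hU0 : U 0 = 1) (hV0 : V 0 = 1)
    (hU : ∀ a, HasLogDerivAt U (spanL (-loopForm B q₁ 0 m a)) a)
    (hV : ∀ b, HasLogDerivAt V (spanL (-loopForm B q₂ m (2 * Real.pi) b)) b)
    {a b : ℝ → ℝ} (ha : ContDiff ℝ ∞ a) (hb : ContDiff ℝ ∞ b)
    (hab : ∀ t ∈ ({0, 2 * Real.pi} : Set ℝ), a t = 0 ∧ b t = 0)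
    (h : ∀ t, deriv a t = 0 ∨ b t = 0) : holonomy A B p₀ (glue m Z₁ Z₂ a b) = 1 := by
  obtain ⟨ha0, hb0⟩ := hab 0 (by simp)
  obtain ⟨ha1, hb1⟩ := hab (2 * Real.pi) (by simp)
  have had := ha.differentiable (by simp)
  have hbd := hb.differentiable (by simp)
  refine (holonomy_eq (A := A) (B := B) (p₀ := p₀) (Γ := glue m Z₁ Z₂ a b)
    (W := fun t => (k (a t))⁻¹ * (V (b t) * (k (a t) * U (a t))))
    (fun τ _ => S.toModel_loopConnectionAt (had τ) (hbd τ)) ?_ (fun τ _ => ?_)).trans ?_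
  · simp [ha0, hb0, hU0, hV0, S.k_zero]
  · obtain ⟨κ, hκ⟩ := exists_hasLogDerivAt_spanL S.smooth_k (a τ)
    exact (hasLogDerivAt_conj_mul_of_rest hV0 hκ (hU _) (hV _) (had τ).hasDerivAt
      (hbd τ).hasDerivAt (h τ)).mono (subset_univ _)
  · simp [ha1, hb1, hU0, hV0, S.k_zero]

/-- The holonomy along profiles that run once around the rectangle with sides `α` and `β`. -/
theorem holonomy_glue_of_rectangle {U V : ℝ → G} (hU0 : U 0 = 1) (hV0 : V 0 = 1)
    (hU : ∀ a, HasLogDerivAt U (spanL (-loopForm B q₁ 0 m a)) a)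
    (hV : ∀ b, HasLogDerivAt V (spanL (-loopForm B q₂ m (2 * Real.pi) b)) b)
    {a b : ℝ → ℝ} (ha : ContDiff ℝ ∞ a) (hb : ContDiff ℝ ∞ b)
    (hab : ∀ t ∈ ({0, 2 * Real.pi} : Set ℝ), a t = 0 ∧ b t = 0)
    {t₁ t₂ α β : ℝ} (h0 : 0 < t₁) (h12 : t₁ < t₂) (h2 : t₂ < 2 * Real.pi)
    (hleft : ∀ t < t₂, deriv b t = 0 ∨ a t = 0) (hright : ∀ t, t₁ < t → deriv a t = 0 ∨ b t = 0)
    (hmid : ∀ t ∈ Icc t₁ t₂, a t = α ∧ b t = β) :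
    holonomy A B p₀ (glue m Z₁ Z₂ a b) =
      ((k α)⁻¹ * (V β * (k α * U α)))⁻¹ * (U α * V β) := by
  classical
  obtain ⟨ha0, hb0⟩ := hab 0 (by simp)
  obtain ⟨ha1, hb1⟩ := hab (2 * Real.pi) (by simp)
  have had := ha.differentiable (by simp)
  have hbd := hb.differentiable (by simp)
  set c : G := ((k α)⁻¹ * (V β * (k α * U α)))⁻¹ * (U α * V β) with hc
  -- `W₁` is the transport while one side of the rectangle is run through, `W₂` on the other side;
  -- `c` makes them agree at the corner `(α, β)`
  set W₁ : ℝ → G := fun t => U (a t) * V (b t) with hW₁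
  set W₂ : ℝ → G := fun t => (k (a t))⁻¹ * (V (b t) * (k (a t) * U (a t))) * c with hW₂
  have hagree : ∀ t ∈ Icc t₁ t₂, W₁ t = W₂ t := by
    intro t ht
    obtain ⟨h3, h4⟩ := hmid t ht
    simp only [hW₁, hW₂, h3, h4, hc, mul_inv_cancel_left]
  refine (holonomy_eq (A := A) (B := B) (p₀ := p₀) (Γ := glue m Z₁ Z₂ a b)
    (W := fun t => if t < t₂ then W₁ t else W₂ t)
    (fun τ _ => S.toModel_loopConnectionAt (had τ) (hbd τ)) ?_ (fun τ _ => ?_)).trans ?_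
  · simp [h0.trans h12, hW₁, ha0, hb0, hU0, hV0]
  · refine HasLogDerivWithinAt.mono (s := univ) ?_ (subset_univ _)
    rcases lt_or_ge τ t₂ with h | h
    · refine HasLogDerivWithinAt.congr (hasLogDerivAt_mul_of_rest hU0 S.k_zero (hU _) (hV _)
        (had τ).hasDerivAt (hbd τ).hasDerivAt (hleft τ h)) ?_ (if_pos h)
      rw [nhdsWithin_univ]
      filter_upwards [Iio_mem_nhds h] with t ht using if_pos ht
    · obtain ⟨κ, hκ⟩ := exists_hasLogDerivAt_spanL S.smooth_k (a τ)
      have h' := h12.trans_le h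
      refine HasLogDerivWithinAt.congr ((hasLogDerivAt_conj_mul_of_rest hV0 hκ (hU _) (hV _)
        (had τ).hasDerivAt (hbd τ).hasDerivAt (hright τ h')).mul_const c) ?_ (if_neg (not_lt.2 h))
      rw [nhdsWithin_univ]
      filter_upwards [Ioi_mem_nhds h'] with t ht
      by_cases h5 : t < t₂
      · exact (if_pos h5).trans (hagree t ⟨le_of_lt ht, h5.le⟩)
      · exact if_neg h5
  · simp [h2.le, hW₂, ha1, hb1, hU0, hV0, S.k_zero]

/-- A reparametrisation can delay the second variation relative to the first. Its invariance forces
the transports of the two variations to commute. -/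
theorem commute_of_rFlat (hR : RFlat A B p₀) {U V : ℝ → G} (hU0 : U 0 = 1) (hV0 : V 0 = 1)
    (hU : ∀ a, HasLogDerivAt U (spanL (-loopForm B q₁ 0 m a)) a)
    (hV : ∀ b, HasLogDerivAt V (spanL (-loopForm B q₂ m (2 * Real.pi) b)) b) (α β : ℝ) :
    V β * (k α * U α) = k α * U α * V β := by
  have hpi := Real.pi_gt_three
  -- the delay acts in the time interval `[1, 5]` and at the parameters after `m`
  obtain ⟨ρ, hρ, hρ0, hρ1, -⟩ := exists_smooth_zero_one (s := Iic m ∪ Ici (2 * Real.pi))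
    (t := Icc m₂ m₃) (isClosed_Iic.union isClosed_Ici) isClosed_Icc
    (disjoint_left.2 fun x hx hx' => hx.elim
      (fun h => absurd (S.lt_right.trans_le hx'.1) (not_lt.2 h))
      (fun h => absurd (hx'.2.trans_lt S.end_lt) (not_lt.2 h)))
  obtain ⟨κ, hκ, hκ0, hκ1, hκI⟩ := exists_smooth_zero_one (s := Iic 1 ∪ Ici 5)
    (t := Icc 2 4) (isClosed_Iic.union isClosed_Ici) isClosed_Icc
    (disjoint_left.2 fun x hx hx' => hx.elim
      (fun h => by have := mem_Iic.1 h; linarith [hx'.1])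
      (fun h => by have := mem_Ici.1 h; linarith [hx'.2]))
  set v : ℝ × ℝ → ℝ × ℝ := fun z => (0, ρ z.1 * κ z.2) with hv
  have hvs : ContDiff ℝ ∞ v :=
    contDiff_const.prodMk ((hρ.comp contDiff_fst).mul (hκ.comp contDiff_snd))
  have hv0 : ∀ z ∉ interior square, v z = 0 := by
    intro z hz
    have hz' : ρ z.1 * κ z.2 = 0 := by
      rw [interior_square] at hz
      by_contra hne
      obtain ⟨hne1, hne2⟩ := mul_ne_zero_iff.1 hne
      refine hz ⟨⟨?_, ?_⟩, ⟨?_, ?_⟩⟩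
      · by_contra hcon
        exact hne1 (hρ0 _ (Or.inl ((not_lt.1 hcon).trans (S.pos.trans S.lt_left).le)))
      · by_contra hcon
        exact hne1 (hρ0 _ (Or.inr (not_lt.1 hcon)))
      · by_contra hcon
        exact hne2 (hκ0 _ (Or.inl ((not_lt.1 hcon).trans zero_le_one)))
      · by_contra hcon
        exact hne2 (hκ0 _ (Or.inr (le_trans (by linarith) (not_lt.1 hcon))))
    simp [hv, hz']
  obtain ⟨ε₀, hε₀, hrep⟩ := exists_isReparametrization hvs hv0
  set ε : ℝ := min ε₀ (1 / 5) with hε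
  have hεpos : 0 < ε := lt_min hε₀ (by norm_num)
  obtain ⟨a, b, b', t₁, t₂, ha, hb, hb', hshift, ht₁, ht₁₂, ht₂, hends, hrest, hleft, hright, hmid⟩ :=
    exists_time_profiles hκI hκ1 hεpos (min_le_right _ _)
  have hda (t : ℝ) : deriv (fun t => α * a t) t = α * deriv a t :=
    deriv_const_mul _ (ha.differentiable (by simp) t)
  have hdb' (t : ℝ) : deriv (fun t => β * b' t) t = β * deriv b' t :=
    deriv_const_mul _ (hb'.differentiable (by simp) t)
  have hα : ContDiff ℝ ∞ fun t => α * a t := contDiff_const.mul ha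
  have hβ : ContDiff ℝ ∞ fun t => β * b t := contDiff_const.mul hb
  have hβ' : ContDiff ℝ ∞ fun t => β * b' t := contDiff_const.mul hb'
  have hends₁ : ∀ t ∈ ({0, 2 * Real.pi} : Set ℝ), α * a t = 0 ∧ β * b t = 0 := fun t ht => by
    simp [hends t ht]
  have hends₂ : ∀ t ∈ ({0, 2 * Real.pi} : Set ℝ), α * a t = 0 ∧ β * b' t = 0 := fun t ht => by
    simp [hends t ht]
  have h1 := S.holonomy_glue_of_rest hU0 hV0 hU hV hα hβ hends₁ (fun t => by
    rw [hda]
    exact (hrest t).imp (fun h => by rw [h, mul_zero]) (fun h => by rw [h, mul_zero]))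
  have h2 := S.holonomy_glue_of_rectangle hU0 hV0 hU hV hα hβ' hends₂ ht₁ ht₁₂ ht₂
    (α := α) (β := β)
    (fun t ht => by
      rw [hdb']
      exact (hleft t ht).imp (fun h => by rw [h, mul_zero]) (fun h => by rw [h, mul_zero]))
    (fun t ht => by
      rw [hda]
      exact (hright t ht).imp (fun h => by rw [h, mul_zero]) (fun h => by rw [h, mul_zero]))
    (fun t ht => by simp [hmid t ht])
  have hcomp : glue m Z₁ Z₂ (fun t => α * a t) (fun t => β * b t) ∘ (fun z => z + ε • v z) =
      glue m Z₁ Z₂ (fun t => α * a t) (fun t => β * b' t) := by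
    ext ⟨σ, τ⟩
    have h3 : (σ, τ) + ε • v (σ, τ) = (σ, τ + ε * (ρ σ * κ τ)) := by simp [hv]
    rw [Function.comp_apply, h3]
    rcases lt_or_ge σ m with h | h
    · rw [S.glue_left _ _ (h.trans S.lt_right), S.glue_left _ _ (h.trans S.lt_right),
        hρ0 σ (Or.inl h.le), zero_mul, mul_zero, add_zero]
    · have h' := S.lt_left.trans_le h
      rw [S.glue_right _ _ h', S.glue_right _ _ h']
      rcases lt_or_ge σ m₂ with h4 | h4
      · rw [S.const₂ _ _ h4, S.const₂ _ (β * b' τ) h4]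
      · rcases lt_or_ge m₃ σ with h5 | h5
        · rw [S.const_end _ _ h5, S.const_end _ (β * b' τ) h5]
        · rw [hρ1 σ ⟨h4, h5⟩, one_mul, hshift]
  have h3 := hR _ (S.isLoopOfLoops hα hβ hends₁) _ (hrep ε hεpos.le (min_le_left _ _))
  rw [hcomp, h1, h2, inv_mul_eq_one] at h3
  have h4 := congrArg (fun g => k α * g) h3
  simpa only [mul_inv_cancel_left, mul_assoc] using h4

/-- The infinitesimal form of the commutation. -/
theorem adL_eq_zero_of_rFlat (hR : RFlat A B p₀) {κ : EG} (hκ : HasLogDerivAt k (spanL κ) 0) :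
    adL EG G (κ - loopForm B q₁ 0 m 0) (loopForm B q₂ m (2 * Real.pi) 0) = 0 := by
  obtain ⟨U, hU0, hU⟩ := exists_hasLogDerivAt (G := G)
    (contDiff_loopForm B S.lift₁ 0 m).neg.continuous 1
  obtain ⟨V, hV0, hV⟩ := exists_hasLogDerivAt (G := G)
    (contDiff_loopForm B S.lift₂ m (2 * Real.pi)).neg.continuous 1
  have hcomm := S.commute_of_rFlat hR hU0 hV0 hU hV
  set w := loopForm B q₂ m (2 * Real.pi) 0 with hw
  -- the derivative of the commutation in `β`
  have h1 (α : ℝ) : AdL (k α * U α) w = w := by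
    have h2 : HasLogDerivAt (fun β => k α * U α * V β) _ 0 :=
      HasLogDerivWithinAt.mul (hasLogDerivWithinAt_const (k α * U α)) (hV 0)
    have h3 : HasLogDerivAt (fun β => V β * (k α * U α)) _ 0 :=
      HasLogDerivWithinAt.mul_const (hV 0) (k α * U α)
    simp only [hcomm α] at h3
    have h4 := DFunLike.congr_fun (h2.unique_at h3) 1
    simpa [hw] using h4
  -- the derivative in `α`
  have h2 := hκ.mul_curve (hU 0)
  have h3 := (HasLogDerivWithinAt.AdL_apply h2 (hasFDerivWithinAt_const w 0 univ)).hasFDerivAt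
    univ_mem
  simp only [h1] at h3
  have h4 := DFunLike.congr_fun (h3.unique (hasFDerivAt_const w 0)) 1
  simpa [S.k_zero, AdL_one, sub_eq_add_neg] using h4

end SeparatedVariations
end Holonomies

/-! ### Localisation, and from r-flatness to curvature locality -/

section Localisation

/-- A compact subset of an open interval lies in a smaller closed interval. -/
theorem exists_Icc_of_isCompact {K : Set ℝ} (hK : IsCompact K) {a b : ℝ} (hab : a < b)
    (h : K ⊆ Ioo a b) : ∃ a' b', a < a' ∧ a' < b' ∧ b' < b ∧ K ⊆ Icc a' b' := by
  rcases K.eq_empty_or_nonempty with rfl | hne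
  · obtain ⟨c, hac, hcb⟩ := exists_between hab
    obtain ⟨d, hcd, hdb⟩ := exists_between hcb
    exact ⟨c, d, hac, hcd, hdb, empty_subset _⟩
  · obtain ⟨x, hx⟩ := hK.exists_isLeast hne
    obtain ⟨y, hy⟩ := hK.exists_isGreatest hne
    obtain ⟨d, hyd, hdb⟩ := exists_between (h hy.1).2
    exact ⟨x, d, (h hx.1).1, (hx.2 hy.1).trans_lt hyd, hdb,
      fun z hz => ⟨hx.2 hz, (hy.2 hz).trans hyd.le⟩⟩

/-- A continuous function that integrates to zero against all test functions on an interval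
vanishes on the interval. -/
theorem eq_zero_of_integral_smul {E : Type*} [NormedAddCommGroup E] [NormedSpace ℝ E]
    [CompleteSpace E] {f : ℝ → E} (hf : Continuous f) {a b : ℝ} (hab : a < b)
    (h : ∀ ρ : ℝ → ℝ, ContDiff ℝ ∞ ρ → HasCompactSupport ρ → tsupport ρ ⊆ Ioo a b →
      ∫ x in a..b, ρ x • f x = 0) : ∀ x ∈ Icc a b, f x = 0 := by
  have h1 : ∀ᵐ x ∂(MeasureTheory.volume : MeasureTheory.Measure ℝ), x ∈ Ioo a b → f x = 0 := by
    refine isOpen_Ioo.ae_eq_zero_of_integral_contDiff_smul_eq_zero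
      (hf.locallyIntegrable.locallyIntegrableOn _) fun ρ hρ hρc hρs => ?_
    rw [← h ρ hρ hρc hρs, intervalIntegral.integral_of_le hab.le]
    refine (MeasureTheory.setIntegral_eq_integral_of_forall_compl_eq_zero fun x hx => ?_).symm
    rw [image_eq_zero_of_notMem_tsupport (fun hx' => hx (Ioo_subset_Ioc_self (hρs hx'))), zero_smul]
  have h2 : EqOn f (fun _ => 0) (Ioo a b) :=
    MeasureTheory.Measure.eqOn_Ioo_of_ae_eq (μ := MeasureTheory.volume)
      ((MeasureTheory.ae_restrict_iff' measurableSet_Ioo).2 h1) hf.continuousOn continuousOn_const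
  intro x hx
  have h3 := h2.closure hf continuous_const
  rw [closure_Ioo hab.ne] at h3
  exact h3 hx

theorem intervalIntegrable_smul {E : Type*} [NormedAddCommGroup E] [NormedSpace ℝ E] {ρ : ℝ → ℝ}
    (hρ : ContDiff ℝ ∞ ρ) {f : ℝ → E} (hf : Continuous f) (a b : ℝ) :
    IntervalIntegrable (fun x => ρ x • f x) MeasureTheory.volume a b :=
  (hρ.continuous.smul hf).intervalIntegrable a b

end Localisation

section Backward

variable {EM EP EG : Type*}
  [NormedAddCommGroup EM] [NormedSpace ℝ EM] [FiniteDimensional ℝ EM]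
  [NormedAddCommGroup EP] [NormedSpace ℝ EP] [FiniteDimensional ℝ EP]
  [NormedAddCommGroup EG] [NormedSpace ℝ EG] [FiniteDimensional ℝ EG]
  {M P G : Type*}
  [TopologicalSpace M] [ChartedSpace EM M] [IsManifold 𝓘(ℝ, EM) ∞ M]
  [TopologicalSpace P] [ChartedSpace EP P] [IsManifold 𝓘(ℝ, EP) ∞ P] [T2Space P]
  [TopologicalSpace G] [ChartedSpace EG G] [Group G] [LieGroup 𝓘(ℝ, EG) ∞ G] [T2Space G]
  {Q : PrincipalBundle EM EP EG M P G} {A : Connection Q} {B : AdjointTwoForm Q} {p₀ : P}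

theorem Connection.baseCurvature_smul_right (A : Connection Q) (p : P) (u v : EM) (c : ℝ) :
    A.baseCurvature p u (c • v) = c • A.baseCurvature p u v := by
  have h1 : A.curvatureL p (A.horizontalL p u) (c • A.horizontalL p v) =
      c • A.curvatureL p (A.horizontalL p u) (A.horizontalL p v) := by
    simp only [Connection.curvatureL, map_smul, smul_apply]
    module
  rwa [A.curvatureL_eq_baseCurvature, map_smul, (A.horizontalL_spec p u).1,
    (A.horizontalL_spec p v).1] at h1

/-- A horizontal lift of a smooth curve is smooth. -/
theorem contMDiff_of_isHorizontalAt {x : ℝ → M} (hx : ContMDiff 𝓘(ℝ, ℝ) 𝓘(ℝ, EM) ∞ x) {p : ℝ → P}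
    (hp : ∀ t, IsHorizontalAt A x p t) : ContMDiff 𝓘(ℝ, ℝ) 𝓘(ℝ, EP) ∞ p := by
  obtain ⟨q, hq, hproj, hstart, hhor⟩ := exists_horizontal_family A (Λ := ℝ)
    (X := fun z : ℝ × ℝ => x z.1) (hx.comp contDiff_fst.contMDiff) (q₀ := fun _ => p 0)
    contMDiff_const (fun _ => (hp 0).1.self_of_nhds)
  have h (t : ℝ) := isHorizontalAt_act_slice hq hproj hhor 1 0 t
  simp only [Q.act_one] at h
  have h1 := horizontalLift_eq A h
  rw [hstart, horizontalLift_eq A hp] at h1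
  rw [h1]
  exact hq.comp (contDiff_prodMk_left (0 : ℝ)).contMDiff

/-- Along a variation of a curve, the two-form and the curvature depend continuously on the
parameter. -/
theorem continuous_bilin_sub_baseCurvature {x : ℝ → M} (hx : ContMDiff 𝓘(ℝ, ℝ) 𝓘(ℝ, EM) ∞ x)
    {p : ℝ → P} (hp : ∀ t, IsHorizontalAt A x p t) {Y : ℝ × ℝ → M}
    (hY : ContMDiff 𝓘(ℝ, ℝ × ℝ) 𝓘(ℝ, EM) ∞ Y) (hY0 : ∀ σ, Y (σ, 0) = x σ) :
    (Continuous fun σ => B.bilin (p σ) (modelDeriv x σ (1 : ℝ))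
      (modelDeriv (fun a => Y (σ, a)) 0 (1 : ℝ))) ∧
    Continuous fun σ => A.baseCurvature (p σ) (modelDeriv x σ (1 : ℝ))
      (modelDeriv (fun a => Y (σ, a)) 0 (1 : ℝ)) := by
  -- lift the variation transversally, in the direction of its parameter
  obtain ⟨r, hr, hproj, hstart, hhor⟩ := exists_horizontal_family A (Λ := ℝ)
    (X := fun z : ℝ × ℝ => Y (z.2, z.1)) (hY.comp (contDiff_snd.prodMk contDiff_fst).contMDiff)
    (contMDiff_of_isHorizontalAt hx hp) (fun l => by rw [hY0, (hp l).1.self_of_nhds])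
  have h1 (σ : ℝ) : modelDeriv (fun a => Y (σ, a)) 0 (1 : ℝ) = Q.baseDeriv r (0, σ) (1, 0) :=
    (modelDeriv_slices (a := fun t => t) (X := fun z : ℝ × ℝ => Y (z.2, z.1)) hr hproj
      differentiableAt_id 0).1
  have h2 (σ : ℝ) : modelDeriv x σ (1 : ℝ) = Q.baseDeriv r (0, σ) (0, 1) := by
    have h3 := (modelDeriv_slices (a := fun t => t) (X := fun z : ℝ × ℝ => Y (z.2, z.1)) (τ := σ) hr
      hproj differentiableAt_id 0).2
    simp only [hY0, deriv_id'', one_smul] at h3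
    exact h3
  have hpr (σ : ℝ) : p σ = r (0, σ) := (hstart σ).symm
  have hl : Continuous fun σ : ℝ => ((0 : ℝ), σ) := by fun_prop
  simp only [h1, h2, hpr, A.baseCurvature_modelDeriv (hr _)]
  have has : ContDiff ℝ ∞ (A.pullForm r) := A.contDiff_pullForm hr
  have hac (u : ℝ × ℝ) : Continuous fun σ : ℝ => A.pullForm r (0, σ) u :=
    (has.continuous.comp hl).clm_apply continuous_const
  have hdc (u v : ℝ × ℝ) : Continuous fun σ : ℝ => fderiv ℝ (A.pullForm r) (0, σ) u v :=
    (((has.continuous_fderiv (by simp)).comp hl).clm_apply continuous_const).clm_apply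
      continuous_const
  refine ⟨(B.contDiff_pull hr (0, 1) (1, 0)).continuous.comp hl, ?_⟩
  exact ((hdc _ _).sub (hdc _ _)).add (((adL EG G).continuous.comp (hac _)).clm_apply (hac _))

/-- The velocity of a variation that is scaled by a function of the parameter of the curve. -/
theorem modelDeriv_scaled {Y : ℝ × ℝ → M} (hY : ContMDiff 𝓘(ℝ, ℝ × ℝ) 𝓘(ℝ, EM) ∞ Y) (σ c : ℝ) :
    (modelDeriv (fun a => Y (σ, a * c)) 0 (1 : ℝ) : EM) =
      c • modelDeriv (fun a => Y (σ, a)) 0 (1 : ℝ) := by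
  have h1 : HasDerivAt (fun a : ℝ => a * c) c 0 := by
    simpa using (hasDerivAt_id (0 : ℝ)).mul_const c
  have h2 := modelDeriv_comp (g := fun a => Y (σ, a)) (f := fun a : ℝ => a * c) (x := 0)
    ((hY.comp (contDiff_prodMk_right σ).contMDiff).mdifferentiable (by simp) _)
    h1.differentiableAt.mdifferentiableAt
  rw [h2, modelDeriv_eq_fderiv, h1.hasFDerivAt.fderiv, zero_mul, ← map_smul]
  exact congrArg (modelDeriv (fun a => Y (σ, a)) 0) (by simp)

/-- The derivatives at the parameter `0` of the projection of a family of lifts of a scaled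
variation. -/
theorem baseDeriv_scaled {x : ℝ → M} {Y : ℝ × ℝ → M}
    (hY : ContMDiff 𝓘(ℝ, ℝ × ℝ) 𝓘(ℝ, EM) ∞ Y) (hY0 : ∀ σ, Y (σ, 0) = x σ) {ρ : ℝ → ℝ}
    {q : ℝ × ℝ → P} (hq : ContMDiff 𝓘(ℝ, ℝ × ℝ) 𝓘(ℝ, EP) ∞ q)
    (hproj : ∀ z, Q.proj (q z) = Y (z.1, z.2 * ρ z.1)) (σ : ℝ) :
    Q.baseDeriv q (σ, 0) (1, 0) = modelDeriv x σ (1 : ℝ) ∧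
      Q.baseDeriv q (σ, 0) (0, 1) = ρ σ • modelDeriv (fun a => Y (σ, a)) 0 (1 : ℝ) := by
  obtain ⟨h1, h2⟩ := modelDeriv_slices (a := fun t => t) (τ := 0)
    (X := fun z : ℝ × ℝ => Y (z.1, z.2 * ρ z.1)) hq hproj differentiableAt_id σ
  simp only [zero_mul, hY0, deriv_id'', one_smul] at h1 h2
  exact ⟨h1.symm, h2.symm.trans (modelDeriv_scaled hY σ (ρ σ))⟩

/-- The smeared form of curvature locality: two variations of a loop, supported before and after
the parameter `m`. -/
theorem adL_integral_eq_zero_of_rFlat (hR : RFlat A B p₀) {x : ℝ → M}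
    (hx : IsLoop EM (Q.proj p₀) x) {p : ℝ → P} (hp0 : p 0 = p₀) (hp : ∀ t, IsHorizontalAt A x p t)
    {m : ℝ} (hm : m ∈ Ioo 0 (2 * Real.pi)) {Y₁ Y₂ : ℝ × ℝ → M}
    (hY₁ : ContMDiff 𝓘(ℝ, ℝ × ℝ) 𝓘(ℝ, EM) ∞ Y₁) (hY₁x : ∀ σ, Y₁ (σ, 0) = x σ)
    (hY₂ : ContMDiff 𝓘(ℝ, ℝ × ℝ) 𝓘(ℝ, EM) ∞ Y₂) (hY₂x : ∀ σ, Y₂ (σ, 0) = x σ)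
    {ρ₁ ρ₂ : ℝ → ℝ} (hρ₁ : ContDiff ℝ ∞ ρ₁) (hc₁ : HasCompactSupport ρ₁)
    (hs₁ : tsupport ρ₁ ⊆ Ioo 0 m) (hρ₂ : ContDiff ℝ ∞ ρ₂) (hc₂ : HasCompactSupport ρ₂)
    (hs₂ : tsupport ρ₂ ⊆ Ioo m (2 * Real.pi)) :
    adL EG G
      (∫ σ in 0..m, ρ₁ σ • (B.bilin (p σ) (modelDeriv x σ (1 : ℝ))
          (modelDeriv (fun a => Y₁ (σ, a)) 0 (1 : ℝ)) -
        A.baseCurvature (p σ) (modelDeriv x σ (1 : ℝ))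
          (modelDeriv (fun a => Y₁ (σ, a)) 0 (1 : ℝ))))
      (∫ σ in m..(2 * Real.pi), ρ₂ σ • B.bilin (p σ) (modelDeriv x σ (1 : ℝ))
        (modelDeriv (fun a => Y₂ (σ, a)) 0 (1 : ℝ))) = 0 := by
  have : CompleteSpace EG := FiniteDimensional.complete ℝ EG
  obtain ⟨hb₁, hF₁⟩ := continuous_bilin_sub_baseCurvature (A := A) (B := B) hx.smooth hp hY₁ hY₁x
  obtain ⟨n, m₁, hn, hnm₁, hm₁, hK₁⟩ := exists_Icc_of_isCompact hc₁ hm.1 hs₁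
  obtain ⟨m₂, m₃, hm₂, hm₂₃, hm₃, hK₂⟩ := exists_Icc_of_isCompact hc₂ hm.2 hs₂
  have hz₁ {σ : ℝ} (h : σ ≤ 0 ∨ m₁ < σ) : ρ₁ σ = 0 := image_eq_zero_of_notMem_tsupport fun h' =>
    h.elim (fun h => by linarith [(hK₁ h').1]) (fun h => by linarith [(hK₁ h').2])
  have hz₂ {σ : ℝ} (h : σ < m₂ ∨ m₃ < σ) : ρ₂ σ = 0 := image_eq_zero_of_notMem_tsupport fun h' =>
    h.elim (fun h => by linarith [(hK₂ h').1]) (fun h => by linarith [(hK₂ h').2])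
  have hsm {ρ : ℝ → ℝ} (hρ : ContDiff ℝ ∞ ρ) :
      ContDiff ℝ ∞ fun z : ℝ × ℝ => (z.1, z.2 * ρ z.1) :=
    contDiff_fst.prodMk (contDiff_snd.mul (hρ.comp contDiff_fst))
  obtain ⟨q₁, q₂, k, S⟩ := exists_separatedVariations (p₀ := p₀) A (m₁ := m₁) (m := m) (m₂ := m₂)
    (m₃ := m₃) (Z₁ := fun z => Y₁ (z.1, z.2 * ρ₁ z.1)) (Z₂ := fun z => Y₂ (z.1, z.2 * ρ₂ z.1))
    (hn.trans hnm₁) hm₁ hm₂ hm₂₃ hm₃ (hY₁.comp (hsm hρ₁).contMDiff) (hY₂.comp (hsm hρ₂).contMDiff)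
    (fun σ => by simp only [zero_mul, hY₁x, hY₂x])
    (fun σ a h => by simp only [hz₁ (Or.inr h), mul_zero])
    (fun σ b h => by simp only [hz₂ (Or.inl h), mul_zero])
    (fun σ b h => by simp only [hz₂ (Or.inr h), mul_zero])
    (fun a => by simp only [hz₁ (Or.inl le_rfl), mul_zero, hY₁x, hx.start])
    (by simp only [zero_mul, hY₂x, hx.finish])
  -- at the parameter `0` both lifts are that of the loop
  have hq₁p : ∀ σ, q₁ (σ, 0) = p σ := by
    have h (t : ℝ) := isHorizontalAt_act_slice S.lift₁ S.proj₁ S.hor₁ 1 0 t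
    simp only [Q.act_one, zero_mul, hY₁x] at h
    have h1 := horizontalLift_eq A h
    rw [S.start₁, ← hp0, horizontalLift_eq A hp] at h1
    exact fun σ => (congrFun h1 σ).symm
  have hD₁ := baseDeriv_scaled hY₁ hY₁x S.lift₁ S.proj₁
  have hD₂ := baseDeriv_scaled hY₂ hY₂x S.lift₂ S.proj₂
  have hU : loopForm B q₁ 0 m 0 = ∫ σ in 0..m, ρ₁ σ • B.bilin (p σ) (modelDeriv x σ (1 : ℝ))
      (modelDeriv (fun a => Y₁ (σ, a)) 0 (1 : ℝ)) := by
    refine intervalIntegral.integral_congr fun σ _ => ?_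
    simp only [AdjointTwoForm.pull]
    rw [(hD₁ σ).1, (hD₁ σ).2, map_smul, hq₁p]
  have hV : loopForm B q₂ m (2 * Real.pi) 0 =
      ∫ σ in m..(2 * Real.pi), ρ₂ σ • B.bilin (p σ) (modelDeriv x σ (1 : ℝ))
        (modelDeriv (fun a => Y₂ (σ, a)) 0 (1 : ℝ)) := by
    refine intervalIntegral.integral_congr fun σ _ => ?_
    simp only [AdjointTwoForm.pull]
    rw [(hD₂ σ).1, (hD₂ σ).2, map_smul, ← S.same_lift, hq₁p]
  -- the logarithmic derivative of `k` is the integral of the curvature over the first variation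
  obtain ⟨κ, hκ⟩ := exists_hasLogDerivAt_spanL S.smooth_k 0
  have hslice (σ : ℝ) : A.pullForm (fun a => q₁ (σ, a)) 0 (1 : ℝ) = A.pullForm q₁ (σ, 0) (0, 1) := by
    rw [A.pullForm_comp (q := q₁) (H := fun a : ℝ => (σ, a)) (S.lift₁.mdifferentiable (by simp) _)
      (hasFDerivAt_prodMk_right σ 0).differentiableAt, (hasFDerivAt_prodMk_right σ (0 : ℝ)).fderiv]
    rfl
  have hκ₁ : κ = A.pullForm q₁ (m, 0) (0, 1) := by
    rw [← hslice, ← funext (fun a => S.act_k m ⟨S.lt_left, S.lt_right⟩ a 0),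
      A.pullForm_act (q := fun _ => q₂ (m, 0)) mdifferentiableAt_const hκ, S.k_zero]
    simp [AdL_one, Connection.pullForm, modelDeriv_const]
  have hκ₀ : A.pullForm q₁ (0, 0) (0, 1) = 0 := by
    rw [← hslice, funext S.start₁, Connection.pullForm, modelDeriv_const]
    simp
  have hκF : κ = ∫ σ in 0..m, ρ₁ σ • A.baseCurvature (p σ) (modelDeriv x σ (1 : ℝ))
      (modelDeriv (fun a => Y₁ (σ, a)) 0 (1 : ℝ)) := by
    rw [intervalIntegral.integral_eq_sub_of_hasDerivAt
      (f := fun σ => A.pullForm q₁ (σ, 0) (0, 1)) (fun σ _ => ?_)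
      (intervalIntegrable_smul hρ₁ hF₁ _ _), hκ₀, sub_zero, hκ₁]
    have h := hasDerivAt_pullForm_of_horizontal S.lift₁ S.hor₁ σ 0 (0, 1)
    rwa [(hD₁ σ).1, (hD₁ σ).2, A.baseCurvature_smul_right, hq₁p] at h
  have hfin := S.adL_eq_zero_of_rFlat hR hκ
  rw [hU, hV, hκF, ← intervalIntegral.integral_sub
    (intervalIntegrable_smul hρ₁ hF₁ _ _)
    (intervalIntegrable_smul hρ₁ hb₁ _ _)] at hfin
  rw [← neg_eq_zero, ← neg_apply, ← map_neg, ← intervalIntegral.integral_neg]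
  simpa only [smul_sub, neg_sub] using hfin

/-- Between the two parameters choose `m`, vary the loop on both sides of `m`, and localise the smeared
form of the condition at the parameters. -/
theorem curvatureLocal_of_rFlat (hR : RFlat A B p₀) : CurvatureLocal A B p₀ := by
  have : CompleteSpace EG := FiniteDimensional.complete ℝ EG
  refine curvatureLocal_iff.2 fun x hx p hp0 hp σ₂ hσ₂ σ₁ hσ₁ h12 u v => ?_
  obtain ⟨m, h1m, hm2⟩ := exists_between h12
  have hm : m ∈ Ioo 0 (2 * Real.pi) := ⟨hσ₁.1.trans_lt h1m, hm2.trans_le hσ₂.2⟩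
  obtain ⟨Y₁, hY₁, hY₁x, c₁, hc₁, hd₁⟩ := exists_variation hx.smooth σ₁ u
  obtain ⟨Y₂, hY₂, hY₂x, c₂, hc₂, hd₂⟩ := exists_variation hx.smooth σ₂ v
  obtain ⟨hb₁, hF₁⟩ := continuous_bilin_sub_baseCurvature (A := A) (B := B) hx.smooth hp hY₁ hY₁x
  obtain ⟨hb₂, -⟩ := continuous_bilin_sub_baseCurvature (A := A) (B := B) hx.smooth hp hY₂ hY₂x
  have hsmear := fun {ρ₁ ρ₂ : ℝ → ℝ} => adL_integral_eq_zero_of_rFlat (ρ₁ := ρ₁) (ρ₂ := ρ₂) hR hx hp0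
    hp hm hY₁ hY₁x hY₂ hY₂x
  set f : ℝ → EG := fun σ => B.bilin (p σ) (modelDeriv x σ (1 : ℝ))
      (modelDeriv (fun a => Y₁ (σ, a)) 0 (1 : ℝ)) -
    A.baseCurvature (p σ) (modelDeriv x σ (1 : ℝ))
      (modelDeriv (fun a => Y₁ (σ, a)) 0 (1 : ℝ)) with hf
  set g : ℝ → EG := fun σ => B.bilin (p σ) (modelDeriv x σ (1 : ℝ))
      (modelDeriv (fun a => Y₂ (σ, a)) 0 (1 : ℝ)) with hg
  have hfc : Continuous f := hb₁.sub hF₁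
  have key : adL EG G (f σ₁) (g σ₂) = 0 := by
    refine eq_zero_of_integral_smul (f := fun σ => adL EG G (f σ) (g σ₂))
      (((adL EG G).continuous.comp hfc).clm_apply continuous_const) hm.1
      (fun ρ₁ hρ₁ hρ₁c hρ₁s => ?_) σ₁ ⟨hσ₁.1, h1m.le⟩
    have hint₁ := intervalIntegrable_smul hρ₁ hfc 0 m
    have h1 : ∫ σ in 0..m, ρ₁ σ • adL EG G (f σ) (g σ₂) =
        adL EG G (∫ σ in 0..m, ρ₁ σ • f σ) (g σ₂) := by
      have h2 := ((adL EG G).flip (g σ₂)).intervalIntegral_comp_comm hint₁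
      simpa using h2
    rw [h1]
    refine eq_zero_of_integral_smul (f := fun σ => adL EG G (∫ σ in 0..m, ρ₁ σ • f σ) (g σ))
      (continuous_const.clm_apply hb₂) hm.2
      (fun ρ₂ hρ₂ hρ₂c hρ₂s => ?_) σ₂ ⟨hm2.le, hσ₂.2⟩
    have hint₂ := intervalIntegrable_smul hρ₂ hb₂ m (2 * Real.pi)
    have h3 := (adL EG G (∫ σ in 0..m, ρ₁ σ • f σ)).intervalIntegral_comp_comm hint₂
    simp only [map_smul] at h3
    rw [h3]
    exact hsmear hρ₁ hρ₁c hρ₁s hρ₂ hρ₂c hρ₂s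
  rw [hf, hg] at key
  simp only at key
  rw [hd₁, hd₂, map_smul, map_smul, A.baseCurvature_smul_right, ← smul_sub, map_smul, map_smul,
    smul_apply, smul_smul] at key
  exact (smul_eq_zero.1 key).resolve_left (mul_ne_zero hc₂ hc₁)

end Backward

end LoopSpace

end

theorem mainTheorem1
    {EM EP EG : Type*}
    [NormedAddCommGroup EM] [NormedSpace ℝ EM] [FiniteDimensional ℝ EM]
    [NormedAddCommGroup EP] [NormedSpace ℝ EP] [FiniteDimensional ℝ EP]
    [NormedAddCommGroup EG] [NormedSpace ℝ EG] [FiniteDimensional ℝ EG]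
    {M P G : Type*}
    [TopologicalSpace M] [ChartedSpace EM M] [IsManifold 𝓘(ℝ, EM) ∞ M]
    [T2Space M] [SecondCountableTopology M]
    [TopologicalSpace P] [ChartedSpace EP P] [IsManifold 𝓘(ℝ, EP) ∞ P]
    [T2Space P] [SecondCountableTopology P]
    [TopologicalSpace G] [ChartedSpace EG G] [Group G] [LieGroup 𝓘(ℝ, EG) ∞ G]
    [T2Space G] [SecondCountableTopology G]
    (Q : LoopSpace.PrincipalBundle EM EP EG M P G)
    (A : LoopSpace.Connection Q) (B : LoopSpace.AdjointTwoForm Q)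
    (p₀ : P) :
    LoopSpace.CurvatureLocal A B p₀ ↔ LoopSpace.RFlat A B p₀ := by
  exact ⟨LoopSpace.rFlat_of_curvatureLocal, LoopSpace.curvatureLocal_of_rFlat⟩
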